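/- **Conventions.** Fix a universe of small sets. Let $V$ be a locally small category with small coproducts. $V$ is *extensive* if for every small family $(X_i)_{i\in I}$ of objects the functor $\prod_i V/X_i\to V/\coprod_i X_i$, $(f_i:Y_i\to X_i)\mapsto \coprod_i f_i$, is an equivalence, and *lextensive* if it moreover has finite limits. $MV$ is the category of finite sequences (possibly empty) of objects of $V$, the maps being the sequences of maps of $V$ between sequences of the same length. A *multitensor* on $V$ is a functor $E:MV\to V$, with natural maps $u_Z:Z\to E(Z)$ and $\sigma_{Z_{ij}}:E_iE_jZ_{ij}\to E_{ij}Z_{ij}$ which satisfy the unit laws $\sigma\circ u_{E(Z_1,\dots,Z_n)}=1=\sigma\circ E_i(u_{Z_i})$ and the associativity law $\sigma\circ\sigma=\sigma\circ E_i(\sigma)$ (a lax monoidal structure). $E$ is *distributive* if each $(X_1,\dots,X_n)\mapsto E(X_1,\dots,X_n)$ preserves small coproducts in each variable. $E$ is *cartesian* if $E:MV\to V$ preserves pullbacks and all naturality squares of $u$ and $\sigma$ are pullbacks. A map of multitensors is a natural transformation compatible with $u$ and $\sigma$. For $E$ cartesian, an *$E$-multitensor* is a multitensor $A$ on $V$ with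 a map of multitensors $\alpha:A\to E$ all of whose naturality squares are pullbacks; $E\text{-}\mathrm{Mult}$ is the category of $E$-multitensors and maps of multitensors over $E$. $\mathcal GV$ is the category of $V$-graphs $X$: a small set $X_0$ of objects, and homs $X(a,b)\in V$ for $a,b\in X_0$. A monad on $\mathcal GV$ is *over* $\mathbf{Set}$ if it lives in $\mathbf{CAT}/\mathbf{Set}$ via $X\mapsto X_0$, so that $(TX)_0=X_0$ and its unit and multiplication are identities on objects. For a cartesian monad $T$ on $\mathcal GV$ over $\mathbf{Set}$, a *$T$-operad over $\mathbf{Set}$* is a monad $A$ on $\mathcal GV$ over $\mathbf{Set}$ with a monad map $\alpha:A\to T$, identity on objects, all of whose naturality squares are pullbacks; $T\text{-}\mathrm{Op}_{\mathbf{Set}}$ is the category of these and of monad maps over $T$. For a distributive multitensor $E$, $\Gamma E$ is the monad on $\mathcal GV$ over $\mathbf{Set}$ with $$\Gamma E(X)(a,b)=\coprod_{a=x_0,\dots,x_n=b}E\big(X(x_0,x_1),\dots,X(x_{n-1},x_n)\big)\qquad(n\ge 0),$$ with unit given by $u$ followed by the inclusion of the summand of the sequence $a,b$, and with multiplication given on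 the summands $E_iE_jX(x_{ij-1},x_{ij})$ of $(\Gamma E)^2X(a,b)$ by $\sigma$ followed by the inclusion of the summand of the concatenated sequence. A map $\alpha:A\to B$ of distributive multitensors induces a map of monads $\Gamma\alpha:\Gamma A\to\Gamma B$ over $\mathbf{Set}$, which on homs is $\coprod\alpha$. **Theorem.** (1) Let $V$ be lextensive and let $E$ be a cartesian distributive multitensor on $V$. Then $\Gamma E$ is a cartesian monad; for every $E$-multitensor $\alpha:A\to E$ the multitensor $A$ is distributive and $\Gamma\alpha:\Gamma A\to\Gamma E$ is a $\Gamma E$-operad over $\mathbf{Set}$; and the functor $(A,\alpha)\mapsto(\Gamma A,\Gamma\alpha)$ is an equivalence of categories $$\Gamma_E:\;E\text{-}\mathrm{Mult}\;\simeq\;\Gamma E\text{-}\mathrm{Op}_{\mathbf{Set}}.$$ (2) For a monad $T$ on a category with finite products let $T^\times$ be the multitensor $T^\times(X_1,\dots,X_n)=\prod_iTX_i$, with unit that of $T$ and with substitution the composite $\prod_iT\prod_jTX_{ij}\to\prod_i\prod_jT^2X_{ij}\to\prod_{ij}TX_{ij}$ of the product comparison maps and the multiplication of $T$. Let $\mathcal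 T_{\le 0}$ be the identity monad on $\mathbf{Set}$ and let $\mathcal T_{\le n+1}=\Gamma(\mathcal T_{\le n}^\times)$ on $\mathcal G^{n+1}\mathbf{Set}$ (the strict $n$-category monads). Then for every $n\in\mathbb N$ the category $\mathcal G^n\mathbf{Set}$ is lextensive, $\mathcal T_{\le n}^\times$ is a cartesian distributive multitensor (so that the recursion makes sense and (1) applies), $\mathcal T_{\le n+1}$ is a cartesian monad, and $\Gamma$ gives an equivalence $$\mathcal T_{\le n}^\times\text{-}\mathrm{Mult}\;\simeq\;\mathcal T_{\le n+1}\text{-}\mathrm{Op}_{\mathbf{Set}}$$ between $\mathcal T_{\le n}^\times$-multitensors and normalised $(n+1)$-operads. -/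

import Mathlib

open CategoryTheory CategoryTheory.Limits

universe w v u u₂

namespace MultitensorOperad

/-! ### The free strict monoidal category `M V` -/

section Sequences

/-- A map of sequences `(X₁, …, Xₙ) ⟶ (Y₁, …, Yₙ)` is a sequence of maps `Xᵢ ⟶ Yᵢ`; there are no
maps between sequences of different lengths. -/
def SeqHom {V : Type u} [Category.{v} V] : List V → List V → Type v
  | [], [] => PUnit
  | X :: Xs, Y :: Ys => (X ⟶ Y) × SeqHom Xs Ys
  | [], _ :: _ => PEmpty
  | _ :: _, [] => PEmpty

variable {V : Type u} [Category.{v} V]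

def SeqHom.id : (Xs : List V) → SeqHom Xs Xs
  | [] => PUnit.unit
  | X :: Xs => (𝟙 X, SeqHom.id Xs)

def SeqHom.comp : {Xs Ys Zs : List V} → SeqHom Xs Ys → SeqHom Ys Zs → SeqHom Xs Zs
  | [], [], [], _, _ => PUnit.unit
  | _ :: _, _ :: _, _ :: _, f, g => (f.1 ≫ g.1, SeqHom.comp f.2 g.2)

/-- The category `M V` of finite sequences of objects of `V`: the free strict monoidal category on
`V`, with concatenation of sequences as its tensor product. -/
instance seqCategory : Category.{v} (List V) where
  Hom := SeqHom
  id := SeqHom.id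
  comp := SeqHom.comp
  id_comp := by
    intro Xs Ys f
    induction Xs generalizing Ys with
    | nil => cases Ys with
      | nil => rfl
      | cons Y Ys => exact f.elim
    | cons X Xs ih => cases Ys with
      | nil => exact f.elim
      | cons Y Ys => exact Prod.ext (Category.id_comp _) (ih f.2)
  comp_id := by
    intro Xs Ys f
    induction Xs generalizing Ys with
    | nil => cases Ys with
      | nil => rfl
      | cons Y Ys => exact f.elim
    | cons X Xs ih => cases Ys with
      | nil => exact f.elim
      | cons Y Ys => exact Prod.ext (Category.comp_id _) (ih f.2)
  assoc := by
    intro Xs Ys Zs Ws f g h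
    induction Xs generalizing Ys Zs Ws with
    | nil =>
      cases Ys with
      | cons Y Ys => exact f.elim
      | nil => cases Zs with
        | cons Z Zs => exact g.elim
        | nil => cases Ws with
          | nil => rfl
          | cons W Ws => exact h.elim
    | cons X Xs ih =>
      cases Ys with
      | nil => exact f.elim
      | cons Y Ys => cases Zs with
        | nil => exact g.elim
        | cons Z Zs => cases Ws with
          | nil => exact h.elim
          | cons W Ws => exact Prod.ext (Category.assoc _ _ _) (ih f.2 g.2 h.2)

/-- The map of sequences with first entry `f` and remaining entries `g`. -/
def seqCons {X Y : V} {Xs Ys : List V} (f : X ⟶ Y) (g : Xs ⟶ Ys) : (X :: Xs) ⟶ (Y :: Ys) :=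
  (f, g)

lemma seqCons_comp {X Y Z : V} {Xs Ys Zs : List V} (f : X ⟶ Y) (g : Y ⟶ Z) (fs : Xs ⟶ Ys)
    (gs : Ys ⟶ Zs) : seqCons f fs ≫ seqCons g gs = seqCons (f ≫ g) (fs ≫ gs) := rfl

lemma seqCons_id (X : V) (Xs : List V) : seqCons (𝟙 X) (𝟙 Xs) = 𝟙 (X :: Xs) := rfl

lemma seqHom_nil_ext (f g : ([] : List V) ⟶ []) : f = g := rfl

/-- Every map of sequences is the empty one or of the form `seqCons f g`. -/
@[elab_as_elim]
lemma seqHom_induction {P : ∀ {Xs Ys : List V}, (Xs ⟶ Ys) → Prop}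
    (nil : P (𝟙 ([] : List V)))
    (cons : ∀ {X Y : V} {Xs Ys : List V} (f : X ⟶ Y) (g : Xs ⟶ Ys), P g → P (seqCons f g))
    {Xs Ys : List V} (f : Xs ⟶ Ys) : P f := by
  induction Xs generalizing Ys with
  | nil => cases Ys with
    | nil => exact nil
    | cons Y Ys => exact f.elim
  | cons X Xs ih => cases Ys with
    | nil => exact f.elim
    | cons Y Ys => exact cons f.1 f.2 (ih f.2)

/-- The concatenation of two maps of sequences. -/
def seqAppend : {Xs Ys Xs' Ys' : List V} → (Xs ⟶ Ys) → (Xs' ⟶ Ys') → (Xs ++ Xs' ⟶ Ys ++ Ys')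
  | [], [], _, _, _, g => g
  | _ :: _, _ :: _, _, _, f, g => seqCons f.1 (seqAppend f.2 g)

@[simp] lemma seqAppend_nil {Xs' Ys' : List V} (g : Xs' ⟶ Ys') :
    seqAppend (𝟙 ([] : List V)) g = g := rfl

@[simp] lemma seqAppend_cons {X Y : V} {Xs Ys Xs' Ys' : List V} (f : X ⟶ Y) (fs : Xs ⟶ Ys)
    (g : Xs' ⟶ Ys') : seqAppend (seqCons f fs) g = seqCons f (seqAppend fs g) := rfl

lemma seqAppend_id (Xs Ys : List V) : seqAppend (𝟙 Xs) (𝟙 Ys) = 𝟙 (Xs ++ Ys) := by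
  induction Xs with
  | nil => rfl
  | cons X Xs ih => exact congrArg (seqCons (𝟙 X)) ih

lemma seqAppend_comp {Xs Ys Zs Xs' Ys' Zs' : List V} (f : Xs ⟶ Ys) (g : Ys ⟶ Zs)
    (f' : Xs' ⟶ Ys') (g' : Ys' ⟶ Zs') :
    seqAppend (f ≫ g) (f' ≫ g') = seqAppend f f' ≫ seqAppend g g' := by
  induction Xs generalizing Ys Zs with
  | nil =>
    cases Ys with
    | cons Y Ys => exact f.elim
    | nil => cases Zs with
      | cons Z Zs => exact g.elim
      | nil => rfl
  | cons X Xs ih =>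
    cases Ys with
    | nil => exact f.elim
    | cons Y Ys => cases Zs with
      | nil => exact g.elim
      | cons Z Zs => exact congrArg (seqCons (f.1 ≫ g.1)) (ih f.2 g.2)

/-- The unit `V ⥤ M V`: sequences of length one. -/
def seqSingle (V : Type u) [Category.{v} V] : V ⥤ List V where
  obj X := [X]
  map f := seqCons f (𝟙 [])

def seqFlattenMap : {L L' : List (List V)} → (L ⟶ L') → (L.flatten ⟶ L'.flatten)
  | [], [], _ => 𝟙 _
  | _ :: _, _ :: _, f => seqAppend f.1 (seqFlattenMap f.2)

/-- The multiplication `M (M V) ⥤ M V`: concatenation of a sequence of sequences. -/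
def seqFlatten (V : Type u) [Category.{v} V] : List (List V) ⥤ List V where
  obj L := L.flatten
  map f := seqFlattenMap f
  map_id L := by
    induction L with
    | nil => rfl
    | cons Xs L ih => exact (congrArg (seqAppend (𝟙 Xs)) ih).trans (seqAppend_id _ _)
  map_comp {L L' L''} f g := by
    induction f using seqHom_induction generalizing L'' with
    | nil => cases L'' with
      | nil => rfl
      | cons => exact g.elim
    | cons f fs ih => cases L'' with
      | nil => exact g.elim
      | cons Zs L'' =>
        exact (congrArg (seqAppend (f ≫ g.1)) (ih g.2)).trans (seqAppend_comp _ _ _ _)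

variable {W : Type u₂} [Category.{v} W]

def seqMapMap (F : V ⥤ W) : {Xs Ys : List V} → (Xs ⟶ Ys) → (Xs.map F.obj ⟶ Ys.map F.obj)
  | [], [], _ => 𝟙 _
  | _ :: _, _ :: _, f => seqCons (F.map f.1) (seqMapMap F f.2)

/-- The functor `M F : M V ⥤ M W` which applies `F` to each entry of a sequence. -/
def seqMap (F : V ⥤ W) : List V ⥤ List W where
  obj Xs := Xs.map F.obj
  map f := seqMapMap F f
  map_id Xs := by
    induction Xs with
    | nil => rfl
    | cons X Xs ih => 
      exact (congrArg (seqCons (F.map (𝟙 X))) ih).trans (by rw [F.map_id]; rfl)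
  map_comp {L L' L''} f g := by
    induction f using seqHom_induction generalizing L'' with
    | nil => cases L'' with
      | nil => rfl
      | cons => exact g.elim
    | cons f fs ih => cases L'' with
      | nil => exact g.elim
      | cons Zs L'' =>
        exact (congrArg (seqCons (F.map (f ≫ g.1))) (ih g.2)).trans (by rw [F.map_comp]; rfl)

/-- The map of sequences with entries `α a : f a ⟶ g a`, for `a` running through a given list. -/
def seqHomOfList {A : Type u₂} {f g : A → V} (α : ∀ a, f a ⟶ g a) :
    (l : List A) → (l.map f ⟶ l.map g)
  | [] => 𝟙 _
  | a :: l => seqCons (α a) (seqHomOfList α l)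

end Sequences

/-! ### Multitensors -/

section Multitensors

lemma flatten_map_singleton {A : Type u} (l : List A) : (l.map fun a => [a]).flatten = l := by
  induction l with
  | nil => rfl
  | cons a l ih => exact congrArg (List.cons a) ih

lemma flatten_map_flatten {A : Type u} (l : List (List (List A))) :
    (l.map List.flatten).flatten = l.flatten.flatten :=
  List.flatten_flatten.symm

/-- A multitensor (that is, a lax monoidal structure) on `V`: a lax algebra structure on `V` for
the free strict monoidal category 2-monad `M`. Identities between sequences, such as the
associativity of concatenation, are recorded by `eqToHom`. -/
structure Multitensor (V : Type u) [Category.{w} V] where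
  /-- The functor `E : M V ⥤ V`. -/
  tensor : List V ⥤ V
  /-- The unit `u_Z : Z ⟶ E (Z)`. -/
  unit : ∀ Z : V, Z ⟶ tensor.obj [Z]
  unit_naturality : ∀ {Z Z' : V} (f : Z ⟶ Z'),
    f ≫ unit Z' = unit Z ≫ tensor.map (seqCons f (𝟙 []))
  /-- The substitution `σ_{Zᵢⱼ} : Eᵢ Eⱼ Zᵢⱼ ⟶ Eᵢⱼ Zᵢⱼ`. -/
  subst : ∀ Z : List (List V), tensor.obj (Z.map tensor.obj) ⟶ tensor.obj Z.flatten
  subst_naturality : ∀ {Z Z' : List (List V)} (f : Z ⟶ Z'),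
    tensor.map (seqMapMap tensor f) ≫ subst Z' = subst Z ≫ tensor.map (seqFlattenMap f)
  unit_subst : ∀ Z : List V,
    unit (tensor.obj Z) ≫ subst [Z] ≫ tensor.map (eqToHom (by simp : [Z].flatten = Z)) =
      𝟙 (tensor.obj Z)
  map_unit_subst : ∀ Z : List V,
    tensor.map (eqToHom ((List.map_id' Z).symm : Z = Z.map fun X => X) ≫
        seqHomOfList (f := fun X => X) (g := fun X => tensor.obj [X]) unit Z ≫
        eqToHom (by simp : (Z.map fun X => tensor.obj [X]) =
          (Z.map fun X => [X]).map tensor.obj)) ≫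
      subst (Z.map fun X => [X]) ≫
      tensor.map (eqToHom (flatten_map_singleton Z)) = 𝟙 (tensor.obj Z)
  assoc : ∀ Z : List (List (List V)),
    tensor.map (eqToHom (by simp : (Z.map fun L => tensor.obj (L.map tensor.obj)) =
        (Z.map fun L => L.map tensor.obj).map tensor.obj)) ≫
      subst (Z.map fun L => L.map tensor.obj) ≫
      tensor.map (eqToHom (by simp :
        (Z.map fun L => L.map tensor.obj).flatten = Z.flatten.map tensor.obj)) ≫
      subst Z.flatten =
    tensor.map (seqHomOfList (f := fun L : List (List V) => tensor.obj (L.map tensor.obj))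
        (g := fun L => tensor.obj L.flatten) subst Z ≫
        eqToHom (by simp : (Z.map fun L => tensor.obj L.flatten) =
          (Z.map List.flatten).map tensor.obj)) ≫
      subst (Z.map List.flatten) ≫
      tensor.map (eqToHom (flatten_map_flatten Z))

variable {V : Type u} [Category.{w} V]

/-- A morphism of multitensors on `V`: a natural transformation `A ⟶ B` compatible with units and
substitutions. -/
@[ext]
structure MultitensorHom (A B : Multitensor V) where
  toNatTrans : A.tensor ⟶ B.tensor
  unit_comp : ∀ X : V, A.unit X ≫ toNatTrans.app [X] = B.unit X
  subst_comp : ∀ Z : List (List V),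
    A.subst Z ≫ toNatTrans.app Z.flatten =
      A.tensor.map (seqHomOfList (f := A.tensor.obj) (g := B.tensor.obj)
        (fun L => toNatTrans.app L) Z) ≫
        toNatTrans.app (Z.map B.tensor.obj) ≫ B.subst Z

lemma seqHomOfList_id {A : Type u₂} (f : A → V) (l : List A) :
    seqHomOfList (fun a => 𝟙 (f a)) l = 𝟙 (l.map f) := by
  induction l with
  | nil => rfl
  | cons a l ih => exact congrArg (seqCons (𝟙 (f a))) ih

lemma seqHomOfList_comp {A : Type u₂} {f g h : A → V} (α : ∀ a, f a ⟶ g a)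
    (β : ∀ a, g a ⟶ h a) (l : List A) :
    seqHomOfList α l ≫ seqHomOfList β l = seqHomOfList (fun a => α a ≫ β a) l := by
  induction l with
  | nil => rfl
  | cons a l ih => exact congrArg (seqCons (α a ≫ β a)) ih

instance multitensorCategory : Category (Multitensor V) where
  Hom := MultitensorHom
  id A :=
    { toNatTrans := 𝟙 _
      unit_comp := fun X => Category.comp_id _
      subst_comp := fun Z => by
        have h := seqHomOfList_id A.tensor.obj Z
        simp only [NatTrans.id_app]
        rw [h]
        simp }
  comp {A B C} α β :=
    { toNatTrans := α.toNatTrans ≫ β.toNatTrans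
      unit_comp := fun X => by
        rw [NatTrans.comp_app, ← Category.assoc, α.unit_comp, β.unit_comp]
      subst_comp := fun Z => by
        have h := seqHomOfList_comp (f := A.tensor.obj) (g := B.tensor.obj) (h := C.tensor.obj)
          (fun L => α.toNatTrans.app L) (fun L => β.toNatTrans.app L) Z
        simp only [NatTrans.comp_app]
        rw [← h, reassoc_of% α.subst_comp, β.subst_comp]
        simp only [Functor.map_comp, Category.assoc, NatTrans.naturality_assoc] }

/-- The functor `V ⥤ M V` which inserts a variable entry between two fixed sequences. -/
def seqInsert (Xs Ys : List V) : V ⥤ List V where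
  obj Z := Xs ++ Z :: Ys
  map f := seqAppend (𝟙 Xs) (seqCons f (𝟙 Ys))
  map_id Z := seqAppend_id Xs (Z :: Ys)
  map_comp f g := by
    rw [← seqAppend_comp, Category.id_comp, seqCons_comp, Category.id_comp]

/-- A multitensor is distributive when each `(X₁, …, Xₙ) ↦ E (X₁, …, Xₙ)` preserves (small)
coproducts in each variable. -/
def Multitensor.IsDistributive (E : Multitensor V) : Prop :=
  ∀ (Xs Ys : List V) (I : Type w),
    PreservesColimitsOfShape (Discrete I) (seqInsert Xs Ys ⋙ E.tensor)

/-- The unit of a multitensor, as a natural transformation. -/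
def Multitensor.unitNatTrans (E : Multitensor V) : 𝟭 V ⟶ seqSingle V ⋙ E.tensor where
  app := E.unit
  naturality _ _ f := E.unit_naturality f

/-- The substitution of a multitensor, as a natural transformation. -/
def Multitensor.substNatTrans (E : Multitensor V) :
    seqMap E.tensor ⋙ E.tensor ⟶ seqFlatten V ⋙ E.tensor where
  app := E.subst
  naturality _ _ f := E.subst_naturality f

/-- A multitensor is cartesian when `E` preserves pullbacks and its unit and substitution are
cartesian transformations, that is, their naturality squares are pullbacks. -/
structure Multitensor.IsCartesian (E : Multitensor V) : Prop where
  preservesPullbacks : PreservesLimitsOfShape WalkingCospan E.tensor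
  unit : NatTrans.Equifibered E.unitNatTrans
  subst : NatTrans.Equifibered E.substNatTrans

/-- The category of `E`-multitensors: its objects are the multitensors `A` on `V` with a morphism of
multitensors `α : A ⟶ E` which is a cartesian transformation, and its morphisms are the morphisms of
multitensors over `E`. -/
abbrev EMultitensor (E : Multitensor V) :=
  ObjectProperty.FullSubcategory
    (fun A : Over E => NatTrans.Equifibered (MultitensorHom.toNatTrans A.hom))

end Multitensors

/-! ### Enriched graphs -/

section Graphs

/-- A graph enriched in `V`: a (small) set of objects, and a hom in `V` for each ordered pair of
objects. -/
structure EGraph (V : Type u) [Category.{w} V] : Type (max u (w + 1)) where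
  obj : Type w
  hom : obj → obj → V

variable {V : Type u} [Category.{w} V]

/-- A morphism of `V`-graphs. -/
structure EGraphHom (X Y : EGraph V) : Type w where
  obj : X.obj → Y.obj
  hom : ∀ a b : X.obj, X.hom a b ⟶ Y.hom (obj a) (obj b)

/-- The category `𝒢V` of `V`-graphs. -/
instance eGraphCategory : Category.{w} (EGraph V) where
  Hom := EGraphHom
  id X := ⟨fun a => a, fun a b => 𝟙 (X.hom a b)⟩
  comp f g := ⟨fun a => g.obj (f.obj a), fun a b => f.hom a b ≫ g.hom (f.obj a) (f.obj b)⟩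
  id_comp f := by
    cases f
    simp
  comp_id f := by
    cases f
    simp
  assoc f g h := by
    simp

lemma EGraphHom.ext_of_hom {X Y : EGraph V} {f g : X ⟶ Y} (h : ∀ a, f.obj a = g.obj a)
    (h' : ∀ a b, f.hom a b ≫ eqToHom (by rw [h, h]) = g.hom a b) : f = g := by
  obtain ⟨f, f'⟩ := f
  obtain ⟨g, g'⟩ := g
  obtain rfl : f = g := funext h
  congr
  funext a b
  simpa using h' a b

/-- An identity-on-objects morphism of `V`-graphs with the same set of objects. -/
abbrev EGraphHom.ofHoms {S : Type w} {H K : S → S → V} (φ : ∀ a b, H a b ⟶ K a b) :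
    (⟨S, H⟩ : EGraph V) ⟶ ⟨S, K⟩ :=
  ⟨fun a => a, φ⟩

/-- A monad on `𝒢V` over `Set`, that is, a monad in `CAT/Set` on the functor `𝒢V ⥤ Set` which sends
a graph to its set of objects. Thus `T X` has the same objects as `X`, `T f` has the same object map
as `f`, and the components of the unit and of the multiplication are identities on objects, so that
all the data lies in the homs. -/
structure MonadOverSet (V : Type u) [Category.{w} V] where
  /-- The homs `T X (a, b)`. -/
  hom : ∀ (X : EGraph V), X.obj → X.obj → V
  map : ∀ {X Y : EGraph V} (f : X ⟶ Y) (a b : X.obj), hom X a b ⟶ hom Y (f.obj a) (f.obj b)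
  map_id : ∀ (X : EGraph V) (a b : X.obj), map (𝟙 X) a b = 𝟙 (hom X a b)
  map_comp : ∀ {X Y Z : EGraph V} (f : X ⟶ Y) (g : Y ⟶ Z) (a b : X.obj),
    map (f ≫ g) a b = map f a b ≫ map g (f.obj a) (f.obj b)
  /-- The hom maps `X (a, b) ⟶ T X (a, b)` of the unit. -/
  η : ∀ (X : EGraph V) (a b : X.obj), X.hom a b ⟶ hom X a b
  η_naturality : ∀ {X Y : EGraph V} (f : X ⟶ Y) (a b : X.obj),
    f.hom a b ≫ η Y (f.obj a) (f.obj b) = η X a b ≫ map f a b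
  /-- The hom maps `T T X (a, b) ⟶ T X (a, b)` of the multiplication. -/
  μ : ∀ (X : EGraph V) (a b : X.obj), hom ⟨X.obj, hom X⟩ a b ⟶ hom X a b
  μ_naturality : ∀ {X Y : EGraph V} (f : X ⟶ Y) (a b : X.obj),
    map (X := ⟨X.obj, hom X⟩) (Y := ⟨Y.obj, hom Y⟩) ⟨f.obj, map f⟩ a b ≫
      μ Y (f.obj a) (f.obj b) = μ X a b ≫ map f a b
  left_unit : ∀ (X : EGraph V) (a b : X.obj), η ⟨X.obj, hom X⟩ a b ≫ μ X a b = 𝟙 (hom X a b)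
  right_unit : ∀ (X : EGraph V) (a b : X.obj),
    map (EGraphHom.ofHoms (η X)) a b ≫ μ X a b = 𝟙 (hom X a b)
  assoc : ∀ (X : EGraph V) (a b : X.obj),
    map (EGraphHom.ofHoms (μ X)) a b ≫ μ X a b = μ ⟨X.obj, hom X⟩ a b ≫ μ X a b

/-- The underlying monad on the category `𝒢V`. -/
def MonadOverSet.toMonad (T : MonadOverSet V) : Monad (EGraph V) where
  obj X := ⟨X.obj, T.hom X⟩
  map f := ⟨f.obj, T.map f⟩
  map_id X := congrArg (EGraphHom.mk _) (funext fun a => funext fun b => T.map_id X a b)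
  map_comp f g :=
    congrArg (EGraphHom.mk _) (funext fun a => funext fun b => T.map_comp f g a b)
  η :=
    { app := fun X => EGraphHom.ofHoms (T.η X)
      naturality := fun _ _ f =>
        congrArg (EGraphHom.mk _) (funext fun a => funext fun b => T.η_naturality f a b) }
  μ :=
    { app := fun X => EGraphHom.ofHoms (T.μ X)
      naturality := fun _ _ f =>
        congrArg (EGraphHom.mk _) (funext fun a => funext fun b => T.μ_naturality f a b) }
  assoc X := congrArg (EGraphHom.mk _) (funext fun a => funext fun b => T.assoc X a b)
  left_unit X := congrArg (EGraphHom.mk _) (funext fun a => funext fun b => T.left_unit X a b)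
  right_unit X := congrArg (EGraphHom.mk _) (funext fun a => funext fun b => T.right_unit X a b)

/-- A morphism of monads on `𝒢V` over `Set`: a natural transformation with components the identity
on objects, which is compatible with units and multiplications. -/
@[ext]
structure MonadOverSetHom (S T : MonadOverSet V) where
  app : ∀ (X : EGraph V) (a b : X.obj), S.hom X a b ⟶ T.hom X a b
  naturality : ∀ {X Y : EGraph V} (f : X ⟶ Y) (a b : X.obj),
    S.map f a b ≫ app Y (f.obj a) (f.obj b) = app X a b ≫ T.map f a b
  η_comp : ∀ (X : EGraph V) (a b : X.obj), S.η X a b ≫ app X a b = T.η X a b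
  μ_comp : ∀ (X : EGraph V) (a b : X.obj),
    S.μ X a b ≫ app X a b =
      (S.map (EGraphHom.ofHoms (app X)) a b ≫ app ⟨X.obj, T.hom X⟩ a b) ≫ T.μ X a b

/-- The underlying morphism of monads on the category `𝒢V`. -/
def MonadOverSetHom.toMonadHom {S T : MonadOverSet V} (α : MonadOverSetHom S T) :
    S.toMonad ⟶ T.toMonad :=
  { app := fun X => EGraphHom.ofHoms (α.app X)
    naturality := fun _ _ f =>
      congrArg (EGraphHom.mk _) (funext fun a => funext fun b => α.naturality f a b)
    app_η := fun X =>
      congrArg (EGraphHom.mk _) (funext fun a => funext fun b => α.η_comp X a b)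
    app_μ := fun X =>
      congrArg (EGraphHom.mk _) (funext fun a => funext fun b => α.μ_comp X a b) }

instance monadOverSetCategory : Category (MonadOverSet V) where
  Hom := MonadOverSetHom
  id T :=
    { app := fun X a b => 𝟙 _
      naturality := fun f a b => by rw [Category.comp_id, Category.id_comp]
      η_comp := fun X a b => Category.comp_id _
      μ_comp := fun X a b => by
        have h : T.map (EGraphHom.ofHoms fun a b => 𝟙 (T.hom X a b)) a b = 𝟙 _ :=
          T.map_id ⟨X.obj, T.hom X⟩ a b
        rw [h]
        exact (Category.comp_id _).trans
          (((congrArg (· ≫ T.μ X a b) (Category.comp_id _)).trans (Category.id_comp _)).symm) }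
  comp {S T U} α β :=
    { app := fun X a b => α.app X a b ≫ β.app X a b
      naturality := fun f a b => by
        rw [← Category.assoc, α.naturality, Category.assoc, β.naturality, Category.assoc]
      η_comp := fun X a b => by
        rw [← Category.assoc, α.η_comp, β.η_comp]
      μ_comp := fun X a b => by
        have h : S.map (EGraphHom.ofHoms fun a b => α.app X a b ≫ β.app X a b) a b =
            S.map (EGraphHom.ofHoms (α.app X)) a b ≫ S.map (EGraphHom.ofHoms (β.app X)) a b :=
          S.map_comp (EGraphHom.ofHoms (α.app X)) (EGraphHom.ofHoms (β.app X)) a b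
        have h' : S.map (EGraphHom.ofHoms (β.app X)) a b ≫ α.app ⟨X.obj, U.hom X⟩ a b =
            α.app ⟨X.obj, T.hom X⟩ a b ≫ T.map (EGraphHom.ofHoms (β.app X)) a b :=
          α.naturality (EGraphHom.ofHoms (β.app X)) a b
        rw [h, ← Category.assoc, α.μ_comp, Category.assoc, β.μ_comp]
        simp only [Category.assoc]
        rw [reassoc_of% h'] }

/-- A monad on a category with pullbacks is cartesian when its functor part preserves pullbacks, and
its unit and multiplication are cartesian transformations. -/
structure IsCartesianMonad {C : Type u₂} [Category.{w} C] (T : Monad C) : Prop where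
  preservesPullbacks : PreservesLimitsOfShape WalkingCospan T.toFunctor
  η : NatTrans.Equifibered T.η
  μ : NatTrans.Equifibered T.μ

/-- The category of `T`-operads over `Set`: its objects are the monads `A` on `𝒢V` over `Set` with
a morphism `α : A ⟶ T` of monads over `Set` which is a cartesian transformation, and its morphisms
are the morphisms of monads over `T`. -/
abbrev OperadOverSet (T : MonadOverSet V) :=
  ObjectProperty.FullSubcategory (fun A : Over T =>
    NatTrans.Equifibered (MonadHom.toNatTrans (MonadOverSetHom.toMonadHom A.hom)))

end Graphs

/-! ### Sequences of objects -/

section Chains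

/-- Given sets `J a b` of labels for all `a, b : S`, the finite sequences
`a = x₀, j₁, x₁, j₂, …, jₙ, xₙ = b` with `xᵢ : S` and `jᵢ : J xᵢ₋₁ xᵢ`. -/
inductive Chain {S : Type w} (J : S → S → Type w) : S → S → Type w
  | nil (a : S) : Chain J a a
  | cons {a b c : S} (j : J a b) (p : Chain J b c) : Chain J a c

/-- The finite sequences `a = x₀, x₁, …, xₙ = b` of elements of `S`, where `n` may be `0`. -/
abbrev ObjSeq {S : Type w} : S → S → Type w := Chain fun _ _ : S => PUnit.{w + 1}

namespace Chain

variable {S S' S'' : Type w} {J : S → S → Type w} {J' : S' → S' → Type w}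
  {J'' : S'' → S'' → Type w}

/-- The list of the `F jᵢ`, for the labels `jᵢ` of a chain. -/
def labels {A : Type u} (F : ∀ a b, J a b → A) : {a b : S} → Chain J a b → List A
  | _, _, nil _ => []
  | _, _, cons j p => F _ _ j :: labels F p

def map (f : S → S') (g : ∀ a b, J a b → J' (f a) (f b)) :
    {a b : S} → Chain J a b → Chain J' (f a) (f b)
  | _, _, nil a => nil (f a)
  | _, _, cons j p => cons (g _ _ j) (map f g p)

def append : {a b c : S} → Chain J a b → Chain J b c → Chain J a c
  | _, _, _, nil _, q => q
  | _, _, _, cons j p, q => cons j (append p q)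

/-- The concatenation of a doubly-nested sequence. -/
def flatten : {a b : S} → Chain (fun a b => Chain J a b) a b → Chain J a b
  | _, _, nil a => nil a
  | _, _, cons q p => append q (flatten p)

/-- The chain of length one. -/
def single {a b : S} (j : J a b) : Chain J a b := cons j (nil b)

lemma append_nil {a b : S} (p : Chain J a b) : append p (nil b) = p := by
  induction p with
  | nil => rfl
  | cons j p ih => exact congrArg (cons j) ih

lemma append_assoc {a b c d : S} (p : Chain J a b) (q : Chain J b c) (r : Chain J c d) :
    append (append p q) r = append p (append q r) := by
  induction p with
  | nil => rfl
  | cons j p ih => exact congrArg (cons j) (ih q)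

lemma flatten_append {a b c : S} (p : Chain (fun a b => Chain J a b) a b)
    (q : Chain (fun a b => Chain J a b) b c) :
    flatten (append p q) = append (flatten p) (flatten q) := by
  induction p with
  | nil => rfl
  | cons j p ih => exact (congrArg (append j) (ih q)).trans (append_assoc _ _ _).symm

lemma flatten_flatten {a b : S}
    (r : Chain (fun a b => Chain (fun a b => Chain J a b) a b) a b) :
    flatten (map (fun a => a) (fun _ _ p => flatten p) r) = flatten (flatten r) := by
  induction r with
  | nil => rfl
  | cons p r ih => exact (congrArg (append (flatten p)) ih).trans (flatten_append _ _).symm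

lemma map_id {a b : S} (p : Chain J a b) : map (fun a => a) (fun _ _ j => j) p = p := by
  induction p with
  | nil => rfl
  | cons j p ih => exact congrArg (cons j) ih

lemma map_map {f : S → S'} {g : ∀ a b, J a b → J' (f a) (f b)} {f' : S' → S''}
    {g' : ∀ a b, J' a b → J'' (f' a) (f' b)} {a b : S} (p : Chain J a b) :
    map f' g' (map f g p) = map (fun a => f' (f a)) (fun _ _ j => g' _ _ (g _ _ j)) p := by
  induction p with
  | nil => rfl
  | cons j p ih => exact congrArg (cons _) ih

lemma map_append {f : S → S'} {g : ∀ a b, J a b → J' (f a) (f b)} {a b c : S}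
    (p : Chain J a b) (q : Chain J b c) :
    map f g (append p q) = append (map f g p) (map f g q) := by
  induction p with
  | nil => rfl
  | cons j p ih => exact congrArg (cons _) (ih q)

lemma map_flatten {f : S → S'} {g : ∀ a b, J a b → J' (f a) (f b)} {a b : S}
    (p : Chain (fun a b => Chain J a b) a b) :
    flatten (map f (fun _ _ q => map f g q) p) = map f g (flatten p) := by
  induction p with
  | nil => rfl
  | cons q p ih => exact (congrArg (append _) ih).trans (map_append _ _).symm

lemma flatten_map_single {a b : S} (p : Chain J a b) :
    flatten (map (fun a => a) (fun _ _ j => single j) p) = p := by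
  induction p with
  | nil => rfl
  | cons j p ih => exact congrArg (cons j) ih

lemma flatten_single {a b : S} (p : Chain J a b) :
    flatten (single (J := fun a b => Chain J a b) p) = p :=
  append_nil p

variable {A : Type u} {B : Type u₂}

lemma labels_append (F : ∀ a b, J a b → A) {a b c : S} (p : Chain J a b) (q : Chain J b c) :
    labels F (append p q) = labels F p ++ labels F q := by
  induction p with
  | nil => rfl
  | cons j p ih => exact congrArg (List.cons _) (ih q)

lemma labels_flatten (F : ∀ a b, J a b → A) {a b : S} (p : Chain (fun a b => Chain J a b) a b) :
    (labels (fun _ _ q => labels F q) p).flatten = labels F (flatten p) := by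
  induction p with
  | nil => rfl
  | cons q p ih => exact (congrArg (labels F q ++ ·) ih).trans (labels_append F _ _).symm

lemma list_map_labels (F : ∀ a b, J a b → A) (h : A → B) {a b : S} (p : Chain J a b) :
    (labels F p).map h = labels (fun a b j => h (F a b j)) p := by
  induction p with
  | nil => rfl
  | cons j p ih => exact congrArg (List.cons _) ih

lemma labels_map {f : S → S'} {g : ∀ a b, J a b → J' (f a) (f b)} (F : ∀ a b, J' a b → A)
    {a b : S} (p : Chain J a b) :
    labels F (map f g p) = labels (fun a b j => F (f a) (f b) (g a b j)) p := by
  induction p with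
  | nil => rfl
  | cons j p ih => exact congrArg (List.cons _) ih

variable {V : Type u} [Category.{v} V]

/-- The map of sequences with entries `ψ jᵢ`, for the labels `jᵢ` of a chain. -/
def labelsHom {f : S → S'} {g : ∀ a b, J a b → J' (f a) (f b)} {F : ∀ a b, J a b → V}
    {F' : ∀ a b, J' a b → V} (ψ : ∀ a b j, F a b j ⟶ F' (f a) (f b) (g a b j)) :
    {a b : S} → (p : Chain J a b) → (labels F p ⟶ labels F' (map f g p))
  | _, _, nil _ => 𝟙 _
  | _, _, cons j p => seqCons (ψ _ _ j) (labelsHom ψ p)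

end Chain

end Chains

/-! ### Auxiliary facts on heterogeneous equality of maps of sequences -/

section Heq

variable {V : Type u} [Category.{v} V]

lemma seqCons_heq {X Y X' Y' : V} {Xs Ys Xs' Ys' : List V} (hX : X = X') (hY : Y = Y')
    (hXs : Xs = Xs') (hYs : Ys = Ys') {f : X ⟶ Y} {f' : X' ⟶ Y'} {g : Xs ⟶ Ys} {g' : Xs' ⟶ Ys'}
    (hf : HEq f f') (hg : HEq g g') : HEq (seqCons f g) (seqCons f' g') := by
  subst hX hY hXs hYs hf hg
  rfl

lemma seqAppend_heq {Xs Ys Xs' Ys' Zs Ws Zs' Ws' : List V} (hXs : Xs = Xs') (hYs : Ys = Ys')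
    (hZs : Zs = Zs') (hWs : Ws = Ws') {f : Xs ⟶ Ys} {f' : Xs' ⟶ Ys'} {g : Zs ⟶ Ws}
    {g' : Zs' ⟶ Ws'} (hf : HEq f f') (hg : HEq g g') : HEq (seqAppend f g) (seqAppend f' g') := by
  subst hXs hYs hZs hWs hf hg
  rfl

lemma map_heq {W : Type u₂} [Category.{w} W] (G : V ⥤ W) {X Y X' Y' : V} (hX : X = X')
    (hY : Y = Y') {f : X ⟶ Y} {f' : X' ⟶ Y'} (hf : HEq f f') : HEq (G.map f) (G.map f') := by
  subst hX hY hf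
  rfl

lemma eqToHom_comp_eqToHom_heq {X Y X' Y' : V} (hX : X' = X) (hY : Y = Y') (f : X ⟶ Y) :
    HEq (eqToHom hX ≫ f ≫ eqToHom hY) f := by
  subst hX hY
  simp

lemma id_heq {X Y : V} (h : X = Y) : HEq (𝟙 X) (𝟙 Y) := by
  subst h
  rfl

end Heq

namespace Chain

variable {S S' S'' : Type w} {J : S → S → Type w} {J' : S' → S' → Type w}
  {J'' : S'' → S'' → Type w} {V : Type u} [Category.{v} V]

lemma labelsHom_comp {f : S → S'} {g : ∀ a b, J a b → J' (f a) (f b)} {f' : S' → S''}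
    {g' : ∀ a b, J' a b → J'' (f' a) (f' b)} {F : ∀ a b, J a b → V} {F' : ∀ a b, J' a b → V}
    {F'' : ∀ a b, J'' a b → V} (ψ : ∀ a b j, F a b j ⟶ F' (f a) (f b) (g a b j))
    (ψ' : ∀ a b j, F' a b j ⟶ F'' (f' a) (f' b) (g' a b j)) {a b : S} (p : Chain J a b) :
    HEq (labelsHom ψ p ≫ labelsHom ψ' (map f g p))
      (labelsHom (F' := F'') (f := fun a => f' (f a)) (g := fun _ _ j => g' _ _ (g _ _ j))
        (fun a b j => ψ a b j ≫ ψ' _ _ (g a b j)) p) := by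
  induction p with
  | nil => rfl
  | cons j p ih =>
    exact seqCons_heq rfl rfl rfl (congrArg _ (map_map p)) HEq.rfl ih

lemma labelsHom_id (F : ∀ a b, J a b → V) {a b : S} (p : Chain J a b) :
    HEq (labelsHom (J' := J) (F' := F) (f := fun a => a) (g := fun _ _ j => j)
      (fun a b j => 𝟙 (F a b j)) p) (𝟙 (labels F p)) := by
  induction p with
  | nil => rfl
  | cons j p ih => exact seqCons_heq rfl rfl rfl (congrArg _ (map_id p)) HEq.rfl ih

lemma labelsHom_append {f : S → S'} {g : ∀ a b, J a b → J' (f a) (f b)} {F : ∀ a b, J a b → V}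
    {F' : ∀ a b, J' a b → V} (ψ : ∀ a b j, F a b j ⟶ F' (f a) (f b) (g a b j)) {a b c : S}
    (p : Chain J a b) (q : Chain J b c) :
    HEq (seqAppend (labelsHom ψ p) (labelsHom ψ q)) (labelsHom ψ (append p q)) := by
  induction p with
  | nil => rfl
  | cons j p ih =>
    exact seqCons_heq rfl rfl (labels_append _ _ _).symm
      ((labels_append _ _ _).symm.trans (congrArg _ (map_append p q).symm)) HEq.rfl (ih q)

lemma seqFlattenMap_labelsHom {f : S → S'} {g : ∀ a b, J a b → J' (f a) (f b)}
    {F : ∀ a b, J a b → V} {F' : ∀ a b, J' a b → V}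
    (ψ : ∀ a b j, F a b j ⟶ F' (f a) (f b) (g a b j)) {a b : S}
    (p : Chain (fun a b => Chain J a b) a b) :
    HEq (seqFlattenMap (labelsHom (F := fun _ _ q => labels F q) (F' := fun _ _ q => labels F' q)
      (f := f) (g := fun _ _ q => map f g q) (fun _ _ q => labelsHom ψ q) p))
      (labelsHom ψ (flatten p)) := by
  induction p with
  | nil => rfl
  | cons q p ih =>
    refine HEq.trans (seqAppend_heq rfl rfl (labels_flatten _ _)
      ((labels_flatten _ _).trans (congrArg _ (map_flatten p))) HEq.rfl ih)
      (labelsHom_append ψ q (flatten p))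

lemma seqMapMap_labelsHom {W : Type u₂} [Category.{v} W] (G : V ⥤ W) {f : S → S'}
    {g : ∀ a b, J a b → J' (f a) (f b)} {F : ∀ a b, J a b → V} {F' : ∀ a b, J' a b → V}
    (ψ : ∀ a b j, F a b j ⟶ F' (f a) (f b) (g a b j)) {a b : S} (p : Chain J a b) :
    HEq (seqMapMap G (labelsHom ψ p))
      (labelsHom (J' := J') (f := f) (g := g) (F := fun _ _ j => G.obj (F _ _ j))
        (F' := fun _ _ j => G.obj (F' _ _ j))
        (fun a b j => G.map (ψ a b j)) p) := by
  induction p with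
  | nil => rfl
  | cons j p ih =>
    exact seqCons_heq rfl rfl (list_map_labels _ _ _) (list_map_labels _ _ _) HEq.rfl ih

lemma seqHomOfList_labels {A : Type u₂} {k l : A → V} (α : ∀ a, k a ⟶ l a) (F : ∀ a b, J a b → A)
    {a b : S} (p : Chain J a b) :
    HEq (seqHomOfList α (labels F p))
      (labelsHom (J' := J) (f := fun a => a) (g := fun _ _ j => j) (F := fun _ _ j => k (F _ _ j))
        (F' := fun _ _ j => l (F _ _ j)) (fun a b j => α (F a b j)) p) := by
  induction p with
  | nil => rfl
  | cons j p ih =>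
    exact seqCons_heq rfl rfl (list_map_labels _ _ _)
      ((list_map_labels _ _ _).trans (congrArg _ (map_id p).symm)) HEq.rfl ih

lemma labelsHom_congr {f f₂ : S → S'} {J₂ : S' → S' → Type w} {g : ∀ a b, J a b → J' (f a) (f b)}
    {g₂ : ∀ a b, J a b → J₂ (f₂ a) (f₂ b)} {F F₂ : ∀ a b, J a b → V} {F' : ∀ a b, J' a b → V}
    {F₂' : ∀ a b, J₂ a b → V} {ψ : ∀ a b j, F a b j ⟶ F' (f a) (f b) (g a b j)}
    {ψ₂ : ∀ a b j, F₂ a b j ⟶ F₂' (f₂ a) (f₂ b) (g₂ a b j)}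
    (hF : ∀ a b j, F a b j = F₂ a b j)
    (hF' : ∀ a b j, F' (f a) (f b) (g a b j) = F₂' (f₂ a) (f₂ b) (g₂ a b j))
    (hψ : ∀ a b j, HEq (ψ a b j) (ψ₂ a b j)) {a b : S} (p : Chain J a b) :
    HEq (labelsHom ψ p) (labelsHom ψ₂ p) := by
  obtain rfl : F = F₂ := funext fun a => funext fun b => funext fun j => hF a b j
  have h : ∀ {a b : S} (p : Chain J a b),
      labels F' (map f g p) = labels F₂' (map f₂ g₂ p) := fun p => by
    simp only [labels_map, hF']
  induction p with
  | nil => rfl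
  | cons j p ih => exact seqCons_heq rfl (hF' _ _ j) rfl (h p) (hψ _ _ j) ih

end Chain

/-! ### The monad `Γ E` -/

section Gamma

variable {V : Type u} [Category.{w} V]

/-- A functor on sequences which preserves coproducts in each variable. -/
def DistFunctor (G : List V ⥤ V) : Prop :=
  ∀ (Xs Ys : List V) (I : Type w),
    PreservesColimitsOfShape (Discrete I) (seqInsert Xs Ys ⋙ G)

/-- The functor which adds a fixed first entry to a sequence. -/
def seqConsFunctor (A : V) : List V ⥤ List V where
  obj Xs := A :: Xs
  map f := seqCons (𝟙 A) f
  map_comp f g := by rw [seqCons_comp, Category.id_comp]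

lemma DistFunctor.cons {G : List V ⥤ V} (hG : DistFunctor G) (A : V) :
    DistFunctor (seqConsFunctor A ⋙ G) :=
  fun Xs Ys I => hG (A :: Xs) Ys I

namespace Chain

variable {S : Type w} {J : S → S → Type w}

/-- The ways to choose labels for a given sequence of objects. -/
def Choice (J : S → S → Type w) : {a b : S} → ObjSeq a b → Type w
  | _, _, nil _ => PUnit
  | _, _, cons (a := a) (b := b) _ q => J a b × Choice J q

def ofChoice : {a b : S} → (q : ObjSeq a b) → Choice J q → Chain J a b
  | _, _, nil a, _ => nil a
  | _, _, cons _ q, c => cons c.1 (ofChoice q c.2)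

/-- The underlying sequence of objects. -/
abbrev objSeq {a b : S} (p : Chain J a b) : ObjSeq a b :=
  map (J' := fun _ _ : S => PUnit.{w + 1}) (fun a => a) (fun _ _ _ => PUnit.unit) p

def choice : {a b : S} → (p : Chain J a b) → Choice J (objSeq p)
  | _, _, nil _ => PUnit.unit
  | _, _, cons j p => (j, choice p)

lemma ofChoice_choice {a b : S} (p : Chain J a b) : ofChoice (objSeq p) (choice p) = p := by
  induction p with
  | nil => rfl
  | cons j p ih => exact congrArg (cons j) ih

lemma objSeq_ofChoice {a b : S} (q : ObjSeq a b) (c : Choice J q) :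
    objSeq (ofChoice q c) = q := by
  induction q with
  | nil => rfl
  | cons j q ih => exact congrArg (cons _) (ih c.2)

/-- The homs `X (x₀, x₁), …, X (xₙ₋₁, xₙ)` along a sequence of objects. -/
abbrev homs (H : S → S → V) {a b : S} (q : ObjSeq a b) : List V := labels (fun a b _ => H a b) q

variable {H : S → S → V} {F : ∀ a b, J a b → V}

def choiceHom (i : ∀ a b j, F a b j ⟶ H a b) :
    {a b : S} → (q : ObjSeq a b) → (c : Choice J q) → (labels F (ofChoice q c) ⟶ homs H q)
  | _, _, nil _, _ => 𝟙 _
  | _, _, cons _ q, c => seqCons (i _ _ c.1) (choiceHom i q c.2)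

lemma choiceHom_heq (i : ∀ a b j, F a b j ⟶ H a b) {a b : S} (q : ObjSeq a b) (c : Choice J q) :
    HEq (choiceHom i q c) (labelsHom (f := fun a => a) (g := fun _ _ _ => PUnit.unit)
      (F' := fun a b _ => H a b) i (ofChoice q c)) := by
  induction q with
  | nil => rfl
  | cons j q ih =>
    exact seqCons_heq rfl rfl rfl (congrArg _ (objSeq_ofChoice q c.2).symm) HEq.rfl (ih c.2)

lemma choice_hom_ext {G : List V ⥤ V} (hG : DistFunctor G) (i : ∀ a b j, F a b j ⟶ H a b)
    (hi : ∀ a b, Nonempty (IsColimit (Cofan.mk (H a b) (i a b)))) {a b : S} (q : ObjSeq a b)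
    {Z : V} (φ ψ : G.obj (homs H q) ⟶ Z)
    (h : ∀ c : Choice J q, G.map (choiceHom i q c) ≫ φ = G.map (choiceHom i q c) ≫ ψ) :
    φ = ψ := by
  induction q generalizing G with
  | nil =>
    have h' : G.map (𝟙 []) ≫ φ = G.map (𝟙 []) ≫ ψ := h PUnit.unit
    rw [G.map_id] at h'
    exact (Category.id_comp φ).symm.trans (h'.trans (Category.id_comp ψ))
  | @cons a b c' j q ih =>
    obtain ⟨hab⟩ := hi a b
    have := hG [] (homs H q) (J a b)
    have hc := isColimitCofanMkObjOfIsColimit (seqInsert [] (homs H q) ⋙ G) _ _ hab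
    refine Cofan.IsColimit.hom_ext hc _ _ fun k => ?_
    refine ih (hG.cons (F a b k)) _ _ fun c => ?_
    have hk : G.map (seqCons (i a b k) (choiceHom i q c)) ≫ φ =
      G.map (seqCons (i a b k) (choiceHom i q c)) ≫ ψ := h ((k, c) : J a b × Choice J q)
    have e : seqCons (i a b k) (choiceHom i q c) =
      seqCons (𝟙 (F a b k)) (choiceHom i q c) ≫ seqCons (i a b k) (𝟙 _) := by
      rw [seqCons_comp, Category.id_comp, Category.comp_id]
    rw [e, G.map_comp] at hk
    exact (Category.assoc _ _ _).symm.trans (hk.trans (Category.assoc _ _ _))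

lemma choice_desc {G : List V ⥤ V} (hG : DistFunctor G) (i : ∀ a b j, F a b j ⟶ H a b)
    (hi : ∀ a b, Nonempty (IsColimit (Cofan.mk (H a b) (i a b)))) {a b : S} (q : ObjSeq a b)
    {Z : V} (θ : ∀ c : Choice J q, G.obj (labels F (ofChoice q c)) ⟶ Z) :
    ∃ φ : G.obj (homs H q) ⟶ Z, ∀ c, G.map (choiceHom i q c) ≫ φ = θ c := by
  induction q generalizing G with
  | nil => 
    refine ⟨θ PUnit.unit, fun c => ?_⟩
    have h' : G.map (𝟙 []) ≫ θ PUnit.unit = θ PUnit.unit := by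
      rw [G.map_id]
      exact Category.id_comp _
    exact h'
  | @cons a b c' j q ih =>
    obtain ⟨hab⟩ := hi a b
    have := hG [] (homs H q) (J a b)
    have hc := isColimitCofanMkObjOfIsColimit (seqInsert [] (homs H q) ⋙ G) _ _ hab
    choose φ hφ using fun k => ih (hG.cons (F a b k)) fun c => θ ((k, c) : J a b × Choice J q)
    obtain ⟨D, hD⟩ : ∃ D : G.obj (H a b :: homs H q) ⟶ Z,
        ∀ k, G.map (seqCons (i a b k) (𝟙 _)) ≫ D = φ k :=
      ⟨Cofan.IsColimit.desc hc φ, fun k => Cofan.IsColimit.fac hc φ k⟩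
    refine ⟨D, fun c => ?_⟩
    obtain ⟨k, c⟩ := c
    have e : seqCons (i a b k) (choiceHom i q c) =
      seqCons (𝟙 (F a b k)) (choiceHom i q c) ≫ seqCons (i a b k) (𝟙 _) := by
      rw [seqCons_comp, Category.id_comp, Category.comp_id]
    refine Eq.trans ?_ (hφ k c)
    have h : G.map (seqCons (i a b k) (choiceHom i q c)) ≫ D =
        G.map (seqCons (𝟙 (F a b k)) (choiceHom i q c)) ≫ φ k := by
      rw [e, G.map_comp, Category.assoc, hD]
    exact h

end Chain

open Chain

variable (E : Multitensor V)
variable {S S' S'' : Type w} {J : S → S → Type w} {J' : S' → S' → Type w} {H : S → S → V}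
  {H' : S' → S' → V} {F : ∀ a b, J a b → V} {F' : ∀ a b, J' a b → V}

/-- The substitution `E (E (F j₁₁, …), …, E (F jₙ₁, …)) ⟶ E (F j₁₁, …, F jₙₘ)` for a doubly-nested
sequence. -/
def substChain (F : ∀ a b, J a b → V) {a b : S} (r : Chain (fun a b => Chain J a b) a b) :
    E.tensor.obj (labels (fun _ _ p => E.tensor.obj (labels F p)) r) ⟶
      E.tensor.obj (labels F (flatten r)) :=
  E.tensor.map (eqToHom (list_map_labels (fun _ _ p => labels F p) E.tensor.obj r).symm) ≫
    E.subst (labels (fun _ _ p => labels F p) r) ≫ E.tensor.map (eqToHom (labels_flatten F r))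

variable {E}

lemma map_eqToHom_heq {X Y Z : List V} (G : List V ⥤ V) (h : X = Y) (f : G.obj Y ⟶ G.obj Z) :
    HEq (G.map (eqToHom h) ≫ f) f := by
  subst h
  simp

lemma heq_map_eqToHom {X Y Z : List V} (G : List V ⥤ V) (h : Y = Z) (f : G.obj X ⟶ G.obj Y) :
    HEq (f ≫ G.map (eqToHom h)) f := by
  subst h
  simp

lemma substChain_heq (F : ∀ a b, J a b → V) {a b : S}
    (r : Chain (fun a b => Chain J a b) a b) :
    HEq (substChain E F r) (E.subst (labels (fun _ _ p => labels F p) r)) :=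
  (map_eqToHom_heq _ _ _).trans (heq_map_eqToHom _ _ _)

lemma substChain_naturality {f : S → S'} {g : ∀ a b, J a b → J' (f a) (f b)}
    (ψ : ∀ a b j, F a b j ⟶ F' (f a) (f b) (g a b j)) {a b : S}
    (r : Chain (fun a b => Chain J a b) a b) :
    HEq (E.tensor.map (labelsHom (F := fun _ _ p => E.tensor.obj (labels F p))
        (F' := fun _ _ p => E.tensor.obj (labels F' p)) (f := f) (g := fun _ _ p => map f g p)
        (fun _ _ p => E.tensor.map (labelsHom ψ p)) r) ≫
      substChain E F' (map f (fun _ _ p => map f g p) r))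
      (substChain E F r ≫ E.tensor.map (labelsHom ψ (flatten r))) := by
  have h := E.subst_naturality (labelsHom (F := fun _ _ q => labels F q)
    (F' := fun _ _ q => labels F' q) (f := f) (g := fun _ _ q => map f g q)
    (fun _ _ q => labelsHom ψ q) r)
  refine HEq.trans ?_ ((heq_of_eq h).trans ?_)
  · exact heq_comp (congrArg E.tensor.obj (list_map_labels _ _ _).symm)
      (congrArg E.tensor.obj (list_map_labels _ _ _).symm)
      (congrArg E.tensor.obj (labels_flatten _ _).symm)
      (map_heq _ (list_map_labels _ _ _).symm (list_map_labels _ _ _).symm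
        (seqMapMap_labelsHom _ _ _).symm) (substChain_heq _ _)
  · exact heq_comp (congrArg E.tensor.obj (list_map_labels _ _ _))
      (congrArg E.tensor.obj (labels_flatten _ _))
      (congrArg E.tensor.obj ((labels_flatten _ _).trans (congrArg _ (map_flatten r))))
      (substChain_heq _ _).symm
      (map_heq _ (labels_flatten _ _) ((labels_flatten _ _).trans (congrArg _ (map_flatten r)))
        (seqFlattenMap_labelsHom _ _))

lemma subst_heq {Z Z' : List (List V)} (h : Z = Z') : HEq (E.subst Z) (E.subst Z') := by
  subst h
  rfl

lemma substChain_congr (F : ∀ a b, J a b → V) {a b : S}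
    {r r' : Chain (fun a b => Chain J a b) a b} (h : r = r') :
    HEq (substChain E F r) (substChain E F r') := by
  subst h
  rfl

lemma multitensor_assoc_heq (Z : List (List (List V))) :
    HEq (E.subst (Z.map fun L => L.map E.tensor.obj) ≫ E.tensor.map (eqToHom (by simp)) ≫
        E.subst Z.flatten)
      (E.tensor.map (seqHomOfList (f := fun L : List (List V) => E.tensor.obj (L.map E.tensor.obj))
        (g := fun L => E.tensor.obj L.flatten) E.subst Z ≫
        eqToHom (by simp : (Z.map fun L => E.tensor.obj L.flatten) =
          (Z.map List.flatten).map E.tensor.obj)) ≫ E.subst (Z.map List.flatten)) := by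
  have h := E.assoc Z
  exact (map_eqToHom_heq E.tensor (by simp) _).symm.trans ((heq_of_eq h).trans
    ((heq_of_eq (Category.assoc _ _ _).symm).trans (heq_map_eqToHom E.tensor _ _)))

lemma substChain_assoc (F : ∀ a b, J a b → V) {a b : S}
    (r : Chain (fun a b => Chain (fun a b => Chain J a b) a b) a b) :
    HEq (E.tensor.map (labelsHom
        (F := fun _ _ p => E.tensor.obj (labels (fun _ _ q => E.tensor.obj (labels F q)) p))
        (F' := fun _ _ p => E.tensor.obj (labels F p)) (f := fun a => a)
        (g := fun _ _ p => flatten p) (fun _ _ p => substChain E F p) r) ≫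
      substChain E F (map (fun a => a) (fun _ _ p => flatten p) r))
      (substChain E (fun _ _ p => E.tensor.obj (labels F p)) r ≫ substChain E F (flatten r)) := by
  set Z := labels (fun _ _ p => labels (fun _ _ q => labels F q) p) r with hZ
  have e1 : (Z.map fun L => L.map E.tensor.obj) =
      labels (fun _ _ p => labels (fun _ _ q => E.tensor.obj (labels F q)) p) r := by
    simp only [hZ, list_map_labels]
  have e2 : Z.flatten = labels (fun _ _ p => labels F p) (flatten r) := labels_flatten _ _
  have e3 : Z.map List.flatten =
      labels (fun _ _ p => labels F p) (map (fun a => a) (fun _ _ p => flatten p) r) := by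
    simp only [hZ, list_map_labels, labels_map, labels_flatten]
  have e4 : (Z.map fun L => E.tensor.obj (L.map E.tensor.obj)) =
      labels (fun _ _ p => E.tensor.obj (labels (fun _ _ q => E.tensor.obj (labels F q)) p)) r := by
    simp only [hZ, list_map_labels]
  have e5 : (Z.map fun L => E.tensor.obj L.flatten) =
      labels (fun _ _ p => E.tensor.obj (labels F p))
        (map (fun a => a) (fun _ _ p => flatten p) r) := by
    simp only [hZ, list_map_labels, labels_map, labels_flatten]
  have e6 : (Z.map List.flatten).map E.tensor.obj = Z.map fun L => E.tensor.obj L.flatten := by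
    simp
  refine HEq.trans ?_ ((multitensor_assoc_heq (E := E) Z).symm.trans ?_)
  · refine heq_comp (congrArg _ e4.symm) (congrArg _ (e5.symm.trans e6.symm)) ?_
      (map_heq _ e4.symm (e5.symm.trans e6.symm) ?_)
      ((substChain_heq _ _).trans (subst_heq e3.symm))
    · rw [e3, labels_flatten]
    · refine HEq.trans ?_ (comp_eqToHom_heq _ _).symm
      refine HEq.trans ?_ (seqHomOfList_labels _ _ _).symm
      refine labelsHom_congr ?_ ?_ (fun a b p => substChain_heq _ _) r
      · intro a b p
        simp only [list_map_labels]
      · intro a b p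
        simp only [labels_flatten]
  · refine heq_comp (congrArg _ (by rw [e1, list_map_labels])) (congrArg _ ?_) (congrArg _ ?_)
      ((subst_heq e1).trans (substChain_heq _ _).symm) ?_
    · rw [e1, labels_flatten]
    · rw [e2, labels_flatten]
    · exact (map_eqToHom_heq _ _ _).trans ((subst_heq e2).trans (substChain_heq _ _).symm)

lemma substChain_single (F : ∀ a b, J a b → V) {a b : S} (p : Chain J a b) :
    HEq (E.unit (E.tensor.obj (labels F p)) ≫ substChain E F (single p))
      (𝟙 (E.tensor.obj (labels F p))) := by
  have h := E.unit_subst (labels F p)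
  refine HEq.trans ?_ (heq_of_eq h)
  refine heq_comp rfl rfl (congrArg _ (congrArg _ (append_nil p))) HEq.rfl ?_
  exact (substChain_heq _ _).trans (heq_map_eqToHom _ _ _).symm

lemma substChain_map_single (F : ∀ a b, J a b → V) {a b : S} (p : Chain J a b) :
    HEq (E.tensor.map (labelsHom (F := F) (F' := fun _ _ q => E.tensor.obj (labels F q))
        (f := fun a => a) (g := fun _ _ j => single j) (fun _ _ j => E.unit (F _ _ j)) p) ≫
      substChain E F (map (fun a => a) (fun _ _ j => single j) p))
      (𝟙 (E.tensor.obj (labels F p))) := by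
  set Z := labels F p with hZ
  have h := E.map_unit_subst Z
  have e1 : (Z.map fun X => [X]) =
      labels (fun _ _ q => labels F q) (map (fun a => a) (fun _ _ j => single j) p) := by
    simp only [hZ, list_map_labels, labels_map]
    rfl
  have e2 : labels (fun _ _ q => E.tensor.obj (labels F q))
      (map (fun a => a) (fun _ _ j => single j) p) = (Z.map fun X => [X]).map E.tensor.obj := by
    rw [e1, list_map_labels]
  refine HEq.trans ?_ (heq_of_eq h)
  refine heq_comp rfl (congrArg _ e2) (congrArg _ (congrArg _ (flatten_map_single p)))
    (map_heq _ rfl e2 ?_) ?_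
  · refine HEq.trans ?_ ((eqToHom_comp_eqToHom_heq (V := List V) _ _ _).symm)
    refine HEq.trans ?_ (seqHomOfList_labels (k := fun X : V => X) (l := fun X : V => E.tensor.obj [X]) _ _ _).symm
    exact labelsHom_congr (V := V) (F := F) (f₂ := fun a => a) (g₂ := fun _ _ j => j) (F₂ := F)
      (F₂' := fun _ _ j => E.tensor.obj [F _ _ j]) (ψ₂ := fun _ _ j => E.unit (F _ _ j))
      (fun _ _ _ => rfl) (fun _ _ _ => rfl) (fun _ _ _ => HEq.rfl) p
  · exact (substChain_heq _ _).trans ((subst_heq e1.symm).trans (heq_map_eqToHom _ _ _).symm)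


lemma substChain_app {A B : Multitensor V} (α : A ⟶ B) (F : ∀ a b, J a b → V) {a b : S}
    (r : Chain (fun a b => Chain J a b) a b) :
    HEq (substChain A F r ≫ α.toNatTrans.app (labels F (flatten r)))
      (A.tensor.map (labelsHom (F' := fun _ _ p => B.tensor.obj (labels F p)) (f := fun a => a)
          (g := fun _ _ p => p) (fun _ _ p => α.toNatTrans.app (labels F p)) r) ≫
        α.toNatTrans.app _ ≫ substChain B F (map (fun a => a) (fun _ _ p => p) r)) := by
  have happ : ∀ {Z Z' : List V}, Z = Z' →
      HEq (α.toNatTrans.app Z) (α.toNatTrans.app Z') := fun h => by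
    subst h
    rfl
  have h := α.subst_comp (labels (fun _ _ p => labels F p) r)
  have e := map_id r
  have e1 := list_map_labels (fun _ _ p => labels F p) A.tensor.obj r
  have e2 : labels (fun _ _ p => B.tensor.obj (labels F p)) (map (fun a => a) (fun _ _ p => p) r) =
      (labels (fun _ _ p => labels F p) r).map B.tensor.obj := by
    rw [e, list_map_labels]
  have e3 := labels_flatten F r
  refine HEq.trans ?_ ((heq_of_eq h).trans ?_)
  · exact heq_comp (congrArg _ e1.symm) (congrArg _ e3.symm) (congrArg _ e3.symm)
      (substChain_heq F r) (happ e3.symm)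
  · refine heq_comp (congrArg _ e1) (congrArg _ e2.symm) (congrArg _ (e3.trans ?_))
      (map_heq _ e1 e2.symm (seqHomOfList_labels (k := A.tensor.obj) (l := B.tensor.obj) _ _ _))
      (heq_comp (congrArg _ e2.symm) (congrArg _ e2.symm) (congrArg _ (e3.trans ?_))
        (happ e2.symm) ?_)
    · rw [e]
    · rw [e]
    · exact (substChain_heq F r).symm.trans (substChain_congr F e.symm)
variable [HasCoproducts.{w} V] (E)

/-- The homs `Γ E X (a, b) = ∐ E (X (x₀, x₁), …, X (xₙ₋₁, xₙ))`, where the coproduct is taken over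
all finite sequences `a = x₀, …, xₙ = b` of objects of `X`. -/
noncomputable def gammaHom {S : Type w} (H : S → S → V) (a b : S) : V :=
  ∐ fun q : ObjSeq a b => E.tensor.obj (homs H q)

/-- The coproduct inclusion for a given sequence. -/
noncomputable def gammaι {S : Type w} (H : S → S → V) {a b : S} (q : ObjSeq a b) :
    E.tensor.obj (homs H q) ⟶ gammaHom E H a b :=
  Sigma.ι (fun q : ObjSeq a b => E.tensor.obj (homs H q)) q

/-- The map out of the coproduct with given restrictions to the summands. -/
noncomputable def gammaDesc {S : Type w} {H : S → S → V} {a b : S} {Z : V}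
    (φ : ∀ q : ObjSeq a b, E.tensor.obj (homs H q) ⟶ Z) : gammaHom E H a b ⟶ Z :=
  Limits.Sigma.desc φ

lemma gammaι_desc {S : Type w} {H : S → S → V} {a b : S} {Z : V}
    (φ : ∀ q : ObjSeq a b, E.tensor.obj (homs H q) ⟶ Z) (q : ObjSeq a b) :
    gammaι E H q ≫ gammaDesc E φ = φ q :=
  Sigma.ι_desc _ _

lemma gamma_hom_ext {S : Type w} {H : S → S → V} {a b : S} {Z : V} {φ ψ : gammaHom E H a b ⟶ Z}
    (h : ∀ q : ObjSeq a b, gammaι E H q ≫ φ = gammaι E H q ≫ ψ) : φ = ψ :=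
  Sigma.hom_ext _ _ h


/-- Given graph maps `i : F j ⟶ H (a, b)`, the composite
`E (F j₁, …, F jₙ) ⟶ E (H (x₀, x₁), …, H (xₙ₋₁, xₙ)) ⟶ Γ E H (a, b)`. -/
noncomputable def gammaChainι (i : ∀ a b j, F a b j ⟶ H a b) {a b : S} (p : Chain J a b) :
    E.tensor.obj (labels F p) ⟶ gammaHom E H a b :=
  E.tensor.map (labelsHom (F' := fun a b _ => H a b) i p) ≫ gammaι E H (objSeq p)

lemma gammaι_eq {a b : S} {q q' : ObjSeq a b} (h : q = q') :
    HEq (gammaι E H q) (gammaι E H q') := by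
  subst h
  rfl

lemma choiceHom_gammaι (i : ∀ a b j, F a b j ⟶ H a b) {a b : S} (q : ObjSeq a b)
    (c : Choice J q) :
    E.tensor.map (choiceHom i q c) ≫ gammaι E H q = gammaChainι E i (ofChoice q c) := by
  have h := (objSeq_ofChoice q c).symm
  have h' := congrArg (homs H) h
  exact eq_of_heq (heq_comp rfl (congrArg _ h') rfl
    (map_heq _ rfl h' (choiceHom_heq i q c)) (gammaι_eq E h))

variable {E} in
/-- For `E` distributive, coproduct decompositions `H (a, b) ≅ ∐ F j` induce coproduct
decompositions of `Γ E H (a, b)`. -/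
lemma gammaChain_isColimit (hE : E.IsDistributive) (i : ∀ a b j, F a b j ⟶ H a b)
    (hi : ∀ a b, Nonempty (IsColimit (Cofan.mk (H a b) (i a b)))) (a b : S) :
    Nonempty (IsColimit (Cofan.mk (gammaHom E H a b)
      fun p : Chain J a b => gammaChainι E i p)) := by
  have hd : ∀ (t : Cofan fun p : Chain J a b => E.tensor.obj (labels F p)) (q : ObjSeq a b),
      ∃ φ : E.tensor.obj (homs H q) ⟶ t.pt, ∀ c : Choice J q,
        E.tensor.map (choiceHom i q c) ≫ φ = t.inj (ofChoice q c) :=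
    fun t q => choice_desc (G := E.tensor) hE i hi q fun c => t.inj (ofChoice q c)
  choose φ hφ using hd
  refine ⟨Cofan.IsColimit.mk _ (fun t => gammaDesc E (φ t)) ?_ ?_⟩
  · intro t p
    obtain ⟨q, c, rfl⟩ : ∃ q c, p = ofChoice q c := ⟨_, _, (ofChoice_choice p).symm⟩
    have h1 := choiceHom_gammaι E i q c
    have h2 := hφ t q c
    change gammaChainι E i (ofChoice q c) ≫ _ = _
    rw [← h1, Category.assoc, gammaι_desc, h2]
  · intro t m hm
    refine gamma_hom_ext E fun q => ?_
    rw [gammaι_desc]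
    refine choice_hom_ext (G := E.tensor) hE i hi q _ _ fun c => ?_
    rw [hφ, ← Category.assoc]
    refine Eq.trans ?_ (hm _)
    exact congrArg (· ≫ m) (choiceHom_gammaι E i q c)

/-- The map `Γ E f` on homs, for a graph map `f` with object map `f` and hom maps `φ`. -/
noncomputable def gammaMap {f : S → S'} (φ : ∀ a b, H a b ⟶ H' (f a) (f b)) (a b : S) :
    gammaHom E H a b ⟶ gammaHom E H' (f a) (f b) :=
  gammaDesc E fun q =>
    E.tensor.map (labelsHom (F := fun a b _ => H a b) (F' := fun a b _ => H' a b)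
      (J' := fun _ _ : S' => PUnit.{w + 1}) (f := f) (g := fun _ _ _ => PUnit.unit) (fun a b _ => φ a b) q) ≫
      gammaι E H' (map f (fun _ _ _ => PUnit.unit) q)

variable {E} {J₁ : S → S → Type w} {F₁ : ∀ a b, J₁ a b → V}

lemma gammaChainι_gammaMap {f : S → S'} {g : ∀ a b, J a b → J' (f a) (f b)}
    (φ : ∀ a b, H a b ⟶ H' (f a) (f b)) (i : ∀ a b j, F a b j ⟶ H a b)
    (i' : ∀ a b j, F' a b j ⟶ H' a b) (ψ : ∀ a b j, F a b j ⟶ F' (f a) (f b) (g a b j))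
    (h : ∀ a b j, i a b j ≫ φ a b = ψ a b j ≫ i' _ _ (g a b j)) {a b : S} (p : Chain J a b) :
    gammaChainι E i p ≫ gammaMap E φ a b =
      E.tensor.map (labelsHom ψ p) ≫ gammaChainι E i' (map f g p) := by
  have e : (map f (fun _ _ _ => PUnit.unit) (objSeq p) : ObjSeq (f a) (f b)) =
      objSeq (map f g p) := by
    rw [objSeq, objSeq, map_map, map_map]
  have h1 := labelsHom_comp (J' := fun _ _ : S => PUnit.{w + 1}) (g := fun _ _ _ => PUnit.unit) (J'' := fun _ _ : S' => PUnit.{w + 1})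
    (g' := fun _ _ _ => PUnit.unit)
    (F' := fun a b _ => H a b) (F'' := fun a b _ => H' a b) i (fun a b _ => φ a b) p
  have h2 := labelsHom_comp (J'' := fun _ _ : S' => PUnit.{w + 1})
    (g' := fun _ _ _ => PUnit.unit) (F'' := fun a b _ => H' a b) ψ i' p
  have h3 := (heq_of_eq (congrArg (fun k => labelsHom (F' := fun a b _ => H' a b) (f := f)
    (J' := fun _ _ : S' => PUnit.{w + 1}) (g := fun _ _ _ => PUnit.unit) k p) (funext fun a => funext fun b => funext fun j =>
      h a b j)))
  rw [gammaChainι, gammaChainι, Category.assoc, gammaMap, gammaι_desc, ← Category.assoc,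
    ← Category.assoc, ← E.tensor.map_comp, ← E.tensor.map_comp]
  exact eq_of_heq (heq_comp rfl (congrArg (fun q => E.tensor.obj (homs H' q)) e) rfl
    (map_heq _ rfl (congrArg (homs H') e) (h1.trans (h3.trans h2.symm))) (gammaι_eq E e))


lemma gammaMap_id (a b : S) :
    gammaMap E (f := fun a => a) (fun a b => 𝟙 (H a b)) a b = 𝟙 (gammaHom E H a b) := by
  refine gamma_hom_ext E fun q => ?_
  rw [gammaMap, gammaι_desc, Category.comp_id]
  have e : map (fun a => a) (fun _ _ _ => PUnit.unit) q = q := map_id q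
  have h1 := map_heq E.tensor rfl (congrArg (homs H) e)
    (labelsHom_id (fun a b _ => H a b) q)
  have h2 := heq_comp rfl (congrArg E.tensor.obj (congrArg (homs H) e)) rfl h1 (gammaι_eq E e)
  rw [eq_of_heq h2, E.tensor.map_id, Category.id_comp]

lemma gammaMap_congr {f : S → S'} {φ φ' : ∀ a b, H a b ⟶ H' (f a) (f b)}
    (h : ∀ a b, φ a b = φ' a b) (a b : S) : gammaMap E φ a b = gammaMap E φ' a b := by
  obtain rfl : φ = φ' := funext fun a => funext fun b => h a b
  rfl

lemma gammaι_gammaMap {f : S → S'} (φ : ∀ a b, H a b ⟶ H' (f a) (f b)) {a b : S}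
    (q : ObjSeq a b) :
    gammaι E H q ≫ gammaMap E φ a b =
      E.tensor.map (labelsHom (F := fun a b _ => H a b) (F' := fun a b _ => H' a b)
        (J' := fun _ _ : S' => PUnit.{w + 1}) (f := f) (g := fun _ _ _ => PUnit.unit)
        (fun a b _ => φ a b) q) ≫ gammaι E H' (map f (fun _ _ _ => PUnit.unit) q) :=
  gammaι_desc E _ q

lemma gammaMap_comp {H'' : S'' → S'' → V} {f : S → S'} {f' : S' → S''}
    (φ : ∀ a b, H a b ⟶ H' (f a) (f b)) (φ' : ∀ a b, H' a b ⟶ H'' (f' a) (f' b)) (a b : S) :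
    gammaMap E (f := fun a => f' (f a)) (fun a b => φ a b ≫ φ' (f a) (f b)) a b =
      gammaMap E φ a b ≫ gammaMap E φ' (f a) (f b) := by
  refine gamma_hom_ext E fun q => ?_
  have e := map_map (J' := fun _ _ : S' => PUnit.{w + 1}) (J'' := fun _ _ : S'' => PUnit.{w + 1})
    (f := f) (g := fun _ _ _ => PUnit.unit) (f' := f') (g' := fun _ _ _ => PUnit.unit) q
  have h1 := labelsHom_comp (J' := fun _ _ : S' => PUnit.{w + 1}) (g := fun _ _ _ => PUnit.unit)
    (J'' := fun _ _ : S'' => PUnit.{w + 1}) (g' := fun _ _ _ => PUnit.unit)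
    (F := fun a b _ => H a b) (F' := fun a b _ => H' a b) (F'' := fun a b _ => H'' a b)
    (fun a b _ => φ a b) (fun a b _ => φ' a b) q
  rw [gammaι_gammaMap, ← Category.assoc, gammaι_gammaMap, Category.assoc, gammaι_gammaMap,
    ← Category.assoc, ← E.tensor.map_comp]
  exact eq_of_heq (heq_comp rfl (congrArg (fun q => E.tensor.obj (homs H'' q)) e.symm) rfl
    (map_heq E.tensor rfl (congrArg (homs H'') e.symm) h1.symm) (gammaι_eq E e.symm))

lemma gammaChainι_map {g : ∀ a b, J a b → J₁ a b} (i : ∀ a b j, F a b j ⟶ H a b)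
    (i' : ∀ a b j, F₁ a b j ⟶ H a b) (ψ : ∀ a b j, F a b j ⟶ F₁ a b (g a b j))
    (h : ∀ a b j, i a b j = ψ a b j ≫ i' _ _ (g a b j)) {a b : S} (p : Chain J a b) :
    gammaChainι E i p = E.tensor.map (labelsHom (f := fun a => a) ψ p) ≫
      gammaChainι E i' (map (fun a => a) g p) := by
  have h' := gammaChainι_gammaMap (E := E) (f := fun a => a) (g := g) (fun a b => 𝟙 (H a b)) i i' ψ
    (fun a b j => (Category.comp_id _).trans (h a b j)) p
  rw [gammaMap_id, Category.comp_id] at h'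
  exact h'

lemma gamma_isColimit (H : S → S → V) (a b : S) :
    Nonempty (IsColimit (Cofan.mk (gammaHom E H a b) fun q : ObjSeq a b => gammaι E H q)) :=
  ⟨coproductIsCoproduct _⟩

variable (E) in
/-- The multiplication of `Γ E`. Since `E` is distributive, `Γ E (Γ E X) (a, b)` is the coproduct of
the `E (E (X (x₀₀, x₀₁), …), …, E (X (xₙ₀, xₙ₁), …))` over all doubly-nested sequences, and the
multiplication is given on summands by substitution. -/
noncomputable def gammaμ (hE : E.IsDistributive) (H : S → S → V) (a b : S) :
    gammaHom E (gammaHom E H) a b ⟶ gammaHom E H a b :=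
  Cofan.IsColimit.desc (gammaChain_isColimit hE (fun _ _ q => gammaι E H q)
    (gamma_isColimit H) a b).some
    fun r => substChain E (fun a b _ => H a b) r ≫ gammaι E H (flatten r)

lemma gammaChainι_gammaμ₀ (hE : E.IsDistributive) (H : S → S → V) {a b : S}
    (r : Chain (fun a b : S => ObjSeq a b) a b) :
    gammaChainι E (fun _ _ q => gammaι E H q) r ≫ gammaμ E hE H a b =
      substChain E (fun a b _ => H a b) r ≫ gammaι E H (flatten r) :=
  Cofan.IsColimit.fac (gammaChain_isColimit hE (fun _ _ q => gammaι E H q)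
    (gamma_isColimit H) a b).some _ r

lemma gammaChainι_gammaμ (hE : E.IsDistributive) (i : ∀ a b j, F a b j ⟶ H a b) {a b : S}
    (r : Chain (fun a b => Chain J a b) a b) :
    gammaChainι E (fun _ _ p => gammaChainι E i p) r ≫ gammaμ E hE H a b =
      substChain E F r ≫ gammaChainι E i (flatten r) := by
  have h1 := gammaChainι_map (E := E) (J₁ := fun a b : S => ObjSeq a b)
    (g := fun _ _ p => objSeq p) (fun _ _ p => gammaChainι E i p) (fun _ _ q => gammaι E H q)
    (fun _ _ p => E.tensor.map (labelsHom (F' := fun a b _ => H a b) i p))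
    (fun _ _ p => rfl) r
  have h2 := substChain_naturality (E := E) (J' := fun _ _ : S => PUnit.{w + 1})
    (f := fun a => a) (g := fun _ _ _ => PUnit.unit) (F' := fun a b _ => H a b) i r
  have e := map_flatten (J' := fun _ _ : S => PUnit.{w + 1})
    (f := fun a => a) (g := fun _ _ _ => PUnit.unit) r
  rw [h1, Category.assoc, gammaChainι_gammaμ₀, gammaChainι, ← Category.assoc, ← Category.assoc]
  exact eq_of_heq (heq_comp rfl (congrArg (fun q => E.tensor.obj (homs H q)) e) rfl h2
    (gammaι_eq E e))

lemma gammaChainι_congr (i : ∀ a b j, F a b j ⟶ H a b) {a b : S} {p p' : Chain J a b}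
    (h : p = p') : HEq (gammaChainι E i p) (gammaChainι E i p') := by
  subst h
  rfl

variable (E) in
/-- The inclusion of the summand for the sequence `a, b`. -/
noncomputable def gammaιSingle (H : S → S → V) (a b : S) :
    E.tensor.obj [H a b] ⟶ gammaHom E H a b :=
  gammaι E H (single (a := a) (b := b) PUnit.unit)

variable (E) in
/-- The unit of `Γ E`. -/
noncomputable def gammaη (H : S → S → V) (a b : S) : H a b ⟶ gammaHom E H a b :=
  E.unit (H a b) ≫ gammaιSingle E H a b

/-- Maps out of `Γ E X (a, b)` can be compared after a coproduct decomposition of the homs. -/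
lemma gammaChain_hom_ext (hE : E.IsDistributive) (i : ∀ a b j, F a b j ⟶ H a b)
    (hi : ∀ a b, Nonempty (IsColimit (Cofan.mk (H a b) (i a b)))) {a b : S} {Z : V}
    {φ ψ : gammaHom E H a b ⟶ Z}
    (h : ∀ p : Chain J a b, gammaChainι E i p ≫ φ = gammaChainι E i p ≫ ψ) : φ = ψ :=
  Cofan.IsColimit.hom_ext (gammaChain_isColimit hE i hi a b).some _ _ h

lemma gammaη_naturality {f : S → S'} (φ : ∀ a b, H a b ⟶ H' (f a) (f b)) (a b : S) :
    φ a b ≫ gammaη E H' (f a) (f b) = gammaη E H a b ≫ gammaMap E φ a b := by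
  have h : gammaιSingle E H a b ≫ gammaMap E φ a b =
      E.tensor.map (seqCons (φ a b) (𝟙 [])) ≫ gammaιSingle E H' (f a) (f b) :=
    gammaι_gammaMap φ (single PUnit.unit)
  rw [gammaη, gammaη, Category.assoc, h, ← Category.assoc, E.unit_naturality, Category.assoc]

lemma gammaμ_naturality (hE : E.IsDistributive) {f : S → S'}
    (φ : ∀ a b, H a b ⟶ H' (f a) (f b)) (a b : S) :
    gammaMap E (fun a b => gammaMap E φ a b) a b ≫ gammaμ E hE H' (f a) (f b) =
      gammaμ E hE H a b ≫ gammaMap E φ a b := by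
  refine gammaChain_hom_ext hE (fun _ _ q => gammaι E H q) (gamma_isColimit H) fun r => ?_
  have h1 := gammaChainι_gammaMap (E := E) (J' := fun a b : S' => ObjSeq a b)
    (f := f) (g := fun _ _ q => map f (fun _ _ _ => PUnit.unit) q) (fun a b => gammaMap E φ a b)
    (fun _ _ q => gammaι E H q) (fun _ _ q => gammaι E H' q)
    (fun _ _ q => E.tensor.map (labelsHom (F' := fun a b _ => H' a b) (fun a b _ => φ a b) q))
    (fun _ _ q => gammaι_gammaMap φ q) r
  have h2 := substChain_naturality (E := E) (J' := fun _ _ : S' => PUnit.{w + 1})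
    (f := f) (g := fun _ _ _ => PUnit.unit) (F' := fun a b _ => H' a b) (fun a b _ => φ a b) r
  have e := map_flatten (J' := fun _ _ : S' => PUnit.{w + 1})
    (f := f) (g := fun _ _ _ => PUnit.unit) r
  rw [← Category.assoc, h1, Category.assoc, gammaChainι_gammaμ₀, ← Category.assoc,
    ← Category.assoc, gammaChainι_gammaμ₀, Category.assoc]
  refine Eq.trans ?_ (Category.assoc _ _ _).symm
  refine Eq.trans ?_ (congrArg (substChain E (fun a b _ => H a b) r ≫ ·)
    (gammaι_gammaMap φ (flatten r))).symm
  refine (Category.assoc _ _ _).symm.trans (Eq.trans ?_ (Category.assoc _ _ _))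
  exact eq_of_heq (heq_comp rfl (congrArg (fun q => E.tensor.obj (homs H' q)) e) rfl h2
    (gammaι_eq E e))

lemma gamma_left_unit (hE : E.IsDistributive) (H : S → S → V) (a b : S) :
    gammaη E (gammaHom E H) a b ≫ gammaμ E hE H a b = 𝟙 _ := by
  refine gamma_hom_ext E fun q => ?_
  have h0 : (E.tensor.map (seqCons (gammaι E H q) (𝟙 [])) ≫ gammaιSingle E (gammaHom E H) a b) ≫
      gammaμ E hE H a b = substChain E (fun a b _ => H a b) (single q) ≫
        gammaι E H (flatten (single q)) :=
    gammaChainι_gammaμ₀ hE H (single q)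
  have h1 := substChain_single (E := E) (fun a b _ => H a b) q
  have e := flatten_single q
  have h2 : E.unit (E.tensor.obj (homs H q)) ≫ (substChain E (fun a b _ => H a b) (single q) ≫
        gammaι E H (flatten (single q))) = gammaι E H q := by
    refine (Category.assoc _ _ _).symm.trans ((eq_of_heq (heq_comp rfl
      (congrArg (fun q => E.tensor.obj (homs H q)) e) rfl h1 (gammaι_eq E e))).trans ?_)
    exact Category.id_comp _
  rw [Category.comp_id, gammaη, ← Category.assoc, ← Category.assoc, E.unit_naturality,
    Category.assoc, Category.assoc, ← Category.assoc (E.tensor.map _), h0]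
  exact h2

lemma gamma_right_unit (hE : E.IsDistributive) (H : S → S → V) (a b : S) :
    gammaMap E (f := fun a => a) (fun a b => gammaη E H a b) a b ≫ gammaμ E hE H a b = 𝟙 _ := by
  refine gamma_hom_ext E fun q => ?_
  have h0 : gammaι E H q ≫ gammaMap E (f := fun a => a) (fun a b => gammaη E H a b) a b =
      E.tensor.map (labelsHom (F' := fun _ _ q => E.tensor.obj (homs H q)) (f := fun a => a)
        (g := fun _ _ _ => single PUnit.unit) (fun a b _ => E.unit (H a b)) q) ≫
      gammaChainι E (fun _ _ q => gammaι E H q)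
        (map (fun a => a) (fun _ _ _ => single PUnit.unit) q) := by
    have h := gammaChainι_gammaMap (E := E) (J' := fun a b : S => ObjSeq a b) (f := fun a => a)
      (g := fun _ _ _ => single PUnit.unit) (fun a b => gammaη E H a b)
      (fun a b (_ : PUnit.{w + 1}) => 𝟙 (H a b))
      (fun _ _ q => gammaι E H q) (fun a b _ => E.unit (H a b))
      (fun a b _ => Category.id_comp (gammaη E H a b)) q
    refine Eq.trans (congrArg (· ≫ _) ?_) h
    have h2 := map_heq E.tensor rfl (congrArg (homs H) (map_id q))
      (labelsHom_id (fun a b _ => H a b) q)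
    rw [E.tensor.map_id] at h2
    refine (Category.id_comp _).symm.trans ?_
    exact (eq_of_heq (heq_comp rfl (congrArg (fun q => E.tensor.obj (homs H q)) (map_id q)) rfl
      h2 (gammaι_eq E (map_id q)))).symm
  have h1 := substChain_map_single (E := E) (fun a b _ => H a b) q
  have e := flatten_map_single q
  rw [← Category.assoc, h0, Category.assoc, gammaChainι_gammaμ₀, ← Category.assoc]
  refine (eq_of_heq (heq_comp rfl (congrArg (fun q => E.tensor.obj (homs H q)) e) rfl h1
    (gammaι_eq E e))).trans ?_
  rw [Category.id_comp, Category.comp_id]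

lemma gamma_assoc (hE : E.IsDistributive) (H : S → S → V) (a b : S) :
    gammaMap E (f := fun a => a) (fun a b => gammaμ E hE H a b) a b ≫ gammaμ E hE H a b =
      gammaμ E hE (gammaHom E H) a b ≫ gammaμ E hE H a b := by
  refine gammaChain_hom_ext hE
    (fun a b (r : Chain (fun a b : S => ObjSeq a b) a b) =>
      gammaChainι E (fun _ _ q => gammaι E H q) r)
    (gammaChain_isColimit hE _ (gamma_isColimit H)) fun t => ?_
  have h1 := gammaChainι_gammaMap (E := E) (J' := fun a b : S => ObjSeq a b) (f := fun a => a)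
    (g := fun _ _ r => flatten r) (fun a b => gammaμ E hE H a b)
    (fun _ _ r => gammaChainι E (fun _ _ q => gammaι E H q) r)
    (fun _ _ q => gammaι E H q) (fun _ _ r => substChain E (fun a b _ => H a b) r)
    (fun _ _ r => gammaChainι_gammaμ₀ hE H r) t
  have h2 := gammaChainι_gammaμ (E := E) hE (fun (_ _ : S) q => gammaι E H q) t
  have h3 := substChain_assoc (E := E) (fun a b (_ : PUnit.{w + 1}) => H a b) t
  have e := flatten_flatten t
  have h4 : (gammaChainι E (fun _ _ r => gammaChainι E (fun _ _ q => gammaι E H q) r) t ≫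
      gammaμ E hE (gammaHom E H) a b) ≫ gammaμ E hE H a b =
      (substChain E (fun _ _ q => E.tensor.obj (homs H q)) t ≫
        substChain E (fun a b _ => H a b) (flatten t)) ≫ gammaι E H (flatten (flatten t)) := by
    rw [h2, Category.assoc, gammaChainι_gammaμ₀, Category.assoc]
  refine Eq.trans ?_ (h4.symm.trans (Category.assoc _ _ _))
  rw [← Category.assoc, h1, Category.assoc, gammaChainι_gammaμ₀, ← Category.assoc]
  exact eq_of_heq (heq_comp rfl (congrArg (fun q => E.tensor.obj (homs H q)) e) rfl h3
    (gammaι_eq E e))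

variable (E) in
/-- The monad `Γ E` on `𝒢V` over `Set`, for a distributive multitensor `E`. -/
noncomputable def gamma (hE : E.IsDistributive) : MonadOverSet V where
  hom X := gammaHom E X.hom
  map f := gammaMap E f.hom
  map_id _ := gammaMap_id
  map_comp f g := gammaMap_comp f.hom g.hom
  η X := gammaη E X.hom
  η_naturality f := gammaη_naturality f.hom
  μ X := gammaμ E hE X.hom
  μ_naturality f := gammaμ_naturality hE f.hom
  left_unit X := gamma_left_unit hE X.hom
  right_unit X := gamma_right_unit hE X.hom
  assoc X := gamma_assoc hE X.hom


/-! ### Functoriality of `Γ` -/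

variable {A B : Multitensor V}

/-- The homs of the morphism `Γ α`, for a morphism of multitensors `α`. -/
noncomputable def gammaApp (α : A ⟶ B) (H : S → S → V) (a b : S) :
    gammaHom A H a b ⟶ gammaHom B H a b :=
  gammaDesc A fun q => α.toNatTrans.app (homs H q) ≫ gammaι B H q

lemma gammaι_gammaApp (α : A ⟶ B) (H : S → S → V) {a b : S} (q : ObjSeq a b) :
    gammaι A H q ≫ gammaApp α H a b = α.toNatTrans.app (homs H q) ≫ gammaι B H q :=
  gammaι_desc A _ q

lemma gammaChainι_gammaApp (α : A ⟶ B) (i : ∀ a b j, F a b j ⟶ H a b) {a b : S}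
    (p : Chain J a b) :
    gammaChainι A i p ≫ gammaApp α H a b =
      α.toNatTrans.app (labels F p) ≫ gammaChainι B i p := by
  rw [gammaChainι, Category.assoc, gammaι_gammaApp, ← Category.assoc, α.toNatTrans.naturality,
    Category.assoc]
  rfl

lemma gammaApp_naturality (α : A ⟶ B) {f : S → S'} (φ : ∀ a b, H a b ⟶ H' (f a) (f b))
    (a b : S) :
    gammaMap A φ a b ≫ gammaApp α H' (f a) (f b) = gammaApp α H a b ≫ gammaMap B φ a b := by
  refine gamma_hom_ext A fun q => ?_
  rw [← Category.assoc, gammaι_gammaMap, Category.assoc, gammaι_gammaApp, ← Category.assoc,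
    α.toNatTrans.naturality, ← Category.assoc, gammaι_gammaApp, Category.assoc, Category.assoc,
    gammaι_gammaMap]

lemma gammaApp_η (α : A ⟶ B) (H : S → S → V) (a b : S) :
    gammaη A H a b ≫ gammaApp α H a b = gammaη B H a b := by
  have h : gammaιSingle A H a b ≫ gammaApp α H a b =
      α.toNatTrans.app [H a b] ≫ gammaιSingle B H a b :=
    gammaι_gammaApp α H (single PUnit.unit)
  rw [gammaη, Category.assoc, h, ← Category.assoc, α.unit_comp, gammaη]

lemma gammaApp_μ (hA : A.IsDistributive) (hB : B.IsDistributive) (α : A ⟶ B) (H : S → S → V)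
    (a b : S) :
    gammaμ A hA H a b ≫ gammaApp α H a b =
      (gammaMap A (f := fun a => a) (gammaApp α H) a b ≫ gammaApp α (gammaHom B H) a b) ≫
        gammaμ B hB H a b := by
  refine gammaChain_hom_ext hA (fun _ _ q => gammaι A H q) (gamma_isColimit H) fun r => ?_
  have h1 := gammaChainι_gammaMap (E := A) (J' := fun a b : S => ObjSeq a b) (f := fun a => a)
    (g := fun _ _ q => q) (gammaApp α H) (fun _ _ q => gammaι A H q) (fun _ _ q => gammaι B H q)
    (fun _ _ q => α.toNatTrans.app (homs H q)) (fun _ _ q => gammaι_gammaApp α H q) r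
  have h2 := gammaChainι_gammaApp α (H := gammaHom B H) (fun (_ _ : S) q => gammaι B H q)
    (map (fun a => a) (fun _ _ q => q) r)
  have h3 := gammaChainι_gammaμ₀ hB H (map (fun a => a) (fun _ _ q => q) r)
  have h4 := substChain_app α (fun a b (_ : PUnit.{w + 1}) => H a b) r
  have e := map_id r
  have h5 := gammaι_gammaApp α H (flatten r)
  calc gammaChainι A (fun _ _ q => gammaι A H q) r ≫ gammaμ A hA H a b ≫ gammaApp α H a b
      = (substChain A (fun a b _ => H a b) r ≫ α.toNatTrans.app (homs H (flatten r))) ≫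
          gammaι B H (flatten r) := by
        rw [← Category.assoc, gammaChainι_gammaμ₀, Category.assoc, h5, Category.assoc]
    _ = (A.tensor.map (labelsHom (F' := fun _ _ q => B.tensor.obj (homs H q)) (f := fun a => a)
          (g := fun _ _ p => p) (fun _ _ q => α.toNatTrans.app (homs H q)) r) ≫
          α.toNatTrans.app _ ≫
            substChain B (fun a b _ => H a b) (map (fun a => a) (fun _ _ p => p) r)) ≫
          gammaι B H (flatten (map (fun a => a) (fun _ _ p => p) r)) :=
        eq_of_heq (heq_comp rfl (congrArg (fun r => B.tensor.obj (homs H (flatten r))) e.symm) rfl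
          h4 (gammaι_eq B (congrArg flatten e.symm)))
    _ = _ := by
        have h6 : gammaChainι A (fun _ _ q => gammaι A H q) r ≫
            (gammaMap A (f := fun a => a) (gammaApp α H) a b ≫ gammaApp α (gammaHom B H) a b) ≫
              gammaμ B hB H a b = ((gammaChainι A (fun _ _ q => gammaι A H q) r ≫
            gammaMap A (f := fun a => a) (gammaApp α H) a b) ≫ gammaApp α (gammaHom B H) a b) ≫
              gammaμ B hB H a b := by
          simp only [Category.assoc]
        refine Eq.trans ?_ h6.symm
        have h7 : ∀ {X : V} (M : X ⟶ _), (M ≫ gammaChainι A (fun _ _ q => gammaι B H q)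
            (map (fun a => a) (fun _ _ q => q) r)) ≫ gammaApp α (gammaHom B H) a b =
            M ≫ α.toNatTrans.app _ ≫ gammaChainι B (fun _ _ q => gammaι B H q)
              (map (fun a => a) (fun _ _ q => q) r) :=
          fun M => by rw [Category.assoc, h2]
        rw [h1, h7]
        simp only [Category.assoc]
        rw [h3]

/-- The morphism `Γ α` of monads over `Set`, for a morphism of multitensors `α`. -/
noncomputable def gammaHomMap (hA : A.IsDistributive) (hB : B.IsDistributive) (α : A ⟶ B) :
    gamma A hA ⟶ gamma B hB where
  app X := gammaApp α X.hom
  naturality f := gammaApp_naturality α f.hom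
  η_comp X := gammaApp_η α X.hom
  μ_comp X := gammaApp_μ hA hB α X.hom

lemma gammaHomMap_id (hA : A.IsDistributive) : gammaHomMap hA hA (𝟙 A) = 𝟙 (gamma A hA) := by
  refine MonadOverSetHom.ext ?_
  funext X a b
  refine gamma_hom_ext A fun q => (gammaι_gammaApp (𝟙 A) X.hom q).trans ?_
  exact (Category.id_comp _).trans (Category.comp_id _).symm

lemma gammaHomMap_comp {C : Multitensor V} (hA : A.IsDistributive) (hB : B.IsDistributive)
    (hC : C.IsDistributive) (α : A ⟶ B) (β : B ⟶ C) :
    gammaHomMap hA hC (α ≫ β) = gammaHomMap hA hB α ≫ gammaHomMap hB hC β := by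
  refine MonadOverSetHom.ext ?_
  funext X a b
  refine gamma_hom_ext A fun q => (gammaι_gammaApp (α ≫ β) X.hom q).trans ?_
  have h : gammaι A X.hom q ≫ gammaApp α X.hom a b ≫ gammaApp β X.hom a b =
      (α.toNatTrans.app (homs X.hom q) ≫ β.toNatTrans.app (homs X.hom q)) ≫ gammaι C X.hom q := by
    rw [← Category.assoc, gammaι_gammaApp, Category.assoc, gammaι_gammaApp, Category.assoc]
  exact h.symm

/-- The functor `Γ_E` from `E`-multitensors to `Γ E`-operads over `Set`, given by
`(A, α) ↦ (Γ A, Γ α)`. It is defined as soon as the multitensors `A` are distributive and the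
monad morphisms `Γ α` are cartesian. -/
noncomputable def gammaFunctor (E : Multitensor V) (hE : E.IsDistributive)
    (hd : ∀ A : EMultitensor E, A.obj.left.IsDistributive)
    (hc : ∀ A : EMultitensor E, NatTrans.Equifibered (MonadHom.toNatTrans
      (MonadOverSetHom.toMonadHom (gammaHomMap (hd A) hE A.obj.hom)))) :
    EMultitensor E ⥤ OperadOverSet (gamma E hE) where
  obj A := ⟨Over.mk (gammaHomMap (hd A) hE A.obj.hom), hc A⟩
  map {A B} f := ObjectProperty.homMk (Over.homMk (gammaHomMap (hd A) (hd B) f.hom.left) 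
    ((gammaHomMap_comp (hd A) (hd B) hE f.hom.left B.obj.hom).symm.trans
      (congrArg (gammaHomMap (hd A) hE) (Over.w f.hom))))
  map_id A := by
    ext : 2
    exact gammaHomMap_id (hd A)
  map_comp {A B C} f g := by
    ext : 2
    exact gammaHomMap_comp (hd A) (hd B) (hd C) f.hom.left g.hom.left

end Gamma

/-! ### Extensive categories -/

section Extensive

variable {V : Type u} [Category.{w} V] [HasCoproducts.{w} V]

/-- The functor `∏ V/Xᵢ ⥤ V/∐ Xᵢ` which sends `(fᵢ : Yᵢ ⟶ Xᵢ)` to `∐ fᵢ : ∐ Yᵢ ⟶ ∐ Xᵢ`. -/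
noncomputable def coprodOver {I : Type w} (X : I → V) : (∀ i, Over (X i)) ⥤ Over (∐ X) where
  obj f := Over.mk (Limits.Sigma.map fun i => (f i).hom)
  map {f g} φ := Over.homMk (Limits.Sigma.map fun i => (φ i).left) (by
    refine Limits.Sigma.hom_ext _ _ fun i => ?_
    simp)
  map_id f := by
    ext
    simp
  map_comp φ ψ := by
    ext
    refine Limits.Sigma.hom_ext _ _ fun i => ?_
    simp

variable (V) in
/-- A category with small coproducts is extensive when all the functors `∏ V/Xᵢ ⥤ V/∐ Xᵢ`, for
small families of objects, are equivalences. -/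
def IsExtensive : Prop :=
  ∀ (I : Type w) (X : I → V), (coprodOver X).IsEquivalence

end Extensive

/-! ### The multitensor `T^×` -/

section ProductMultitensor

variable {V : Type u} [Category.{w} V] [HasFiniteProducts V] (T : Monad V)

/-- The product `T X₁ × … × T Xₙ`, as an iterated binary product. -/
noncomputable def timesObj : List V → V
  | [] => ⊤_ V
  | X :: Xs => T.obj X ⨯ timesObj Xs

noncomputable def timesMap : {Xs Ys : List V} → (Xs ⟶ Ys) → (timesObj T Xs ⟶ timesObj T Ys)
  | [], [], _ => 𝟙 _
  | _ :: _, _ :: _, f => prod.map (T.map f.1) (timesMap f.2)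

/-- The functor `(X₁, …, Xₙ) ↦ T X₁ × … × T Xₙ`. -/
noncomputable def timesFunctor : List V ⥤ V where
  obj := timesObj T
  map := timesMap T
  map_id Xs := by
    induction Xs with
    | nil => rfl
    | cons X Xs ih =>
      exact (congrArg₂ prod.map (T.map_id X) ih).trans prod.map_id_id
  map_comp {L L' L''} f g := by
    induction f using seqHom_induction generalizing L'' with
    | nil => cases L'' with
      | nil => exact (Category.id_comp _).symm
      | cons => exact g.elim
    | cons f fs ih => cases L'' with
      | nil => exact g.elim
      | cons Zs L'' =>
        exact (congrArg₂ prod.map (T.map_comp f g.1) (ih g.2)).trans (prod.map_map _ _ _ _).symm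

/-- The first projection. -/
noncomputable def timesFst (X : V) (Xs : List V) : timesObj T (X :: Xs) ⟶ T.obj X :=
  (prod.fst : T.obj X ⨯ timesObj T Xs ⟶ T.obj X)

/-- The product of the other projections. -/
noncomputable def timesSnd (X : V) (Xs : List V) : timesObj T (X :: Xs) ⟶ timesObj T Xs :=
  (prod.snd : T.obj X ⨯ timesObj T Xs ⟶ timesObj T Xs)

/-- The map into a product with a given first component and given remaining components. -/
noncomputable def timesLift {Z X : V} {Xs : List V} (f : Z ⟶ T.obj X) (g : Z ⟶ timesObj T Xs) :
    Z ⟶ timesObj T (X :: Xs) :=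
  prod.lift f g

/-- The canonical isomorphism `∏ᵢ T Xᵢ × ∏ⱼ T Yⱼ ⟶ ∏ₖ T Zₖ`, where `Z` is the concatenation of `X`
and `Y`. -/
noncomputable def timesAppend : (Xs Ys : List V) →
    (timesObj T Xs ⨯ timesObj T Ys ⟶ timesObj T (Xs ++ Ys))
  | [], _ => prod.snd
  | X :: Xs, Ys =>
    timesLift T (prod.fst ≫ timesFst T X Xs)
      (prod.map (timesSnd T X Xs) (𝟙 _) ≫ timesAppend Xs Ys)

/-- The composite `T (∏ T Xⱼ) ⟶ ∏ T T Xⱼ ⟶ ∏ T Xⱼ` of the product preservation obstruction map of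
`T` and of the multiplication of `T`. -/
noncomputable def timesAct : (Xs : List V) → (T.obj (timesObj T Xs) ⟶ timesObj T Xs)
  | [] => terminal.from _
  | X :: Xs => timesLift T (T.map (timesFst T X Xs) ≫ T.μ.app X)
      (T.map (timesSnd T X Xs) ≫ timesAct Xs)

/-- The substitution `∏ᵢ T (∏ⱼ T Xᵢⱼ) ⟶ ∏ᵢⱼ T Xᵢⱼ`. -/
noncomputable def timesSubst : (Z : List (List V)) →
    (timesObj T (Z.map (timesFunctor T).obj) ⟶ timesObj T Z.flatten)
  | [] => 𝟙 _
  | L :: Z => prod.lift (timesFst T (timesObj T L) (Z.map (timesFunctor T).obj) ≫ timesAct T L)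
      (timesSnd T (timesObj T L) (Z.map (timesFunctor T).obj) ≫ timesSubst Z) ≫ timesAppend T L Z.flatten

/-- The unit `X ⟶ T X`, where `T X` is regarded as a product with one factor. -/
noncomputable def timesUnit (X : V) : X ⟶ timesObj T [X] :=
  timesLift T (T.η.app X) (terminal.from _)

lemma timesLift_fst {Z X : V} {Xs : List V} (f : Z ⟶ T.obj X) (g : Z ⟶ timesObj T Xs) :
    timesLift T f g ≫ timesFst T X Xs = f :=
  Limits.prod.lift_fst f g

lemma timesLift_snd {Z X : V} {Xs : List V} (f : Z ⟶ T.obj X) (g : Z ⟶ timesObj T Xs) :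
    timesLift T f g ≫ timesSnd T X Xs = g :=
  Limits.prod.lift_snd f g

lemma timesMap_fst {X Y : V} {Xs Ys : List V} (f : X ⟶ Y) (g : Xs ⟶ Ys) :
    timesMap T (seqCons f g) ≫ timesFst T Y Ys = timesFst T X Xs ≫ T.map f :=
  prod.map_fst _ _

lemma timesMap_snd {X Y : V} {Xs Ys : List V} (f : X ⟶ Y) (g : Xs ⟶ Ys) :
    timesMap T (seqCons f g) ≫ timesSnd T Y Ys = timesSnd T X Xs ≫ timesMap T g :=
  prod.map_snd _ _

lemma timesMap_id (Xs : List V) : timesMap T (𝟙 Xs) = 𝟙 _ := (timesFunctor T).map_id Xs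

lemma timesMap_comp {Xs Ys Zs : List V} (f : Xs ⟶ Ys) (g : Ys ⟶ Zs) :
    timesMap T (f ≫ g) = timesMap T f ≫ timesMap T g := (timesFunctor T).map_comp f g

lemma timesNil_ext {X : V} (f g : X ⟶ timesObj T []) : f = g :=
  terminalIsTerminal.hom_ext f g

lemma timesCons_ext {Z X : V} {Xs : List V} {f g : Z ⟶ timesObj T (X :: Xs)}
    (h₁ : f ≫ timesFst T X Xs = g ≫ timesFst T X Xs)
    (h₂ : f ≫ timesSnd T X Xs = g ≫ timesSnd T X Xs) : f = g :=
  Limits.prod.hom_ext h₁ h₂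

lemma timesLift_comp {Z Z' X : V} {Xs : List V} (h : Z' ⟶ Z) (f : Z ⟶ T.obj X)
    (g : Z ⟶ timesObj T Xs) : h ≫ timesLift T f g = timesLift T (h ≫ f) (h ≫ g) :=
  prod.comp_lift h f g

lemma timesLift_map {Z X Y : V} {Xs Ys : List V} (f : Z ⟶ T.obj X) (g : Z ⟶ timesObj T Xs)
    (h : X ⟶ Y) (k : Xs ⟶ Ys) :
    timesLift T f g ≫ timesMap T (seqCons h k) =
      timesLift T (f ≫ T.map h) (g ≫ timesMap T k) :=
  prod.lift_map f g _ _

/-- The map `Z ⟶ ∏ₖ T Zₖ` with components `f` and `g`. -/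
noncomputable def timesPair {Z : V} {Xs Ys : List V} (f : Z ⟶ timesObj T Xs)
    (g : Z ⟶ timesObj T Ys) : Z ⟶ timesObj T (Xs ++ Ys) :=
  prod.lift f g ≫ timesAppend T Xs Ys

lemma timesPair_nil {Z : V} {Ys : List V} (f : Z ⟶ timesObj T []) (g : Z ⟶ timesObj T Ys) :
    timesPair T f g = g :=
  Limits.prod.lift_snd f g

lemma timesPair_cons {Z X : V} {Xs Ys : List V} (f : Z ⟶ timesObj T (X :: Xs))
    (g : Z ⟶ timesObj T Ys) :
    timesPair T f g = timesLift T (f ≫ timesFst T X Xs) (timesPair T (f ≫ timesSnd T X Xs) g) := by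
  refine (prod.comp_lift _ _ _).trans (congrArg₂ (timesLift T) ?_ ?_)
  · rw [← Category.assoc, Limits.prod.lift_fst]
  · rw [timesPair, ← Category.assoc, prod.lift_map, Category.comp_id]

lemma timesPair_comp {Z Z' : V} {Xs Ys : List V} (h : Z' ⟶ Z) (f : Z ⟶ timesObj T Xs)
    (g : Z ⟶ timesObj T Ys) : h ≫ timesPair T f g = timesPair T (h ≫ f) (h ≫ g) := by
  rw [timesPair, timesPair, ← Category.assoc, prod.comp_lift]

lemma timesPair_map {Z : V} {Xs Ys Xs' Ys' : List V} (f : Z ⟶ timesObj T Xs)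
    (g : Z ⟶ timesObj T Xs') (h : Xs ⟶ Ys) (k : Xs' ⟶ Ys') :
    timesPair T f g ≫ timesMap T (seqAppend h k) =
      timesPair T (f ≫ timesMap T h) (g ≫ timesMap T k) := by
  induction h using seqHom_induction with
  | nil =>
    exact (congrArg (fun l => l ≫ timesMap T k) (timesPair_nil T f g)).trans
      (timesPair_nil T (f ≫ timesMap T (𝟙 [])) (g ≫ timesMap T k)).symm
  | @cons X Y Xs Ys h hs ih =>
    rw [timesPair_cons T f g, timesPair_cons T (f ≫ _)]
    refine (timesLift_map T _ _ h (seqAppend hs k)).trans (congrArg₂ (timesLift T) ?_ ?_)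
    · rw [Category.assoc, Category.assoc, timesMap_fst]
    · rw [ih, Category.assoc, Category.assoc, timesMap_snd]

lemma timesAct_fst (X : V) (Xs : List V) :
    timesAct T (X :: Xs) ≫ timesFst T X Xs = T.map (timesFst T X Xs) ≫ T.μ.app X :=
  timesLift_fst T _ _

lemma timesAct_snd (X : V) (Xs : List V) :
    timesAct T (X :: Xs) ≫ timesSnd T X Xs = T.map (timesSnd T X Xs) ≫ timesAct T Xs :=
  timesLift_snd T _ _

lemma timesAct_naturality {Xs Ys : List V} (f : Xs ⟶ Ys) :
    T.map (timesMap T f) ≫ timesAct T Ys = timesAct T Xs ≫ timesMap T f := by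
  induction f using seqHom_induction with
  | nil => exact timesNil_ext T _ _
  | @cons X Y Xs Ys f fs ih =>
    refine timesCons_ext T ?_ ?_
    · rw [Category.assoc, timesAct_fst, Category.assoc, timesMap_fst, ← Category.assoc,
        ← Category.assoc, ← T.map_comp, timesMap_fst, timesAct_fst, T.map_comp, Category.assoc,
        Category.assoc]
      exact congrArg (T.map (timesFst T X Xs) ≫ ·) (T.μ.naturality f)
    · rw [Category.assoc, timesAct_snd, Category.assoc, timesMap_snd, ← Category.assoc,
        ← Category.assoc, ← T.map_comp, timesMap_snd, timesAct_snd, T.map_comp, Category.assoc,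
        Category.assoc, ih]

lemma timesSubst_cons (L : List V) (Z : List (List V)) : timesSubst T (L :: Z) =
    timesPair T (timesFst T (timesObj T L) (Z.map (timesFunctor T).obj) ≫ timesAct T L)
      (timesSnd T (timesObj T L) (Z.map (timesFunctor T).obj) ≫ timesSubst T Z) := rfl

lemma timesSubst_naturality {Z Z' : List (List V)} (f : Z ⟶ Z') :
    timesMap T (seqMapMap (timesFunctor T) f) ≫ timesSubst T Z' =
      timesSubst T Z ≫ timesMap T (seqFlattenMap f) := by
  induction f using seqHom_induction with
  | nil => rfl
  | @cons X Y Xs Ys f fs ih =>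
    refine (timesPair_comp T _ _ _).trans (Eq.trans ?_ (timesPair_map T _ _ f _).symm)
    refine congrArg₂ (timesPair T) ?_ ?_
    · have h := timesMap_fst T (timesMap T f) (seqMapMap (timesFunctor T) fs)
      refine (Category.assoc _ _ _).symm.trans ((congrArg (· ≫ _) h).trans ?_)
      refine (Category.assoc _ _ _).trans (Eq.trans ?_ (Category.assoc _ _ _).symm)
      exact congrArg (_ ≫ ·) (timesAct_naturality T f)
    · have h := timesMap_snd T (timesMap T f) (seqMapMap (timesFunctor T) fs)
      refine (Category.assoc _ _ _).symm.trans ((congrArg (· ≫ _) h).trans ?_)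
      refine (Category.assoc _ _ _).trans (Eq.trans ?_ (Category.assoc _ _ _).symm)
      exact congrArg (_ ≫ ·) ih

lemma timesUnit_naturality {X Y : V} (f : X ⟶ Y) :
    f ≫ timesUnit T Y = timesUnit T X ≫ timesMap T (seqCons f (𝟙 [])) := by
  refine (timesLift_comp T _ _ _).trans (Eq.trans ?_ (timesLift_map T _ _ _ _).symm)
  exact congrArg₂ (timesLift T) (T.η.naturality f) (timesNil_ext T _ _)

lemma unit_timesAct (Xs : List V) : T.η.app (timesObj T Xs) ≫ timesAct T Xs = 𝟙 _ := by
  induction Xs with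
  | nil => exact timesNil_ext T _ _
  | cons X Xs ih =>
    have h1 := T.η.naturality (timesFst T X Xs)
    have h2 := T.η.naturality (timesSnd T X Xs)
    refine timesCons_ext T ?_ ?_
    · rw [Category.assoc, timesAct_fst, ← Category.assoc]
      refine (congrArg (· ≫ _) h1.symm).trans ?_
      rw [Category.id_comp]
      simp
    · rw [Category.assoc, timesAct_snd, ← Category.assoc]
      refine (congrArg (· ≫ _) h2.symm).trans ?_
      rw [Category.id_comp, Category.assoc]
      simp [ih]

lemma map_timesAct (Xs : List V) :
    T.map (timesAct T Xs) ≫ timesAct T Xs = T.μ.app (timesObj T Xs) ≫ timesAct T Xs := by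
  induction Xs with
  | nil => exact timesNil_ext T _ _
  | cons X Xs ih =>
    have h1 := T.μ.naturality (timesFst T X Xs)
    have h2 := T.μ.naturality (timesSnd T X Xs)
    refine timesCons_ext T ?_ ?_
    · rw [Category.assoc, Category.assoc, timesAct_fst, ← Category.assoc, ← Category.assoc,
        ← T.map_comp, timesAct_fst]
      refine Eq.trans ?_ (congrArg (· ≫ T.μ.app X) h1)
      simp [T.assoc]
    · rw [Category.assoc, Category.assoc, timesAct_snd, ← Category.assoc, ← Category.assoc,
        ← T.map_comp, timesAct_snd, T.map_comp, Category.assoc, ih]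
      refine Eq.trans ?_ (congrArg (· ≫ timesAct T Xs) h2)
      simp

/-- The maps `timesPair f g` are compatible with the actions of `T`. -/
lemma map_timesPair_timesAct {Z : V} {Xs Ys : List V} (f : Z ⟶ timesObj T Xs)
    (g : Z ⟶ timesObj T Ys) :
    T.map (timesPair T f g) ≫ timesAct T (Xs ++ Ys) =
      timesPair T (T.map f ≫ timesAct T Xs) (T.map g ≫ timesAct T Ys) := by
  induction Xs with
  | nil =>
    exact (congrArg (fun k => T.map k ≫ timesAct T Ys) (timesPair_nil T f g)).trans
      (timesPair_nil T _ _).symm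
  | cons X Xs ih =>
    rw [timesPair_cons T (T.map f ≫ _)]
    refine timesCons_ext T (X := X) (Xs := Xs ++ Ys) ?_ ?_
    · refine ((Category.assoc _ _ _).trans (congrArg (_ ≫ ·) (timesAct_fst T X (Xs ++ Ys)))).trans
        (Eq.trans ?_ (timesLift_fst T _ _).symm)
      rw [timesPair_cons, Category.assoc, timesAct_fst, ← Category.assoc, ← Category.assoc,
        ← T.map_comp]
      refine Eq.trans ?_ (congrArg (· ≫ T.μ.app X) (T.map_comp _ _))
      exact congrArg (fun k => T.map k ≫ T.μ.app X) (timesLift_fst T _ _)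
    · refine ((Category.assoc _ _ _).trans (congrArg (_ ≫ ·) (timesAct_snd T X (Xs ++ Ys)))).trans
        (Eq.trans ?_ (timesLift_snd T _ _).symm)
      rw [Category.assoc, timesAct_snd, ← Category.assoc, ← Category.assoc,
        ← T.map_comp, ← T.map_comp, ← ih]
      refine congrArg (fun k => T.map k ≫ timesAct T (Xs ++ Ys)) ?_
      rw [timesPair_cons]
      exact timesLift_snd T _ _

/-- The maps `timesPair f g` are associative. -/
lemma timesPair_assoc {Z : V} {Xs Ys Zs : List V} (f : Z ⟶ timesObj T Xs)
    (g : Z ⟶ timesObj T Ys) (h : Z ⟶ timesObj T Zs) :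
    HEq (timesPair T (timesPair T f g) h) (timesPair T f (timesPair T g h)) := by
  induction Xs with
  | nil =>
    exact heq_of_eq ((congrArg (fun l => timesPair T l h) (timesPair_nil T f g)).trans
      (timesPair_nil T f _).symm)
  | cons X Xs ih =>
    have key : ∀ {Ws Ws' : List V} (_ : Ws = Ws') {k k' : Z ⟶ T.obj X} {l : Z ⟶ timesObj T Ws}
        {l' : Z ⟶ timesObj T Ws'} (_ : k = k') (_ : HEq l l'),
        HEq (timesLift T k l) (timesLift T k' l') := by
      rintro _ _ rfl _ _ _ _ rfl h
      cases h
      rfl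
    have e := timesPair_cons T (Xs := Xs ++ Ys) (timesPair T f g) h
    rw [timesPair_cons T f (timesPair T g h)]
    refine HEq.trans (heq_of_eq e) (key (List.append_assoc _ _ _) ?_ ?_)
    · rw [timesPair_cons T f g]
      exact timesLift_fst T _ _
    · refine HEq.trans (heq_of_eq ?_) (ih (f ≫ timesSnd T X Xs))
      refine congrArg (fun l => timesPair T l h) ?_
      rw [timesPair_cons T f g]
      exact timesLift_snd T _ _

lemma timesPair_nil_right {Z : V} {Xs : List V} (f : Z ⟶ timesObj T Xs)
    (g : Z ⟶ timesObj T []) : HEq (timesPair T f g) f := by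
  induction Xs with
  | nil => exact heq_of_eq (timesNil_ext T _ _)
  | cons X Xs ih =>
    have key : ∀ {Ws : List V} (_ : Ws = Xs) {l : Z ⟶ timesObj T Ws}
        (_ : HEq l (f ≫ timesSnd T X Xs)), HEq (timesLift T (f ≫ timesFst T X Xs) l) f := by
      rintro _ rfl _ h
      cases h
      refine heq_of_eq (timesCons_ext T ?_ ?_)
      · rw [timesLift_fst]
      · rw [timesLift_snd]
    exact (heq_of_eq (timesPair_cons T f g)).trans (key (List.append_nil Xs) (ih _))

lemma timesPair_heq {Z Z' : V} {Xs Xs' Ys Ys' : List V} (hZ : Z = Z') (hX : Xs = Xs')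
    (hY : Ys = Ys') {f : Z ⟶ timesObj T Xs} {f' : Z' ⟶ timesObj T Xs'} {g : Z ⟶ timesObj T Ys}
    {g' : Z' ⟶ timesObj T Ys'} (hf : HEq f f') (hg : HEq g g') :
    HEq (timesPair T f g) (timesPair T f' g') := by
  subst hZ hX hY hf hg
  rfl

lemma timesSubst_heq {Z Z' : List (List V)} (h : Z = Z') :
    HEq (timesSubst T Z) (timesSubst T Z') := by
  subst h
  rfl

lemma timesFst_heq {Z X : V} {Ws Ws' : List V} (h : Ws = Ws') {f : Z ⟶ timesObj T (X :: Ws)}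
    {f' : Z ⟶ timesObj T (X :: Ws')} (hf : HEq f f') :
    f ≫ timesFst T X Ws = f' ≫ timesFst T X Ws' := by
  subst h hf
  rfl

lemma timesSnd_heq {Z X : V} {Ws Ws' : List V} (h : Ws = Ws') {f : Z ⟶ timesObj T (X :: Ws)}
    {f' : Z ⟶ timesObj T (X :: Ws')} (hf : HEq f f') :
    HEq (f ≫ timesSnd T X Ws) (f' ≫ timesSnd T X Ws') := by
  subst h hf
  rfl

lemma comp_timesSubst_cons {W : V} (L : List V) (Z : List (List V))
    (f : W ⟶ timesObj T ((L :: Z).map (timesFunctor T).obj)) :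
    f ≫ timesSubst T (L :: Z) =
      timesPair T ((f ≫ timesFst T (timesObj T L) (Z.map (timesFunctor T).obj)) ≫ timesAct T L)
        ((f ≫ timesSnd T (timesObj T L) (Z.map (timesFunctor T).obj)) ≫ timesSubst T Z) := by
  refine (timesPair_comp T f _ _).trans (congrArg₂ (timesPair T) ?_ ?_)
  · exact (Category.assoc _ _ _).symm
  · exact (Category.assoc _ _ _).symm

/-- Substitution on a concatenation, in terms of substitution on each part. -/
lemma timesPair_timesSubst {W : V} (L Z : List (List V))
    (f : W ⟶ timesObj T (L.map (timesFunctor T).obj))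
    (g : W ⟶ timesObj T (Z.map (timesFunctor T).obj))
    (k : W ⟶ timesObj T ((L ++ Z).map (timesFunctor T).obj)) (hk : HEq k (timesPair T f g)) :
    HEq (k ≫ timesSubst T (L ++ Z)) (timesPair T (f ≫ timesSubst T L) (g ≫ timesSubst T Z)) := by
  induction L with
  | nil =>
    have h1 : k = g := eq_of_heq (hk.trans (heq_of_eq (timesPair_nil T f g)))
    subst h1
    exact heq_of_eq (timesPair_nil T (f ≫ 𝟙 _) _).symm
  | cons X Xs ih =>
    have e : (Xs ++ Z).map (timesFunctor T).obj =
      Xs.map (timesFunctor T).obj ++ Z.map (timesFunctor T).obj := List.map_append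
    have hk' := hk.trans (heq_of_eq (timesPair_cons T (X := timesObj T X) f g))
    have h1 := (timesFst_heq T (X := timesObj T X) e hk').trans (timesLift_fst T _ _)
    have h2 := (timesSnd_heq T (X := timesObj T X) e hk').trans
      (heq_of_eq (timesLift_snd T _ _))
    have h3 := ih _ _ h2
    refine (heq_of_eq (comp_timesSubst_cons T X (Xs ++ Z) k)).trans ?_
    refine (timesPair_heq T rfl rfl List.flatten_append (heq_of_eq (congrArg (· ≫ timesAct T X) h1))
      h3).trans ?_
    refine (timesPair_assoc T _ _ _).symm.trans (heq_of_eq ?_)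
    exact congrArg (fun l => timesPair T l (g ≫ timesSubst T Z)) (comp_timesSubst_cons T X Xs f).symm

lemma map_timesSubst_timesAct (L : List (List V)) :
    T.map (timesSubst T L) ≫ timesAct T L.flatten =
      timesAct T (L.map (timesFunctor T).obj) ≫ timesSubst T L := by
  induction L with
  | nil => exact timesNil_ext T _ _
  | cons X Xs ih =>
    refine Eq.trans ?_ (comp_timesSubst_cons T X Xs _).symm
    refine (map_timesPair_timesAct T _ _).trans ?_
    have h1 := timesAct_fst T (timesObj T X) (Xs.map (timesFunctor T).obj)
    have h2 := timesAct_snd T (timesObj T X) (Xs.map (timesFunctor T).obj)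
    refine congrArg₂ (timesPair T) ?_ ?_
    · refine Eq.trans ?_ (congrArg (· ≫ timesAct T X) h1.symm)
      refine (congrArg (· ≫ timesAct T X) (T.map_comp _ _)).trans ((Category.assoc _ _ _).trans ?_)
      exact (congrArg (_ ≫ ·) (map_timesAct T X)).trans (Category.assoc _ _ _).symm
    · refine Eq.trans ?_ (congrArg (· ≫ timesSubst T Xs) h2.symm)
      refine (congrArg (· ≫ timesAct T Xs.flatten) (T.map_comp _ _)).trans
        ((Category.assoc _ _ _).trans ?_)
      exact (congrArg (_ ≫ ·) ih).trans (Category.assoc _ _ _).symm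

lemma timesSubst_assoc {W : V} (Z : List (List (List V)))
    (x : W ⟶ timesObj T ((Z.map fun L => L.map (timesFunctor T).obj).map (timesFunctor T).obj))
    (y : W ⟶ timesObj T (Z.flatten.map (timesFunctor T).obj))
    (hy : HEq y (x ≫ timesSubst T (Z.map fun L => L.map (timesFunctor T).obj)))
    (x' : W ⟶ timesObj T (Z.map fun L => timesObj T (L.map (timesFunctor T).obj)))
    (hx : HEq x' x) (z : W ⟶ timesObj T ((Z.map List.flatten).map (timesFunctor T).obj))
    (hz : HEq z (x' ≫ timesMap T (seqHomOfList
      (f := fun L : List (List V) => timesObj T (L.map (timesFunctor T).obj))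
      (g := fun L => timesObj T L.flatten) (timesSubst T) Z))) :
    HEq (y ≫ timesSubst T Z.flatten) (z ≫ timesSubst T (Z.map List.flatten)) := by
  induction Z with
  | nil =>
    have h : y = z := timesNil_ext T _ _
    rw [h]
    rfl
  | cons L Z ih =>
    have e1 : (Z.map fun L => L.map (timesFunctor T).obj).flatten =
        Z.flatten.map (timesFunctor T).obj := by
      simp
    have e2 : (Z.map fun L => timesObj T (L.map (timesFunctor T).obj)) =
        (Z.map fun L => L.map (timesFunctor T).obj).map (timesFunctor T).obj := by
      simp [timesFunctor]
    have e3 : (Z.map List.flatten).map (timesFunctor T).obj =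
        Z.map fun L => timesObj T L.flatten := by
      simp [timesFunctor]
    have hy' := hy.trans (heq_of_eq (comp_timesSubst_cons T _ _ x))
    obtain ⟨y', hy'₂⟩ : ∃ y' : W ⟶ timesObj T (Z.flatten.map (timesFunctor T).obj),
        HEq y' ((x ≫ timesSnd T (timesObj T (L.map (timesFunctor T).obj)) _) ≫
          timesSubst T (Z.map fun L => L.map (timesFunctor T).obj)) := by
      rw [← e1]
      exact ⟨_, HEq.rfl⟩
    have h1 := timesPair_timesSubst T L Z.flatten _ y' y
      (hy'.trans (timesPair_heq T rfl rfl e1 HEq.rfl hy'₂.symm))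
    have hx1 := timesFst_heq T (X := timesObj T (L.map (timesFunctor T).obj)) e2 hx
    have hx2 := timesSnd_heq T (X := timesObj T (L.map (timesFunctor T).obj)) e2 hx
    have hz1 := timesFst_heq T (X := timesObj T L.flatten) e3 hz
    have hz2 := timesSnd_heq T (X := timesObj T L.flatten) e3 hz
    have hz3 := hz1.trans ((Category.assoc _ _ _).trans ((congrArg (x' ≫ ·)
      (timesMap_fst T _ _)).trans (Category.assoc _ _ _).symm))
    have hz4 := hz2.trans (heq_of_eq ((Category.assoc _ _ _).trans ((congrArg (x' ≫ ·)
      (timesMap_snd T _ _)).trans (Category.assoc _ _ _).symm)))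
    have h2 := ih _ y' hy'₂ _ hx2 _ hz4
    refine h1.trans (HEq.trans ?_ (heq_of_eq (comp_timesSubst_cons T _ _ z).symm))
    refine timesPair_heq T rfl rfl (flatten_map_flatten Z).symm (heq_of_eq ?_) h2
    refine Eq.trans ?_ (congrArg (· ≫ timesAct T L.flatten) hz3).symm
    rw [Category.assoc, Category.assoc, map_timesSubst_timesAct]
    exact congrArg (· ≫ (timesAct T (L.map (timesFunctor T).obj) ≫ timesSubst T L)) hx1.symm

lemma timesUnit_timesAct (X : V) :
    T.map (timesUnit T X) ≫ timesAct T [X] ≫ timesFst T X [] = 𝟙 _ := by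
  rw [timesAct_fst, ← Category.assoc, ← T.map_comp]
  exact (congrArg (fun k => T.map k ≫ T.μ.app X) (timesLift_fst T _ _)).trans (T.right_unit X)

lemma timesUnit_timesSubst {W : V} (Z : List V) (x : W ⟶ timesObj T Z)
    (x' : W ⟶ timesObj T (Z.map fun X => X)) (hx : HEq x' x)
    (z : W ⟶ timesObj T ((Z.map fun X => [X]).map (timesFunctor T).obj))
    (hz : HEq z (x' ≫ timesMap T (seqHomOfList (f := fun X => X) (g := fun X => timesObj T [X])
      (timesUnit T) Z))) :
    HEq (z ≫ timesSubst T (Z.map fun X => [X])) x := by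
  induction Z with
  | nil => exact heq_of_eq (timesNil_ext T _ _)
  | cons X Z ih =>
    have e1 : ((Z.map fun X => [X]).map (timesFunctor T).obj) =
        Z.map fun X => timesObj T [X] := by
      simp [timesFunctor]
    have hx1 := timesFst_heq T (X := X) (List.map_id' Z) hx
    have hx2 := timesSnd_heq T (X := X) (List.map_id' Z) hx
    have hz1 := timesFst_heq T (X := timesObj T [X]) e1 hz
    have hz2 := timesSnd_heq T (X := timesObj T [X]) e1 hz
    have hz3 := hz1.trans ((Category.assoc _ _ _).trans ((congrArg (x' ≫ ·)
      (timesMap_fst T _ _)).trans (Category.assoc _ _ _).symm))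
    have hz4 := hz2.trans (heq_of_eq ((Category.assoc _ _ _).trans ((congrArg (x' ≫ ·)
      (timesMap_snd T _ _)).trans (Category.assoc _ _ _).symm)))
    have h2 := ih _ _ hx2 _ hz4
    refine (heq_of_eq ((comp_timesSubst_cons T [X] _ z).trans (timesPair_cons T _ _))).trans ?_
    have key : ∀ {Ws : List V} (_ : Ws = Z) {k : W ⟶ T.obj X} {l : W ⟶ timesObj T Ws}
        (_ : k = x ≫ timesFst T X Z) (_ : HEq l (x ≫ timesSnd T X Z)),
        HEq (timesLift T k l) x := by
      rintro _ rfl _ _ rfl h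
      cases h
      refine heq_of_eq (timesCons_ext T ?_ ?_)
      · rw [timesLift_fst]
      · rw [timesLift_snd]
    refine key (flatten_map_singleton Z) ?_ ?_
    · refine Eq.trans ?_ hx1
      refine (Category.assoc _ _ _).trans ((congrArg (· ≫ timesAct T [X] ≫ timesFst T X []) hz3).trans
        ?_)
      refine (Category.assoc _ _ _).trans ?_
      exact (congrArg (_ ≫ ·) (timesUnit_timesAct T X)).trans (Category.comp_id _)
    · exact (heq_of_eq (timesPair_nil T _ _)).trans h2

/-- The multitensor `T^×` with `T^× (X₁, …, Xₙ) = ∏ T Xᵢ`, for a monad `T` on a category with finite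
products. -/
noncomputable def timesMultitensor : Multitensor V where
  tensor := timesFunctor T
  unit := timesUnit T
  unit_naturality := timesUnit_naturality T
  subst := timesSubst T
  subst_naturality := timesSubst_naturality T
  unit_subst Z := by
    have h1 : timesUnit T (timesObj T Z) ≫ timesSubst T [Z] = timesPair T (𝟙 _)
        (terminal.from _ : timesObj T Z ⟶ timesObj T []) := by
      refine (comp_timesSubst_cons T Z [] _).trans (congrArg₂ (timesPair T) ?_ ?_)
      · exact (congrArg (· ≫ timesAct T Z) (timesLift_fst T _ _)).trans (unit_timesAct T Z)
      · exact timesNil_ext T _ _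
    have h2 := (congrArg (· ≫ timesMap T (eqToHom (by simp : [Z].flatten = Z))) h1)
    refine (Category.assoc _ _ _).symm.trans (h2.trans (eq_of_heq ?_))
    exact (heq_map_eqToHom (timesFunctor T) _ _).trans (timesPair_nil_right T _ _)
  map_unit_subst Z := by
    refine eq_of_heq ?_
    refine (heq_of_eq (Category.assoc _ _ _).symm).trans
      ((heq_map_eqToHom (timesFunctor T) _ _).trans ?_)
    have hx := heq_map_eqToHom (timesFunctor T) (List.map_id' Z).symm (𝟙 (timesObj T Z))
    refine timesUnit_timesSubst T Z (𝟙 _) _ hx _ ?_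
    refine HEq.trans ?_ (heq_map_eqToHom (timesFunctor T) (Z := (Z.map fun X => [X]).map
      (timesFunctor T).obj) (by simp [timesFunctor]) _)
    refine heq_of_eq ?_
    refine ((timesFunctor T).map_comp _ _).trans ?_
    refine (congrArg (_ ≫ ·) ((timesFunctor T).map_comp _ _)).trans ?_
    refine (Category.assoc _ _ _).symm.trans ?_
    exact congrArg (fun k => (k ≫ timesMap T (seqHomOfList (f := fun X => X)
      (g := fun X => timesObj T [X]) (timesUnit T) Z)) ≫ _) (Category.id_comp _).symm
  assoc Z := by
    have e : (Z.map fun L => timesObj T (L.map (timesFunctor T).obj)) =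
        (Z.map fun L => L.map (timesFunctor T).obj).map (timesFunctor T).obj := by
      simp [timesFunctor]
    have e' : (Z.map fun L => timesObj T L.flatten) =
        (Z.map List.flatten).map (timesFunctor T).obj := by
      simp [timesFunctor]
    have e₂ : (Z.map fun L => L.map (timesFunctor T).obj).flatten =
        Z.flatten.map (timesFunctor T).obj := by
      simp
    have hx : HEq (timesMap T (eqToHom e)) (𝟙 _) :=
      (heq_of_eq (Category.id_comp _).symm).trans (heq_map_eqToHom (timesFunctor T) e (𝟙 _))
    have hz : HEq (timesMap T (seqHomOfList
        (f := fun L : List (List V) => timesObj T (L.map (timesFunctor T).obj))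
        (g := fun L => timesObj T L.flatten) (timesSubst T) Z ≫ eqToHom e'))
        (𝟙 _ ≫ timesMap T (seqHomOfList
          (f := fun L : List (List V) => timesObj T (L.map (timesFunctor T).obj))
          (g := fun L => timesObj T L.flatten) (timesSubst T) Z)) :=
      (heq_of_eq (timesMap_comp T _ _)).trans ((heq_map_eqToHom (timesFunctor T) e' _).trans
        (heq_of_eq (Category.id_comp _).symm))
    have h := timesSubst_assoc T Z (timesMap T (eqToHom e)) _
      (heq_map_eqToHom (timesFunctor T) e₂ _) (𝟙 _) hx.symm _ hz
    refine eq_of_heq (HEq.trans ?_ (h.trans ?_))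
    · refine heq_of_eq ?_
      exact (Category.assoc _ _ _).symm.trans (Category.assoc _ _ _).symm
    · refine HEq.trans ?_ (heq_of_eq (Category.assoc _ _ _))
      exact (heq_map_eqToHom (timesFunctor T) (flatten_map_flatten Z) _).symm

end ProductMultitensor

/-! ### Coproducts and finite products of enriched graphs -/

section GraphLimits

variable {V : Type u} [Category.{w} V]

section Coproducts

variable [HasCoproducts.{w} V]

/-- The coproduct of `V`-graphs: the set of objects is the disjoint union, the hom between two
objects of the same summand is that of the summand (a coproduct over a singleton), and the hom
between objects of different summands is initial (a coproduct over the empty set). -/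
noncomputable def EGraph.sigma {I : Type w} (X : I → EGraph V) : EGraph V where
  obj := Σ i, (X i).obj
  hom a b := ∐ fun h : ULift.{w} (PLift (a.1 = b.1)) =>
    (X b.1).hom (cast (congrArg (fun i => (X i).obj) h.down.down) a.2) b.2

noncomputable def EGraph.sigmaι {I : Type w} (X : I → EGraph V) (i : I) :
    X i ⟶ EGraph.sigma X where
  obj a := ⟨i, a⟩
  hom a b := Sigma.ι (fun h : ULift.{w} (PLift (i = i)) =>
    (X i).hom (cast (congrArg (fun i => (X i).obj) h.down.down) a) b) ⟨⟨rfl⟩⟩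

def EGraph.sigmaDescAux {I : Type w} {X : I → EGraph V} {Y : EGraph V} (f : ∀ i, X i ⟶ Y)
    {i j : I} (h : i = j) (a : (X i).obj) (b : (X j).obj) :
    (X j).hom (cast (congrArg (fun i => (X i).obj) h) a) b ⟶ Y.hom ((f i).obj a) ((f j).obj b) :=
  match j, h, b with
  | _, rfl, b => (f i).hom a b

noncomputable def EGraph.sigmaDesc {I : Type w} {X : I → EGraph V} {Y : EGraph V}
    (f : ∀ i, X i ⟶ Y) : EGraph.sigma X ⟶ Y where
  obj a := (f a.1).obj a.2
  hom a b := Limits.Sigma.desc fun h => EGraph.sigmaDescAux f h.down.down a.2 b.2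

lemma EGraph.sigmaι_desc {I : Type w} {X : I → EGraph V} {Y : EGraph V} (f : ∀ i, X i ⟶ Y)
    (i : I) : EGraph.sigmaι X i ≫ EGraph.sigmaDesc f = f i := by
  refine congrArg (EGraphHom.mk _) (funext fun a => funext fun b => ?_)
  exact Limits.Sigma.ι_desc (fun h : ULift.{w} (PLift (i = i)) =>
    EGraph.sigmaDescAux f h.down.down a b) ⟨⟨rfl⟩⟩

lemma EGraph.sigma_hom_ext {I : Type w} {X : I → EGraph V} {Y : EGraph V}
    {f g : EGraph.sigma X ⟶ Y} (h : ∀ i, EGraph.sigmaι X i ≫ f = EGraph.sigmaι X i ≫ g) :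
    f = g := by
  have h0 : ∀ a, f.obj a = g.obj a := fun a =>
    congrFun (congrArg EGraphHom.obj (h a.1)) a.2
  refine EGraphHom.ext_of_hom h0 ?_
  rintro ⟨i, a⟩ ⟨j, b⟩
  refine Limits.Sigma.hom_ext _ _ ?_
  rintro ⟨⟨hij⟩⟩
  cases hij
  have key : ∀ {k l : X i ⟶ Y} (hkl : k = l),
      k.hom a b ≫ eqToHom (by rw [hkl]) = l.hom a b := by
    rintro k _ rfl
    simp
  have h1 := key (h i)
  refine (Category.assoc _ _ _).symm.trans ?_
  exact h1

instance : HasCoproducts.{w} (EGraph V) :=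
  hasCoproducts_of_colimit_cofans (fun X => Cofan.mk (EGraph.sigma X) (EGraph.sigmaι X))
    fun _ => Cofan.IsColimit.mk _ (fun t => EGraph.sigmaDesc t.inj)
      (fun t i => EGraph.sigmaι_desc t.inj i)
      (fun t _ hm => EGraph.sigma_hom_ext fun i =>
        (hm i).trans (EGraph.sigmaι_desc t.inj i).symm)

end Coproducts

section Products

variable [HasFiniteProducts V]

/-- The terminal `V`-graph has one object, with terminal hom. -/
noncomputable def EGraph.top (V : Type u) [Category.{w} V] [HasFiniteProducts V] : EGraph V :=
  ⟨PUnit, fun _ _ => ⊤_ V⟩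

/-- The product of `V`-graphs has pairs of objects as objects, and products of homs as homs. -/
noncomputable def EGraph.prod (X Y : EGraph V) : EGraph V :=
  ⟨X.obj × Y.obj, fun a b => X.hom a.1 b.1 ⨯ Y.hom a.2 b.2⟩

lemma EGraph.hasTerminal : HasTerminal (EGraph V) := by
  refine (IsTerminal.ofUniqueHom (Y := EGraph.top V)
    (fun X => EGraphHom.mk (fun _ => PUnit.unit) fun _ _ => terminal.from _) fun X m => ?_).hasTerminal
  refine EGraphHom.ext_of_hom (fun a => rfl) fun a b => ?_
  exact terminalIsTerminal.hom_ext _ _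

noncomputable def EGraph.prodFst (X Y : EGraph V) : EGraph.prod X Y ⟶ X :=
  ⟨fun a => a.1, fun _ _ => prod.fst⟩

noncomputable def EGraph.prodSnd (X Y : EGraph V) : EGraph.prod X Y ⟶ Y :=
  ⟨fun a => a.2, fun _ _ => prod.snd⟩

noncomputable def EGraph.prodLift {X Y Z : EGraph V} (f : Z ⟶ X) (g : Z ⟶ Y) :
    Z ⟶ EGraph.prod X Y :=
  ⟨fun a => (f.obj a, g.obj a), fun a b => prod.lift (f.hom a b) (g.hom a b)⟩

lemma EGraph.hasBinaryProducts : HasBinaryProducts (EGraph V) := by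
  have : ∀ {X Y : EGraph V}, HasLimit (pair X Y) := fun {X Y} =>
    ⟨⟨⟨_, BinaryFan.isLimitMk (fst := EGraph.prodFst X Y) (snd := EGraph.prodSnd X Y)
      (fun s => EGraph.prodLift s.fst s.snd)
      (fun s => congrArg (EGraphHom.mk _) (funext fun a => funext fun b => prod.lift_fst _ _))
      (fun s => congrArg (EGraphHom.mk _) (funext fun a => funext fun b => prod.lift_snd _ _))
      (fun s m h₁ h₂ => by
        rw [← h₁, ← h₂]
        refine congrArg (EGraphHom.mk _) (funext fun a => funext fun b => ?_)
        refine Limits.prod.hom_ext ?_ ?_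
        · exact (Limits.prod.lift_fst _ _).symm
        · exact (Limits.prod.lift_snd _ _).symm)⟩⟩⟩
  exact hasBinaryProducts_of_hasLimit_pair _

instance : HasFiniteProducts (EGraph V) :=
  have := EGraph.hasTerminal (V := V)
  have := EGraph.hasBinaryProducts (V := V)
  hasFiniteProducts_of_has_binary_and_terminal

end Products

end GraphLimits

/-! ### The strict `n`-category monads -/

section StrictNCategories

/-- A category with small coproducts and finite products, with a monad on it. -/
structure CategoryWithMonad : Type (w + 2) where
  carrier : Type (w + 1)
  [category : Category.{w} carrier]
  [hasCoproducts : HasCoproducts.{w} carrier]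
  [hasFiniteProducts : HasFiniteProducts carrier]
  monad : CategoryTheory.Monad carrier

attribute [instance] CategoryWithMonad.category CategoryWithMonad.hasCoproducts
  CategoryWithMonad.hasFiniteProducts

/-- The category `𝒢ⁿSet` of `n`-globular sets with the strict `n`-category monad `T_{≤n}`, where
`T_{≤0}` is the identity monad on `Set` and `T_{≤n+1} = Γ (T_{≤n}^×)`. (The monad `Γ E` is only
defined for distributive `E`. The multitensors `T_{≤n}^×` are all distributive, and so the default
value below is not used.) -/
noncomputable def strictNCat : ℕ → CategoryWithMonad.{w}
  | 0 => { carrier := Type w, monad := Monad.id (Type w) }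
  | n + 1 =>
    { carrier := EGraph (strictNCat n).carrier
      monad :=
        open Classical in
        if h : (timesMultitensor (strictNCat n).monad).IsDistributive then
          (gamma (timesMultitensor (strictNCat n).monad) h).toMonad
        else Monad.id _ }

end StrictNCategories

end MultitensorOperad

open MultitensorOperad

/-! A path over a list `Z₁, …, Zₙ` in a graph `X` is a sequence of objects `a = x₀, …, xₙ = b` with
maps `Zᵢ ⟶ X (xᵢ₋₁, xᵢ)`; it induces `gammaPath E p : E (Z₁, …, Zₙ) ⟶ Γ E X (a, b)`. These maps
control everything. Identity paths give the coproduct injections, so the maps are jointly epic.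
Every list also has a path, in some graph, for which `gammaPath E p` is a coproduct injection up to
isomorphism, and injections are monic in an extensive category (`exists_mono_gammaPath`). The unit
of `Γ E` corresponds to paths of length one and its multiplication to the concatenation of paths of
paths (`gammaPath_unit`, `gammaPath_flatten`).

Cartesianness: in a lextensive category a square of coproducts is a pullback once the square of
index sets and the squares of summands are (`IsExtensive.isPullback_coprod`). For `Γ E` the index
sets are sequences of objects, and their squares are pullbacks for the same reason that the list
monad on sets is cartesian; the squares of summands are pullbacks because `E` is cartesian. So `Γ E`
is cartesian. If `α : A ⟶ E` is cartesian, then `A` is distributive, since coproducts are stable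
under pullback, and `Γ α` is cartesian.

Equivalence: for cartesian `α : A ⟶ E` and any path `p` over `Z`, the square formed by `gammaPath A
p`, `gammaPath E p`, `α` at `Z` and `Γ α` is a pullback. With the unique path over `Z` in the
terminal graph `1`, this exhibits `A Z` as the pullback of `Γ A 1` along `E Z ⟶ Γ E 1`. Hence a map
of operads induces a map of multitensors (`exists_multitensorHom`). For an arbitrary operad `P` the
same formula, with `P 1` for `Γ A 1`, defines a functor `opObj`. Cancellation of pullback squares
shows that `opObj Z` is also the pullback of `P X (a, b)` along every path over `Z` in every `X`.
The resulting maps `opPath` characterise the unit and substitution of a multitensor on `opObj`, and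
its laws reduce to the monad laws of `P`. Pulling the decomposition of `Γ E X (a, b)` back along `P
⟶ Γ E` then gives one of `P X (a, b)` with summands `opObj`, so that `P` is isomorphic to `Γ` of
this multitensor (`isIso_opApp`).

Part (2) is an induction whose hypothesis is that the category is lextensive and that the monad is
cartesian and preserves coproducts. Enriched graphs inherit lextensivity. The multitensor `T^×`
inherits cartesianness from `T`; it is distributive because a product is a pullback of any of its
factors along a projection, and coproducts are stable under pullback. Finally `Γ E` preserves
coproducts: a sequence of objects which changes summand in a disjoint union of graphs meets an
initial hom, and a distributive `E` then takes an initial value. -/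

namespace MultitensorOperad

/-! ### Coproducts in extensive categories -/

section Coprod

variable {V : Type u} [Category.{v} V]

/-- The maps `x i : X i ⟶ P` exhibit `P` as a coproduct of the `X i`. -/
structure IsCoprod {I : Type u₂} (X : I → V) (P : V) (x : ∀ i, X i ⟶ P) : Prop where
  existsUnique : ∀ {Z : V} (t : ∀ i, X i ⟶ Z), ∃! φ : P ⟶ Z, ∀ i, x i ≫ φ = t i

namespace IsCoprod

variable {I : Type u₂} {X : I → V} {P : V} {x : ∀ i, X i ⟶ P}

lemma of_isColimit (h : IsColimit (Cofan.mk P x)) : IsCoprod X P x :=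
  ⟨fun t => ⟨Cofan.IsColimit.desc h t, fun i => Cofan.IsColimit.fac h t i,
    fun _ hm => Cofan.IsColimit.hom_ext h _ _ fun i =>
      (hm i).trans (Cofan.IsColimit.fac h t i).symm⟩⟩

lemma exists_desc (h : IsCoprod X P x) {Z : V} (t : ∀ i, X i ⟶ Z) :
    ∃ φ : P ⟶ Z, ∀ i, x i ≫ φ = t i :=
  (h.existsUnique t).exists

lemma hom_ext (h : IsCoprod X P x) {Z : V} {φ ψ : P ⟶ Z} (e : ∀ i, x i ≫ φ = x i ≫ ψ) : φ = ψ :=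
  (h.existsUnique fun i => x i ≫ ψ).unique e fun _ => rfl

lemma nonempty_isColimit (h : IsCoprod X P x) : Nonempty (IsColimit (Cofan.mk P x)) := by
  choose d hd using fun (t : Cofan X) => h.exists_desc t.inj
  exact ⟨Cofan.IsColimit.mk _ d hd fun t m hm => h.hom_ext fun i => (hm i).trans (hd t i).symm⟩

lemma isIso (h : IsCoprod X P x) {P' : V} {x' : ∀ i, X i ⟶ P'} (h' : IsCoprod X P' x')
    {f : P ⟶ P'} (e : ∀ i, x i ≫ f = x' i) : IsIso f := by
  obtain ⟨g, hg⟩ := h'.exists_desc x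
  refine ⟨g, h.hom_ext fun i => ?_, h'.hom_ext fun i => ?_⟩
  · rw [← Category.assoc, e, hg, Category.comp_id]
  · rw [← Category.assoc, hg, e, Category.comp_id]

lemma comp_iso (h : IsCoprod X P x) {P' : V} (f : P ⟶ P') [IsIso f] :
    IsCoprod X P' fun i => x i ≫ f := by
  refine ⟨fun t => ?_⟩
  obtain ⟨φ, hφ⟩ := h.exists_desc t
  refine ⟨inv f ≫ φ, fun i => by simp [hφ], fun m hm => ?_⟩
  rw [IsIso.eq_inv_comp]
  exact h.hom_ext fun i => by rw [hφ, ← hm, Category.assoc]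

lemma iso_comp (h : IsCoprod X P x) {X' : I → V} (e : ∀ i, X' i ⟶ X i) [∀ i, IsIso (e i)] :
    IsCoprod X' P fun i => e i ≫ x i := by
  refine ⟨fun t => ?_⟩
  obtain ⟨φ, hφ⟩ := h.exists_desc fun i => inv (e i) ≫ t i
  refine ⟨φ, fun i => by simp [hφ], fun m hm => h.hom_ext fun i => ?_⟩
  rw [hφ, ← hm, Category.assoc, IsIso.inv_hom_id_assoc]

/-- A coproduct decomposition remains one when initial summands are left out. -/
lemma restrict {I' : Type*} (h : IsCoprod X P x) (f : I' → I) (hf : Function.Injective f)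
    (h0 : ∀ i, (∀ j, f j ≠ i) → Nonempty (IsInitial (X i))) :
    IsCoprod (fun i => X (f i)) P fun i => x (f i) := by
  refine ⟨fun {Z} t => ?_⟩
  -- The component at `i` is prescribed when `i` is in the image of `f` and is the map out of an
  -- initial object otherwise; `eqToHom` is needed because `f j = i` is not definitional.
  have key : ∀ i, ∃ s : X i ⟶ Z, ∀ (j : I') (hj : f j = i), s = eqToHom (congrArg X hj.symm) ≫ t j := by
    intro i
    by_cases hi : ∃ j, f j = i
    · obtain ⟨j, rfl⟩ := hi
      refine ⟨t j, fun j' hj' => ?_⟩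
      obtain rfl := hf hj'
      simp
    · have hi' : ∀ j, f j ≠ i := fun j hj => hi ⟨j, hj⟩
      exact ⟨(h0 i hi').some.to Z, fun j hj => (hi' j hj).elim⟩
  choose s hs using key
  obtain ⟨φ, hφ⟩ := h.exists_desc s
  refine ⟨φ, fun i => ?_, fun m hm => h.hom_ext fun i => ?_⟩
  · rw [hφ, hs (f i) i rfl]
    simp
  · by_cases hi : ∃ j, f j = i
    · obtain ⟨j, rfl⟩ := hi
      rw [hm, hφ, hs (f j) j rfl]
      simp
    · have hi' : ∀ j, f j ≠ i := fun j hj => hi ⟨j, hj⟩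
      exact (h0 i hi').some.hom_ext _ _

lemma trans {J : I → Type*} (h : IsCoprod X P x) {Y : ∀ i, J i → V} {y : ∀ i j, Y i j ⟶ X i}
    (hy : ∀ i, IsCoprod (Y i) (X i) (y i)) :
    IsCoprod (fun k : Σ i, J i => Y k.1 k.2) P fun k => y k.1 k.2 ≫ x k.1 := by
  refine ⟨fun t => ?_⟩
  choose s hs using fun i => (hy i).exists_desc fun j => t ⟨i, j⟩
  obtain ⟨φ, hφ⟩ := h.exists_desc s
  refine ⟨φ, fun k => ?_, fun m hm => h.hom_ext fun i => (hy i).hom_ext fun j => ?_⟩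
  · rw [Category.assoc, hφ, hs]
  · rw [hφ, hs, ← hm ⟨i, j⟩, Category.assoc]

lemma isInitial [IsEmpty I] (h : IsCoprod X P x) : Nonempty (IsInitial P) :=
  ⟨IsInitial.ofUniqueHom (fun _ => (h.exists_desc fun i => isEmptyElim i).choose)
    fun _ _ => h.hom_ext fun i => isEmptyElim i⟩

end IsCoprod

lemma isCoprod_sigma {I : Type u₂} (X : I → V) [HasCoproduct X] :
    IsCoprod X (∐ X) (Sigma.ι X) :=
  .of_isColimit (coproductIsCoproduct X)

lemma isCoprod_id (X : V) : IsCoprod (fun _ : PUnit.{u₂ + 1} => X) X fun _ => 𝟙 X :=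
  ⟨fun t => ⟨t ⟨⟩, fun _ => Category.id_comp _, fun m hm => by rw [← hm ⟨⟩, Category.id_comp]⟩⟩

/-- Coproducts are unique up to isomorphism, so one cocone per family suffices; each application may
choose the most convenient model. -/
lemma preservesColimitsOfShape_discrete {W : Type*} [Category W] {I : Type u₂} (F : V ⥤ W)
    (h : ∀ X : I → V, ∃ (P : V) (x : ∀ i, X i ⟶ P), IsCoprod X P x ∧
      IsCoprod (fun i => F.obj (X i)) (F.obj P) fun i => F.map (x i)) :
    PreservesColimitsOfShape (Discrete I) F := by
  have : ∀ X : I → V, PreservesColimit (Discrete.functor X) F := fun X => by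
    obtain ⟨P, x, h₁, h₂⟩ := h X
    refine preservesColimit_of_preserves_colimit_cocone h₁.nonempty_isColimit.some ?_
    exact (Cofan.isColimitMapCoconeEquiv F X (Cofan.mk P x)).symm h₂.nonempty_isColimit.some
  exact preservesColimitsOfShape_of_discrete F

lemma IsCoprod.map {W : Type*} [Category W] {I : Type u₂} (F : V ⥤ W)
    [PreservesColimitsOfShape (Discrete I) F] {X : I → V} {P : V} {x : ∀ i, X i ⟶ P}
    (h : IsCoprod X P x) : IsCoprod (fun i => F.obj (X i)) (F.obj P) fun i => F.map (x i) :=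
  .of_isColimit (isColimitCofanMkObjOfIsColimit F X _ h.nonempty_isColimit.some)

end Coprod

/-! ### Stability, disjointness and pullbacks of coproducts in extensive categories. -/

section Extensive

variable {V : Type u} [Category.{w} V]

/-- A copy of `T` at the index `i`, and initial objects elsewhere. -/
noncomputable def singleAt [HasCoproducts.{w} V] {I : Type w} (i : I) (T : V) (j : I) : V :=
  ∐ fun _ : ULift.{w} (PLift (i = j)) => T

section SingleAt

variable [HasCoproducts.{w} V] {I : Type w} (i : I) (T : V)

lemma isCoprod_singleAt (j : I) :
    IsCoprod (fun _ : ULift.{w} (PLift (i = j)) => T) (singleAt i T j) (Sigma.ι _) :=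
  isCoprod_sigma _

noncomputable def singleAtι : T ⟶ singleAt i T i :=
  Sigma.ι (fun _ : ULift.{w} (PLift (i = i)) => T) ⟨⟨rfl⟩⟩

noncomputable def singleAtTo (j : I) : singleAt i T j ⟶ T :=
  Limits.Sigma.desc fun _ => 𝟙 T

lemma singleAtι_to : singleAtι i T ≫ singleAtTo i T i = 𝟙 T :=
  Sigma.ι_desc _ _

lemma singleAt_hom_ext {Z : V} {f g : singleAt i T i ⟶ Z}
    (h : singleAtι i T ≫ f = singleAtι i T ≫ g) : f = g :=
  (isCoprod_singleAt i T i).hom_ext fun _ => h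

/-- Turns a map into a single member `X i` into a map of whole families, the only kind of map to
which the functor `coprodOver` applies. -/
lemma exists_singleAt_desc {X : I → V} (t : T ⟶ X i) :
    ∃ f : ∀ j, singleAt i T j ⟶ X j, singleAtι i T ≫ f i = t := by
  refine ⟨fun j => Limits.Sigma.desc fun h => t ≫ eqToHom (by rw [h.down.down]), ?_⟩
  refine (Sigma.ι_desc _ _).trans ?_
  simp

lemma singleAt_isInitial {j : I} (h : i ≠ j) : Nonempty (IsInitial (singleAt i T j)) :=
  have : IsEmpty (ULift.{w} (PLift (i = j))) := ⟨fun k => h k.down.down⟩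
  (isCoprod_singleAt i T j).isInitial

/-- The double coproduct over `j` and over the proofs of `i = j` has exactly one summand. -/
lemma isCoprod_singleAtTo : IsCoprod (singleAt i T) T (singleAtTo i T) := by
  refine ⟨fun {Z} t => ?_⟩
  refine ⟨singleAtι i T ≫ t i, fun j => ?_, fun m hm => ?_⟩
  · refine (isCoprod_singleAt i T j).hom_ext fun h => ?_
    obtain ⟨⟨rfl⟩⟩ := h
    change singleAtι i T ≫ singleAtTo i T i ≫ _ = singleAtι i T ≫ _
    rw [← Category.assoc, singleAtι_to, Category.id_comp]
  · rw [← hm, ← Category.assoc, singleAtι_to, Category.id_comp]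

end SingleAt

namespace IsExtensive

variable [HasCoproducts.{w} V] (hV : IsExtensive V) {I : Type w} {X Y : I → V}

include hV

/-- For the empty family, essential surjectivity of `coprodOver` says that every object over the
empty coproduct is itself isomorphic to an empty coproduct. -/
lemma strictInitial {T Z : V} (hZ : IsInitial Z) (f : T ⟶ Z) : Nonempty (IsInitial T) := by
  let X : PEmpty.{w + 1} → V := fun i => i.elim
  have h := hV _ X
  have h0 : ∀ Y : PEmpty.{w + 1} → V, Nonempty (IsInitial (∐ Y)) := fun Y =>
    (isCoprod_sigma Y).isInitial
  let e := (coprodOver X).objObjPreimageIso (Over.mk (f ≫ hZ.to (∐ X)))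
  exact ⟨(h0 _).some.ofIso ((Over.forget _).mapIso e)⟩

lemma faithful_ext {f : ∀ i, Y i ⟶ X i} {T : I → V} {t : ∀ i, T i ⟶ X i} (k l : ∀ i, T i ⟶ Y i)
    (hk : ∀ i, k i ≫ f i = t i) (hl : ∀ i, l i ≫ f i = t i)
    (h : Limits.Sigma.map k = Limits.Sigma.map l) : k = l := by
  have := hV I X
  let a : (fun i => Over.mk (t i)) ⟶ fun i => Over.mk (f i) := fun i => Over.homMk (k i) (hk i)
  let b : (fun i => Over.mk (t i)) ⟶ fun i => Over.mk (f i) := fun i => Over.homMk (l i) (hl i)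
  have hab : a = b := (coprodOver X).map_injective (by
    ext1
    exact h)
  funext i
  exact congrArg (fun z => (z i).left) hab

lemma full_exists {f : ∀ i, Y i ⟶ X i} {T : I → V} {t : ∀ i, T i ⟶ X i} (s : ∐ T ⟶ ∐ Y)
    (h : s ≫ Limits.Sigma.map f = Limits.Sigma.map t) :
    ∃ k : ∀ i, T i ⟶ Y i, (∀ i, k i ≫ f i = t i) ∧ Limits.Sigma.map k = s := by
  have := hV I X
  let φ : (coprodOver X).obj (fun i => Over.mk (t i)) ⟶
    (coprodOver X).obj (fun i => Over.mk (f i)) := Over.homMk s h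
  let k := (coprodOver X).preimage φ
  refine ⟨fun i => (k i).left, fun i => Over.w (k i), ?_⟩
  exact congrArg (fun z => z.left) ((coprodOver X).map_preimage φ)

/-- A cone with vertex `T` over the cospan at `i` becomes, through `singleAt i T`, a statement on
maps of families over `X`. Faithfulness of `coprodOver` gives uniqueness of the lift and fullness
its existence. -/
lemma isPullback_sigmaMap (f : ∀ i, Y i ⟶ X i) (i : I) :
    IsPullback (Sigma.ι Y i) (f i) (Limits.Sigma.map f) (Sigma.ι X i) := by
  refine IsPullback.mk' (by simp) ?_ ?_
  · intro T k l h₁ h₂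
    obtain ⟨k', hk'⟩ := exists_singleAt_desc i T k
    obtain ⟨l', hl'⟩ := exists_singleAt_desc i T l
    have h2 : ∀ j, k' j ≫ f j = l' j ≫ f j := fun j => by
      by_cases hj : i = j
      · subst hj
        refine singleAt_hom_ext _ _ ?_
        rw [← Category.assoc, ← Category.assoc, hk', hl', h₂]
      · exact (singleAt_isInitial i T hj).some.hom_ext _ _
    have h3 : Limits.Sigma.map k' = Limits.Sigma.map l' := by
      refine Limits.Sigma.hom_ext _ _ fun j => ?_
      rw [Limits.Sigma.ι_map, Limits.Sigma.ι_map]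
      by_cases hj : i = j
      · subst hj
        refine singleAt_hom_ext _ _ ?_
        rw [← Category.assoc, ← Category.assoc, hk', hl', h₁]
      · exact (singleAt_isInitial i T hj).some.hom_ext _ _
    have h4 := hV.faithful_ext k' l' h2 (fun _ => rfl) h3
    rw [← hk', ← hl', h4]
  · intro T a b h
    obtain ⟨b', hb'⟩ := exists_singleAt_desc i T b
    -- Composing with `d : ∐ singleAt i T ⟶ T` makes `a` a map between coproducts, to which fullness
    -- applies.
    obtain ⟨d, hd⟩ := (isCoprod_sigma (singleAt i T)).exists_desc (singleAtTo i T)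
    obtain ⟨k, hk, hk'⟩ := hV.full_exists (f := f) (t := b') (d ≫ a) (by
      refine Limits.Sigma.hom_ext _ _ fun j => ?_
      rw [Category.assoc, ← Category.assoc, hd, Limits.Sigma.ι_map]
      by_cases hj : i = j
      · subst hj
        refine singleAt_hom_ext _ _ ?_
        rw [h, ← Category.assoc, singleAtι_to, Category.id_comp, ← Category.assoc, hb']
      · exact (singleAt_isInitial i T hj).some.hom_ext _ _)
    refine ⟨singleAtι i T ≫ k i, ?_, ?_⟩
    · have := congrArg (fun z => singleAtι i T ≫ Sigma.ι _ i ≫ z) hk'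
      simp only [Limits.Sigma.ι_map] at this
      rw [Category.assoc, this, ← Category.assoc (Sigma.ι _ i), hd, ← Category.assoc, singleAtι_to,
        Category.id_comp]
    · rw [Category.assoc, hk, hb']

/-- Coproducts in an extensive category are stable under pullback. -/
lemma isCoprod_of_isPullback {P W : V} {x : ∀ i, X i ⟶ P} (h : IsCoprod X P x) (g : W ⟶ P)
    {w : ∀ i, Y i ⟶ W} {f : ∀ i, Y i ⟶ X i} (hp : ∀ i, IsPullback (w i) (f i) g (x i)) :
    IsCoprod Y W w := by
  obtain ⟨e, he⟩ := h.exists_desc (Sigma.ι X)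
  have := h.isIso (isCoprod_sigma X) he
  have := hV I X
  -- By essential surjectivity `W` is a coproduct of some `Z i` over `X i`. These are pullbacks
  -- along the injections by `isPullback_sigmaMap`, hence isomorphic to the given `Y i`.
  let Z := (coprodOver X).objPreimage (Over.mk (g ≫ e))
  let θ := (coprodOver X).objObjPreimageIso (Over.mk (g ≫ e))
  let θ' : (∐ fun i => (Z i).left) ≅ W := (Over.forget _).mapIso θ
  have hθ : θ'.hom ≫ g ≫ e = Limits.Sigma.map fun i => (Z i).hom := Over.w θ.hom
  have h1 : ∀ i, IsPullback (Sigma.ι (fun i => (Z i).left) i ≫ θ'.hom) (Z i).hom g (x i) :=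
    fun i => (hV.isPullback_sigmaMap (fun i => (Z i).hom) i).of_iso (Iso.refl _) θ' (Iso.refl _)
      (asIso e).symm (by simp) (by simp) (by simp [← hθ]) (by simp [← he])
  have h2 := (isCoprod_sigma fun i => (Z i).left).comp_iso θ'.hom
  have h3 := h2.iso_comp fun i => ((hp i).isoIsPullback _ _ (h1 i)).hom
  simpa using h3

/-- Up to isomorphism the injection `x i` is itself a coproduct of maps: an identity at `i`, and
maps out of initial objects elsewhere. Thus `isPullback_sigmaMap` computes the intersection of two
injections, and yields both monicity and disjointness. -/
lemma isPullback_singleAt (i j : I) {P : V} {x : ∀ i, X i ⟶ P} (h : IsCoprod X P x) :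
    ∃ f : singleAt i (X i) j ⟶ X j, IsPullback (singleAtTo i (X i) j) f (x i) (x j) := by
  obtain ⟨b, hb⟩ := exists_singleAt_desc i (X i) (𝟙 (X i))
  refine ⟨b j, ?_⟩
  obtain ⟨e, he⟩ := h.exists_desc (Sigma.ι X)
  have := h.isIso (isCoprod_sigma X) he
  obtain ⟨d, hd⟩ := (isCoprod_sigma (singleAt i (X i))).exists_desc (singleAtTo i (X i))
  have := (isCoprod_sigma (singleAt i (X i))).isIso (isCoprod_singleAtTo i (X i)) hd
  refine (hV.isPullback_sigmaMap b j).of_iso (Iso.refl _) (asIso d) (Iso.refl _)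
    (asIso e).symm (by simp [hd]) (by simp) ?_ (by simp [← he])
  refine Limits.Sigma.hom_ext _ _ fun k => ?_
  rw [Limits.Sigma.ι_map_assoc]
  simp only [asIso_hom, Iso.symm_hom, asIso_inv]
  rw [← Category.assoc (Sigma.ι _ k), hd, ← he, Category.assoc, IsIso.hom_inv_id,
    Category.comp_id]
  by_cases hj : i = k
  · subst hj
    refine singleAt_hom_ext _ _ ?_
    rw [← Category.assoc, ← Category.assoc, hb, singleAtι_to]
  · exact (singleAt_isInitial i _ hj).some.hom_ext _ _

/-- In the case `j = i` of `isPullback_singleAt` one leg of the kernel pair of `x i` is invertible.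
-/
lemma mono_inj {P : V} {x : ∀ i, X i ⟶ P} (h : IsCoprod X P x) (i : I) : Mono (x i) := by
  obtain ⟨f, hf⟩ := hV.isPullback_singleAt i i h
  have : IsIso (singleAtTo i (X i) i) :=
    ⟨singleAtι i (X i), singleAt_hom_ext _ _ (by
      rw [← Category.assoc, singleAtι_to, Category.id_comp, Category.comp_id]), singleAtι_to _ _⟩
  refine ⟨fun {T} k l hkl => ?_⟩
  have h1 : hf.lift k l hkl ≫ singleAtTo i (X i) i = hf.lift k k rfl ≫ singleAtTo i (X i) i := by
    simp
  have h2 := (cancel_mono _).1 h1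
  exact ((hf.lift_snd k k rfl).symm.trans (congrArg (· ≫ f) h2.symm)).trans (hf.lift_snd k l hkl)

lemma disjoint {P : V} {x : ∀ i, X i ⟶ P} (h : IsCoprod X P x) {i j : I} (hij : i ≠ j) {T : V}
    (a : T ⟶ X i) (b : T ⟶ X j) (hab : a ≫ x i = b ≫ x j) : Nonempty (IsInitial T) := by
  obtain ⟨f, hf⟩ := hV.isPullback_singleAt i j h
  exact hV.strictInitial (singleAt_isInitial i (X i) hij).some (hf.lift a b hab)

lemma isPullback_of_isCoprod {P Q : V} {x : ∀ i, X i ⟶ P} (h : IsCoprod X P x)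
    {y : ∀ i, Y i ⟶ Q} (h' : IsCoprod Y Q y) {f : ∀ i, Y i ⟶ X i} {g : Q ⟶ P}
    (hg : ∀ i, y i ≫ g = f i ≫ x i) (i : I) : IsPullback (y i) (f i) g (x i) := by
  obtain ⟨e, he⟩ := (isCoprod_sigma X).exists_desc x
  have := (isCoprod_sigma X).isIso h he
  obtain ⟨d, hd⟩ := (isCoprod_sigma Y).exists_desc y
  have := (isCoprod_sigma Y).isIso h' hd
  refine (hV.isPullback_sigmaMap f i).of_iso (Iso.refl _) (asIso d) (Iso.refl _) (asIso e)
    (by simp [hd]) (by simp) ?_ (by simp [he])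
  refine Limits.Sigma.hom_ext _ _ fun k => ?_
  rw [Limits.Sigma.ι_map_assoc]
  simp only [asIso_hom]
  rw [he, ← hg, ← Category.assoc, hd]

omit hV [HasCoproducts.{w} V] in
-- Compatibility over `Z'` is the same as over `Z` when `m` is monic. Squares of summands can
-- therefore be compared inside the whole coproduct, without identifying summands whose indices are
-- only propositionally equal.
lemma isPullback_of_mono {P X Y Z Z' : V} {a : P ⟶ X} {b : P ⟶ Y} {f : X ⟶ Z} {g : Y ⟶ Z}
    (h : IsPullback a b f g) (m : Z ⟶ Z') [Mono m] {f' : X ⟶ Z'} {g' : Y ⟶ Z'}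
    (hf : f' = f ≫ m) (hg : g' = g ≫ m) : IsPullback a b f' g' := by
  subst hf hg
  refine IsPullback.mk' (by rw [h.w_assoc]) (fun T k l => h.hom_ext) fun T k l hkl => ?_
  have : k ≫ f = l ≫ g := (cancel_mono m).1 (by simpa using hkl)
  exact ⟨h.lift k l this, h.lift_fst _ _ _, h.lift_snd _ _ _⟩

/-- A square of coproducts is a pullback as soon as the square of the index sets and the squares of
the summands are pullbacks. -/
lemma isPullback_coprod [HasPullbacks V] {K J L : Type w} {A : K → V} {B : I → V} {C : J → V}
    {D : L → V} {P X Y Z : V} {a : ∀ k, A k ⟶ P} {b : ∀ i, B i ⟶ X} {c : ∀ j, C j ⟶ Y}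
    {d : ∀ l, D l ⟶ Z} (ha : IsCoprod A P a) (hb : IsCoprod B X b) (hc : IsCoprod C Y c)
    (hd : IsCoprod D Z d) {p : P ⟶ X} {q : P ⟶ Y} {f : X ⟶ Z} {g : Y ⟶ Z} {r : K → I} {s : K → J}
    {r' : I → L} {s' : J → L} {pk : ∀ k, A k ⟶ B (r k)} {qk : ∀ k, A k ⟶ C (s k)}
    {fi : ∀ i, B i ⟶ D (r' i)} {gj : ∀ j, C j ⟶ D (s' j)}
    (hp : ∀ k, a k ≫ p = pk k ≫ b (r k)) (hq : ∀ k, a k ≫ q = qk k ≫ c (s k))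
    (hf : ∀ i, b i ≫ f = fi i ≫ d (r' i)) (hg : ∀ j, c j ≫ g = gj j ≫ d (s' j))
    (hk : ∀ k, IsPullback (pk k) (qk k) (b (r k) ≫ f) (c (s k) ≫ g))
    (inj : ∀ k k', r k = r k' → s k = s k' → k = k')
    (surj : ∀ i j, r' i = s' j → ∃ k, r k = i ∧ s k = j) : IsPullback p q f g := by
  have hw : p ≫ f = q ≫ g := ha.hom_ext fun k => by
    rw [← Category.assoc, hp, ← Category.assoc, hq, Category.assoc, Category.assoc, (hk k).w]
  -- The canonical pullback of `f` and `g` is decomposed along the summands of `X` in `h1`, and each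
  -- piece along the summands of `Y` in `h2`.
  have h1 := hV.isCoprod_of_isPullback hb (pullback.fst f g)
    (w := fun i => pullback.lift (pullback.fst (b i ≫ f) g ≫ b i) (pullback.snd (b i ≫ f) g)
      (by rw [Category.assoc, pullback.condition]))
    (f := fun i => pullback.fst (b i ≫ f) g) fun i => by
      refine (IsPullback.of_bot (v₂₁ := pullback.snd f g) (v₂₂ := f) (h₃₁ := g)
        (v₁₂ := b i) (h₁₁ := pullback.fst (b i ≫ f) g) (h₂₁ := pullback.fst f g) ?_ ?_ ?_).flip
      · rw [pullback.lift_snd]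
        exact IsPullback.of_hasPullback (b i ≫ f) g
      · exact (pullback.lift_fst _ _ _).symm
      · exact IsPullback.of_hasPullback f g
  have h2 := fun i => hV.isCoprod_of_isPullback hc (pullback.snd (b i ≫ f) g)
    (w := fun j => pullback.lift (pullback.fst (b i ≫ f) (c j ≫ g))
      (pullback.snd (b i ≫ f) (c j ≫ g) ≫ c j)
      (by rw [pullback.condition, Category.assoc]))
    (f := fun j => pullback.snd (b i ≫ f) (c j ≫ g)) fun j => by
      refine IsPullback.of_right (h₁₂ := pullback.fst (b i ≫ f) g) (h₂₂ := g)
        (v₁₃ := b i ≫ f) (h₂₁ := c j) ?_ ?_ ?_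
      · rw [pullback.lift_fst]
        exact IsPullback.of_hasPullback (b i ≫ f) (c j ≫ g)
      · exact pullback.lift_snd _ _ _
      · exact (IsPullback.of_hasPullback (b i ≫ f) g)
  -- Pairs `(i, j)` with `r' i ≠ s' j` contribute initial objects, by disjointness in `Z`. The
  -- remaining pairs are indexed by `K`, so that `P` and the canonical pullback have the same
  -- summands.
  have h3 := (h1.trans h2).restrict (fun k : K => (⟨r k, s k⟩ : Σ _ : I, J))
    (fun k k' h => inj k k' (congrArg Sigma.fst h) (eq_of_heq (Sigma.mk.inj h).2)) (by
      rintro ⟨i, j⟩ hij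
      by_cases h : r' i = s' j
      · obtain ⟨k, rfl, rfl⟩ := surj i j h
        exact (hij k rfl).elim
      · refine hV.disjoint hd h (pullback.fst _ _ ≫ fi i) (pullback.snd _ _ ≫ gj j) ?_
        rw [Category.assoc, ← hf, Category.assoc, ← hg, pullback.condition])
  have h4 := h3.iso_comp fun k => (hk k).isoPullback.hom
  have h5 : IsIso (pullback.lift p q hw) := ha.isIso h4 fun k => by
    refine pullback.hom_ext ?_ ?_
    · simp only [Category.assoc, pullback.lift_fst, pullback.lift_fst_assoc, hp,
        IsPullback.isoPullback_hom_fst_assoc]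
    · simp only [Category.assoc, pullback.lift_snd, hq,
        IsPullback.isoPullback_hom_snd_assoc]
  exact IsPullback.of_iso_pullback ⟨hw⟩ (asIso (pullback.lift p q hw)) (pullback.lift_fst _ _ _)
    (pullback.lift_snd _ _ _)

end IsExtensive

/-- A criterion for extensivity, in terms of chosen coproducts. -/
lemma IsExtensive.of_isCoprod [HasCoproducts.{w} V]
    (P : ∀ {I : Type w}, (I → V) → V) (x : ∀ {I : Type w} (X : I → V) (i : I), X i ⟶ P X)
    (hx : ∀ {I : Type w} (X : I → V), IsCoprod X (P X) (x X))
    (h₁ : ∀ {I : Type w} {X Y : I → V} (f : ∀ i, Y i ⟶ X i) (g : P Y ⟶ P X)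
      (_ : ∀ i, x Y i ≫ g = f i ≫ x X i) (i : I), IsPullback (x Y i) (f i) g (x X i))
    (h₂ : ∀ {I : Type w} {X : I → V} {W : V} (g : W ⟶ P X), ∃ (Y : I → V) (y : ∀ i, Y i ⟶ W)
      (f : ∀ i, Y i ⟶ X i), IsCoprod Y W y ∧ ∀ i, y i ≫ g = f i ≫ x X i) :
    IsExtensive V := by
  intro I X
  -- Moving `h₁` from the chosen coproducts to `∐` is what gives full faithfulness; `h₂` gives
  -- essential surjectivity.
  have hs : ∀ {X Y : I → V} (f : ∀ i, Y i ⟶ X i) (i : I),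
      IsPullback (Sigma.ι Y i) (f i) (Limits.Sigma.map f) (Sigma.ι X i) := by
    intro X Y f i
    obtain ⟨e, he⟩ := (hx X).exists_desc (Sigma.ι X)
    have := (hx X).isIso (isCoprod_sigma X) he
    obtain ⟨d, hd⟩ := (hx Y).exists_desc (Sigma.ι Y)
    have := (hx Y).isIso (isCoprod_sigma Y) hd
    obtain ⟨g, hg⟩ := (hx Y).exists_desc fun i => f i ≫ x X i
    refine (h₁ f g hg i).of_iso (Iso.refl _) (asIso d) (Iso.refl _) (asIso e)
      (by simp [hd]) (by simp) ?_ (by simp [he])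
    refine (hx Y).hom_ext fun k => ?_
    simp only [asIso_hom]
    rw [← Category.assoc, hg, Category.assoc, he, ← Category.assoc, hd, Limits.Sigma.ι_map]
  have ffu : (coprodOver X).Faithful := ⟨fun {Y Y'} a b hab => by
    funext i
    ext1
    refine (hs (fun i => (Y' i).hom) i).hom_ext ?_ ((Over.w (a i)).trans (Over.w (b i)).symm)
    have h := congrArg (fun z => Sigma.ι (fun i => (Y i).left) i ≫ z.left) hab
    have h' : Sigma.ι (fun i => (Y i).left) i ≫ Limits.Sigma.map (fun i => (a i).left) =
      Sigma.ι (fun i => (Y i).left) i ≫ Limits.Sigma.map (fun i => (b i).left) := h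
    simpa using h'⟩
  have ful : (coprodOver X).Full := ⟨fun {Y Y'} φ => by
    have hφ : φ.left ≫ Limits.Sigma.map (fun i => (Y' i).hom) =
      Limits.Sigma.map fun i => (Y i).hom := Over.w φ
    choose k hk₁ hk₂ using fun i => (hs (fun i => (Y' i).hom) i).exists_lift
      (Sigma.ι (fun i => (Y i).left) i ≫ φ.left) (Y i).hom
      ((Category.assoc _ _ _).trans ((congrArg (Sigma.ι (fun i => (Y i).left) i ≫ ·) hφ).trans
        (Limits.Sigma.ι_map (fun i => (Y i).hom) i)))
    refine ⟨fun i => Over.homMk (k i) (hk₂ i), ?_⟩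
    ext1
    exact Limits.Sigma.hom_ext _ _ fun i => (Limits.Sigma.ι_map k i).trans (hk₁ i)⟩
  have ess : (coprodOver X).EssSurj := ⟨fun W => by
    obtain ⟨e, he⟩ := (hx X).exists_desc (Sigma.ι X)
    have := (hx X).isIso (isCoprod_sigma X) he
    obtain ⟨Y, y, f, hy, hf⟩ := h₂ (W.hom ≫ inv e)
    obtain ⟨d, hd⟩ := (isCoprod_sigma Y).exists_desc y
    have hdi := (isCoprod_sigma Y).isIso hy hd
    refine ⟨fun i => Over.mk (f i), ⟨Over.isoMk (@asIso _ _ _ _ d hdi) ?_⟩⟩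
    refine Limits.Sigma.hom_ext _ _ fun i => ?_
    refine Eq.trans ?_ (Limits.Sigma.ι_map f i).symm
    have h3 := congrArg (· ≫ e) (hf i)
    simp only [Category.assoc, IsIso.inv_hom_id, Category.comp_id, he] at h3
    refine Eq.trans ?_ h3
    exact (Category.assoc _ _ _).symm.trans (congrArg (· ≫ W.hom) (hd i))⟩
  exact { faithful := ffu, full := ful, essSurj := ess }

end Extensive

/-! ### Limits and coproducts of enriched graphs -/

section GraphPullbacks

variable {V : Type u} [Category.{w} V]

namespace EGraph

lemma hom_eq_of_mk_eq {X Y : EGraph V} {f : X.obj → Y.obj}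
    {φ ψ : ∀ a b, X.hom a b ⟶ Y.hom (f a) (f b)}
    (h : (EGraphHom.mk f φ : EGraphHom X Y) = EGraphHom.mk f ψ) (a b : X.obj) :
    φ a b = ψ a b := by
  injection h with _ h
  exact congrFun (congrFun h a) b

lemma hom_comp_eqToHom {X Y : EGraph V} {f g : X ⟶ Y} (h : f = g) (a b : X.obj) :
    f.hom a b ≫ eqToHom (by rw [h]) = g.hom a b := by
  subst h
  simp

/-- The inverse is found by testing on all `T`: once an object map into `Y` is written as `f.obj`
after `l₀`, the hom maps can be inverted in place. A direct inverse would need transports along the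
inverse bijection. -/
lemma isIso_of_hom {X Y : EGraph V} (f : X ⟶ Y) (h₀ : Function.Bijective f.obj)
    (h : ∀ a b, IsIso (f.hom a b)) : IsIso f := by
  refine isIso_of_yoneda_map_bijective f fun T => ⟨fun k l hkl => ?_, fun k => ?_⟩
  · obtain ⟨k₀, k⟩ := k
    obtain ⟨l₀, l⟩ := l
    obtain rfl : k₀ = l₀ := funext fun a => h₀.1 (congrFun (congrArg EGraphHom.obj hkl) a)
    refine congrArg (EGraphHom.mk k₀) (funext fun a => funext fun b => ?_)
    have := h (k₀ a) (k₀ b)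
    exact (cancel_mono (f.hom (k₀ a) (k₀ b))).1 (hom_eq_of_mk_eq hkl a b)
  · obtain ⟨k₀, k⟩ := k
    obtain ⟨l₀, rfl⟩ : ∃ l₀ : T.obj → X.obj, k₀ = fun a => f.obj (l₀ a) := by
      choose l₀ hl₀ using fun a => h₀.2 (k₀ a)
      exact ⟨l₀, funext fun a => (hl₀ a).symm⟩
    refine ⟨⟨l₀, fun a b => k a b ≫ inv (f.hom (l₀ a) (l₀ b))⟩, ?_⟩
    refine congrArg (EGraphHom.mk _) (funext fun a => funext fun b => ?_)
    simp

/-- A square of graphs is a pullback when its squares of object sets and of homs are. -/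
lemma isPullback_of_hom {P X Y Z : EGraph V} {p : P ⟶ X} {q : P ⟶ Y} {f : X ⟶ Z} {g : Y ⟶ Z}
    (hw : ∀ a, f.obj (p.obj a) = g.obj (q.obj a))
    (inj : ∀ a a', p.obj a = p.obj a' → q.obj a = q.obj a' → a = a')
    (surj : ∀ x y, f.obj x = g.obj y → ∃ a, p.obj a = x ∧ q.obj a = y)
    (h : ∀ a b, IsPullback (p.hom a b) (q.hom a b)
      (f.hom (p.obj a) (p.obj b) ≫ eqToHom (by rw [hw, hw])) (g.hom (q.obj a) (q.obj b))) :
    IsPullback p q f g := by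
  refine IsPullback.mk' ?_ ?_ ?_
  · refine EGraphHom.ext_of_hom hw fun a b => ?_
    exact (Category.assoc _ _ _).trans (h a b).w
  · intro T k l h₁ h₂
    obtain ⟨k₀, k⟩ := k
    obtain ⟨l₀, l⟩ := l
    obtain rfl : k₀ = l₀ := funext fun a => inj _ _
      (congrFun (congrArg EGraphHom.obj h₁) a) (congrFun (congrArg EGraphHom.obj h₂) a)
    refine congrArg (EGraphHom.mk k₀) (funext fun a => funext fun b => ?_)
    exact (h (k₀ a) (k₀ b)).hom_ext (hom_eq_of_mk_eq h₁ a b) (hom_eq_of_mk_eq h₂ a b)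
  · intro T k l hkl
    obtain ⟨k₀, k⟩ := k
    obtain ⟨l₀, l⟩ := l
    -- Substituting the object maps of the cone by their factorisation through `P` gives its hom
    -- maps the types that `h` expects.
    obtain ⟨m, rfl, rfl⟩ : ∃ m : T.obj → P.obj, k₀ = (fun a => p.obj (m a)) ∧
        l₀ = fun a => q.obj (m a) := by
      choose m hm₁ hm₂ using fun a => surj (k₀ a) (l₀ a) (congrFun (congrArg EGraphHom.obj hkl) a)
      exact ⟨m, funext fun a => (hm₁ a).symm, funext fun a => (hm₂ a).symm⟩
    have hc : ∀ a b, k a b ≫ f.hom _ _ ≫ eqToHom (by rw [hw, hw]) = l a b ≫ g.hom _ _ :=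
      fun a b => (Category.assoc _ _ _).symm.trans (hom_comp_eqToHom hkl a b)
    refine ⟨⟨m, fun a b => (h (m a) (m b)).lift (k a b) (l a b) (hc a b)⟩, ?_, ?_⟩
    · refine congrArg (EGraphHom.mk _) (funext fun a => funext fun b => ?_)
      exact IsPullback.lift_fst _ _ _ _
    · refine congrArg (EGraphHom.mk _) (funext fun a => funext fun b => ?_)
      exact IsPullback.lift_snd _ _ _ _

/-! ### Detecting pullbacks of homs with arrow graphs. -/

section Arrow

variable [HasInitial V]

/-- The graph with two objects and one hom which is not initial. -/
noncomputable def arrow (Z : V) : EGraph V where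
  obj := ULift.{w} Bool
  hom a b := match a, b with
    | ⟨false⟩, ⟨true⟩ => Z
    | ⟨false⟩, ⟨false⟩ => ⊥_ V
    | ⟨true⟩, _ => ⊥_ V

/-- Maps out of `arrow Z` amount to two objects and a map from `Z` into the hom between them. The
universal property of a pullback of graphs, tested on `arrow T`, becomes that of a square of homs
tested on `T`. -/
noncomputable def arrowMap {Z : V} {X : EGraph V} (a b : X.obj) (z : Z ⟶ X.hom a b) :
    arrow Z ⟶ X where
  obj t := match t with
    | ⟨false⟩ => a
    | ⟨true⟩ => b
  hom s t := match s, t with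
    | ⟨false⟩, ⟨true⟩ => z
    | ⟨false⟩, ⟨false⟩ => initial.to _
    | ⟨true⟩, _ => initial.to _

lemma arrow_hom_ext {Z : V} {X : EGraph V} {f : (arrow Z).obj → X.obj}
    {φ ψ : ∀ a b, (arrow Z).hom a b ⟶ X.hom (f a) (f b)}
    (h : φ ⟨false⟩ ⟨true⟩ = ψ ⟨false⟩ ⟨true⟩) :
    (EGraphHom.mk f φ : EGraphHom (arrow Z) X) = EGraphHom.mk f ψ := by
  refine congrArg (EGraphHom.mk f) (funext fun a => funext fun b => ?_)
  match a, b with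
  | ⟨false⟩, ⟨true⟩ => exact h
  | ⟨false⟩, ⟨false⟩ => exact initialIsInitial.hom_ext _ _
  | ⟨true⟩, _ => exact initialIsInitial.hom_ext _ _

/-- A square with two identity-on-objects sides is a pullback if and only if the squares of homs
are. -/
lemma isPullback_ofHoms_iff {S R : Type w} {f : S → R} {K K' : S → S → V} {L L' : R → R → V}
    {φ : ∀ a b, K a b ⟶ L (f a) (f b)} {φ' : ∀ a b, K' a b ⟶ L' (f a) (f b)}
    {α : ∀ a b, K a b ⟶ K' a b} {β : ∀ a b, L a b ⟶ L' a b} :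
    IsPullback (EGraphHom.mk f φ : (⟨S, K⟩ : EGraph V) ⟶ ⟨R, L⟩) (EGraphHom.ofHoms α)
      (EGraphHom.ofHoms β) (EGraphHom.mk f φ' : (⟨S, K'⟩ : EGraph V) ⟶ ⟨R, L'⟩) ↔
    ∀ a b, IsPullback (φ a b) (α a b) (β (f a) (f b)) (φ' a b) := by
  refine ⟨fun h a b => IsPullback.mk' (hom_eq_of_mk_eq h.w a b) ?_ ?_, fun h => ?_⟩
  · intro T k l h₁ h₂
    have h₃ : arrowMap (X := ⟨S, K⟩) a b k = arrowMap (X := ⟨S, K⟩) a b l := by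
      refine h.hom_ext ?_ ?_
      · exact arrow_hom_ext h₁
      · exact arrow_hom_ext h₂
    exact hom_eq_of_mk_eq h₃ ⟨false⟩ ⟨true⟩
  · intro T k l hkl
    obtain ⟨m, hm₁, hm₂⟩ := h.exists_lift (arrowMap (X := ⟨R, L⟩) (f a) (f b) k)
      (arrowMap (X := ⟨S, K'⟩) a b l) (by
        refine EGraphHom.ext_of_hom ?_ ?_
        · rintro ⟨_ | _⟩ <;> rfl
        · rintro ⟨_ | _⟩ ⟨_ | _⟩
          · exact initialIsInitial.hom_ext _ _
          · exact (Category.comp_id _).trans hkl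
          · exact initialIsInitial.hom_ext _ _
          · exact initialIsInitial.hom_ext _ _)
    obtain ⟨m₀, m⟩ := m
    -- One projection of the square is the identity on objects, so it fixes the object map of the
    -- lift.
    obtain rfl : m₀ = (arrowMap (X := ⟨S, K'⟩) a b l).obj := congrArg EGraphHom.obj hm₂
    refine ⟨m ⟨false⟩ ⟨true⟩, ?_, hom_eq_of_mk_eq hm₂ ⟨false⟩ ⟨true⟩⟩
    have h₄ := hom_comp_eqToHom hm₁ ⟨false⟩ ⟨true⟩
    exact (Category.comp_id _).symm.trans h₄
  · refine isPullback_of_hom (fun _ => rfl) (fun _ _ _ h => h) (fun x y hxy => ⟨y, hxy.symm, rfl⟩)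
      fun a b => ?_
    have := h a b
    rw [← Category.comp_id (β (f a) (f b))] at this
    exact this

end Arrow

noncomputable def pullback [HasPullbacks V] {X Y Z : EGraph V} (f : X ⟶ Z) (g : Y ⟶ Z) :
    EGraph V where
  obj := {a : X.obj × Y.obj // f.obj a.1 = g.obj a.2}
  hom a b := Limits.pullback
    (f.hom a.1.1 b.1.1 ≫ eqToHom (by rw [a.2, b.2]) : _ ⟶ Z.hom (g.obj a.1.2) (g.obj b.1.2))
    (g.hom a.1.2 b.1.2)

noncomputable def pullbackFst [HasPullbacks V] {X Y Z : EGraph V} (f : X ⟶ Z) (g : Y ⟶ Z) :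
    pullback f g ⟶ X :=
  ⟨fun a => a.1.1, fun _ _ => Limits.pullback.fst _ _⟩

noncomputable def pullbackSnd [HasPullbacks V] {X Y Z : EGraph V} (f : X ⟶ Z) (g : Y ⟶ Z) :
    pullback f g ⟶ Y :=
  ⟨fun a => a.1.2, fun _ _ => Limits.pullback.snd _ _⟩

lemma isPullback [HasPullbacks V] {X Y Z : EGraph V} (f : X ⟶ Z) (g : Y ⟶ Z) :
    IsPullback (pullbackFst f g) (pullbackSnd f g) f g :=
  isPullback_of_hom (fun a => a.2) (fun _ _ h₁ h₂ => Subtype.ext (Prod.ext h₁ h₂))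
    (fun x y h => ⟨⟨(x, y), h⟩, rfl, rfl⟩) fun _ _ => IsPullback.of_hasPullback _ _

instance [HasFiniteLimits V] : HasFiniteLimits (EGraph V) := by
  have : ∀ {X Y Z : EGraph V} {f : X ⟶ Z} {g : Y ⟶ Z}, HasLimit (cospan f g) :=
    fun {_ _ _ f g} => (isPullback f g).hasPullback
  have := hasPullbacks_of_hasLimit_cospan (EGraph V)
  exact hasFiniteLimits_of_hasTerminal_and_pullbacks

/-- Every map of graphs is isomorphic to one whose object map is the projection of a disjoint
union. -/
lemma exists_iso_sigma {X Z : EGraph V} (f : X ⟶ Z) :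
    ∃ (S : Z.obj → Type w) (K : (Σ z, S z) → (Σ z, S z) → V)
      (φ : ∀ a b, K a b ⟶ Z.hom a.1 b.1) (e : (⟨Σ z, S z, K⟩ : EGraph V) ≅ X),
      e.hom ≫ f = (⟨Sigma.fst, φ⟩ : (⟨Σ z, S z, K⟩ : EGraph V) ⟶ Z) := by
  let S : Z.obj → Type w := fun z => {a // f.obj a = z}
  let K : (Σ z, S z) → (Σ z, S z) → V := fun a b => X.hom a.2.1 b.2.1
  let e : (⟨Σ z, S z, K⟩ : EGraph V) ⟶ X := ⟨fun a => a.2.1, fun _ _ => 𝟙 _⟩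
  have he : IsIso e := isIso_of_hom e
    ⟨by
      rintro ⟨_, a, rfl⟩ ⟨_, b, rfl⟩ h
      obtain rfl : a = b := h
      rfl, fun a => ⟨⟨_, a, rfl⟩, rfl⟩⟩ fun a b => IsIso.id _
  refine ⟨S, K, fun a b => f.hom _ _ ≫ eqToHom (by rw [a.2.2, b.2.2]), asIso e, ?_⟩
  refine EGraphHom.ext_of_hom (fun a => a.2.2) fun a b => ?_
  change (𝟙 _ ≫ f.hom _ _) ≫ _ = _
  rw [Category.id_comp]
  rfl

end EGraph

end GraphPullbacks

/-! ### Coproducts and extensivity of enriched graphs and of sets. -/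

section GraphCoproducts

variable {V : Type u} [Category.{w} V] [HasCoproducts.{w} V]

namespace EGraph

lemma isCoprod_sigma {I : Type w} (X : I → EGraph V) : IsCoprod X (sigma X) (sigmaι X) :=
  ⟨fun t => ⟨sigmaDesc t, sigmaι_desc t, fun _ hm => sigma_hom_ext fun i =>
    (hm i).trans (sigmaι_desc t i).symm⟩⟩

/-- The hom of the coproduct within one summand is a coproduct over the proofs of `i = i`, of which
there is exactly one. -/
lemma isIso_sigmaι_hom {I : Type w} (X : I → EGraph V) (i : I) (a b : (X i).obj) :
    IsIso ((sigmaι X i).hom a b) := by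
  let F : ULift.{w} (PLift (i = i)) → V := fun h =>
    (X i).hom (cast (congrArg (fun i => (X i).obj) h.down.down) a) b
  -- Every proof of `i = i` is definitionally `rfl`, so the cast in `F h` reduces and the component
  -- is an identity.
  obtain ⟨d, hd⟩ := (MultitensorOperad.isCoprod_sigma F).exists_desc
    (Z := (X i).hom a b) fun h => eqToHom rfl
  have h1 : (sigmaι X i).hom a b ≫ d = 𝟙 _ := hd ⟨⟨rfl⟩⟩
  refine ⟨d, h1, (MultitensorOperad.isCoprod_sigma F).hom_ext fun h => ?_⟩
  exact (Category.assoc _ _ _).symm.trans ((congrArg (· ≫ (sigmaι X i).hom a b) h1).trans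
    ((Category.id_comp _).trans (Category.comp_id _).symm))

lemma sigma_hom_isInitial {I : Type w} (X : I → EGraph V) {i j : I} (h : i ≠ j) (a : (X i).obj)
    (b : (X j).obj) : Nonempty (IsInitial ((sigma X).hom ⟨i, a⟩ ⟨j, b⟩)) := by
  have : IsEmpty (ULift.{w} (PLift (i = j))) := ⟨fun k => h k.down.down⟩
  exact (MultitensorOperad.isCoprod_sigma
    fun h : ULift.{w} (PLift (i = j)) =>
      (X j).hom (cast (congrArg (fun i => (X i).obj) h.down.down) a) b).isInitial

/-- The hypotheses say that the comparison from `sigma Y` is bijective on objects and invertible on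
homs: within a summand it is an isomorphism, and between different summands it is a map of initial
objects. -/
lemma isCoprod_of_hom {I : Type w} {Y : I → EGraph V} {W : EGraph V} {y : ∀ i, Y i ⟶ W}
    (inj : ∀ i j a b, (y i).obj a = (y j).obj b →
      (⟨i, a⟩ : Σ i, (Y i).obj) = ⟨j, b⟩)
    (surj : ∀ c, ∃ i a, (y i).obj a = c) (hom : ∀ i a b, IsIso ((y i).hom a b))
    (init : ∀ i j a b, i ≠ j → Nonempty (IsInitial (W.hom ((y i).obj a) ((y j).obj b)))) :
    IsCoprod Y W y := by
  have h : IsIso (sigmaDesc y) := by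
    refine isIso_of_hom _ ⟨fun a b => inj _ _ _ _, fun c => ?_⟩ ?_
    · obtain ⟨i, a, rfl⟩ := surj c
      exact ⟨⟨i, a⟩, rfl⟩
    · rintro ⟨i, a⟩ ⟨j, b⟩
      by_cases hij : i = j
      · subst hij
        have h1 : (sigmaι Y i).hom a b ≫ (sigmaDesc y).hom ⟨i, a⟩ ⟨i, b⟩ = (y i).hom a b :=
          Sigma.ι_desc (fun h : ULift.{w} (PLift (i = i)) => sigmaDescAux y h.down.down a b) ⟨⟨rfl⟩⟩
        have h2 := hom i a b
        rw [← h1] at h2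
        exact @IsIso.of_isIso_comp_left _ _ _ _ _ _ _ (isIso_sigmaι_hom Y i a b) h2
      · obtain ⟨h1⟩ := sigma_hom_isInitial Y hij a b
        obtain ⟨h2⟩ := init i j a b hij
        refine ⟨h2.to _, h1.hom_ext _ _, h2.hom_ext _ _⟩
  have := (isCoprod_sigma Y).comp_iso (sigmaDesc y)
  simpa only [sigmaι_desc] using this

/-- A map into a coproduct of graphs with all its values in one summand. -/
lemma exists_factor {I : Type w} {X : I → EGraph V} {T : EGraph V} (u : T ⟶ sigma X) (i : I)
    (h : ∀ t, (u.obj t).1 = i) : ∃ v : T ⟶ X i, v ≫ sigmaι X i = u := by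
  obtain ⟨u₀, u⟩ := u
  obtain ⟨v₀, rfl⟩ : ∃ v₀ : T.obj → (X i).obj, u₀ = fun t => ⟨i, v₀ t⟩ := by
    have key : ∀ c : Σ i, (X i).obj, c.1 = i → ∃ a, c = ⟨i, a⟩ := by
      rintro ⟨_, a⟩ rfl
      exact ⟨a, rfl⟩
    choose v₀ hv₀ using fun t => key (u₀ t) (h t)
    exact ⟨v₀, funext hv₀⟩
  choose d _ hd using fun a b => (isIso_sigmaι_hom X i a b).out
  refine ⟨⟨v₀, fun a b => u a b ≫ d (v₀ a) (v₀ b)⟩, ?_⟩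
  refine congrArg (EGraphHom.mk _) (funext fun a => funext fun b => ?_)
  exact (Category.assoc _ _ _).trans ((congrArg (u a b ≫ ·) (hd _ _)).trans (Category.comp_id _))

lemma mono_sigmaι {I : Type w} (X : I → EGraph V) (i : I) : Mono (sigmaι X i) := by
  refine ⟨fun {T} k l hkl => ?_⟩
  obtain ⟨k₀, k⟩ := k
  obtain ⟨l₀, l⟩ := l
  obtain rfl : k₀ = l₀ := funext fun a =>
    eq_of_heq (Sigma.mk.inj (congrFun (congrArg EGraphHom.obj hkl) a)).2
  refine congrArg (EGraphHom.mk k₀) (funext fun a => funext fun b => ?_)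
  have := isIso_sigmaι_hom X i (k₀ a) (k₀ b)
  exact (cancel_mono _).1 (hom_eq_of_mk_eq hkl a b)

/-- The full subgraph on the objects which a map to a coproduct sends to a given summand. -/
def part {I : Type w} {X : I → EGraph V} {W : EGraph V} (g : W ⟶ sigma X) (i : I) : EGraph V :=
  ⟨{c : W.obj // (g.obj c).1 = i}, fun a b => W.hom a.1 b.1⟩

def partι {I : Type w} {X : I → EGraph V} {W : EGraph V} (g : W ⟶ sigma X) (i : I) :
    part g i ⟶ W :=
  ⟨fun a => a.1, fun _ _ => 𝟙 _⟩

/-- A graph over `sigma X` splits into the full subgraphs `part g i`. A hom between objects of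
different parts maps to an initial hom of `sigma X`, so it is initial because initial objects of `V`
are strict. -/
lemma isExtensive (hV : IsExtensive V) : IsExtensive (EGraph V) := by
  refine IsExtensive.of_isCoprod sigma sigmaι isCoprod_sigma ?_ ?_
  · intro I X Y f g hg i
    have hm := mono_sigmaι X i
    refine IsPullback.mk' (hg i) ?_ ?_
    · intro T k l h₁ _
      have := mono_sigmaι Y i
      exact (cancel_mono _).1 h₁
    · intro T a b hab
      -- Since `g` preserves the summand and `a ≫ g` lands in the summand `i`, so does `a`.
      have hg₀ : ∀ c, (g.obj c).1 = c.1 := fun c =>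
        congrArg Sigma.fst (congrFun (congrArg EGraphHom.obj (hg c.1)) c.2)
      obtain ⟨v, hv⟩ := exists_factor a i fun t => (hg₀ _).symm.trans
        (congrArg Sigma.fst (congrFun (congrArg EGraphHom.obj hab) t))
      refine ⟨v, hv, ?_⟩
      rw [← cancel_mono (sigmaι X i), Category.assoc, ← hg, ← Category.assoc, hv, hab]
  · intro I X W g
    choose f hf using fun i => exists_factor (partι g i ≫ g) i fun t => t.2
    refine ⟨part g, partι g, f, isCoprod_of_hom ?_ ?_ ?_ ?_, fun i => (hf i).symm⟩
    · rintro i j ⟨a, rfl⟩ ⟨b, rfl⟩ h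
      obtain rfl : a = b := h
      rfl
    · exact fun c => ⟨_, ⟨c, rfl⟩, rfl⟩
    · exact fun i a b => IsIso.id _
    · rintro i j ⟨a, rfl⟩ ⟨b, rfl⟩ h
      exact hV.strictInitial (sigma_hom_isInitial X h _ _).some (g.hom a b)

end EGraph

lemma isExtensive_type : IsExtensive (Type w) := by
  refine IsExtensive.of_isCoprod (fun {I} X => Σ i, X i) (fun X i => ↾(fun a => ⟨i, a⟩)) ?_ ?_ ?_
  · intro I X
    refine ⟨fun t => ⟨↾(fun a => t a.1 a.2), fun i => rfl, fun m hm => ?_⟩⟩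
    ext a
    exact congrArg (fun k => k a.2) (hm a.1)
  · intro I X Y f g hg i
    have hg' : ∀ c : Σ i, Y i, g c = ⟨c.1, f c.1 c.2⟩ := fun c =>
      congrArg (fun k => k c.2) (hg c.1)
    refine IsPullback.mk' (hg i) (fun T k l h₁ _ => ?_) fun T a b hab => ?_
    · ext t
      exact eq_of_heq (Sigma.mk.inj (congrArg (fun k => k t) h₁)).2
    · have h : ∀ t, ∃ y : Y i, a t = ⟨i, y⟩ ∧ f i y = b t := fun t => by
        have h₁ : g (a t) = ⟨i, b t⟩ := congrArg (fun k => k t) hab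
        rw [hg'] at h₁
        generalize a t = c at h₁ ⊢
        obtain ⟨j, y⟩ := c
        obtain ⟨rfl, h₂⟩ := Sigma.mk.inj h₁
        exact ⟨y, rfl, eq_of_heq h₂⟩
      choose v hv₁ hv₂ using h
      refine ⟨↾v, ?_, ?_⟩
      · exact ConcreteCategory.hom_ext _ _ fun t => (hv₁ t).symm
      · exact ConcreteCategory.hom_ext _ _ fun t => hv₂ t
  · intro I X W g
    refine ⟨fun i => {c : W // (g c).1 = i}, fun i => ↾(fun c => c.1), fun i => ↾(fun c => c.2 ▸ (g c.1).2), ?_, ?_⟩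
    · refine ⟨fun t => ⟨↾(fun a => t (g a).1 ⟨a, rfl⟩), fun i => ?_, fun m hm => ?_⟩⟩
      · ext ⟨a, rfl⟩
        rfl
      · ext a
        exact congrArg (fun k => k ⟨a, rfl⟩) (hm (g a).1)
    · refine fun i => ConcreteCategory.hom_ext _ _ ?_
      rintro ⟨a, rfl⟩
      rfl

end GraphCoproducts

/-! ### Labelled paths -/

universe u₃ v₃

/-- Paths `a = x₀, …, xₙ = b` of elements of `S`, with a label in `K Zᵢ xᵢ₋₁ xᵢ` for each step, where
`Z₁, …, Zₙ` is a given list. -/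
inductive LPath {S : Type w} {A : Type u₂} (K : A → S → S → Type v) :
    List A → S → S → Type (max u₂ v w)
  | nil (a : S) : LPath K [] a a
  | cons {Z : A} {Zs : List A} {a b c : S} (f : K Z a b) (p : LPath K Zs b c) :
    LPath K (Z :: Zs) a c

namespace LPath

variable {S S' S'' : Type w} {A : Type u₂} {A' : Type u₃} {K : A → S → S → Type v}
  {K' : A' → S → S → Type v₃}

/-- The underlying sequence of objects of a path. -/
def seq : {Zs : List A} → {a b : S} → LPath K Zs a b → ObjSeq a b
  | _, _, _, nil a => Chain.nil a
  | _, _, _, cons _ p => Chain.cons PUnit.unit (seq p)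

def append : {Zs Ws : List A} → {a b c : S} → LPath K Zs a b → LPath K Ws b c →
    LPath K (Zs ++ Ws) a c
  | _, _, _, _, _, nil _, q => q
  | _, _, _, _, _, cons f p, q => cons f (append p q)

def flatten : {Zss : List (List A)} → {a b : S} → LPath (LPath K) Zss a b →
    LPath K Zss.flatten a b
  | _, _, _, nil a => nil a
  | _, _, _, cons p R => append p (flatten R)

/-- Change the labels of a path. -/
def mapLabels (o : A → A') (g : ∀ Z a b, K Z a b → K' (o Z) a b) :
    {Zs : List A} → {a b : S} → LPath K Zs a b → LPath K' (Zs.map o) a b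
  | _, _, _, nil a => nil a
  | _, _, _, cons f p => cons (g _ _ _ f) (mapLabels o g p)

/-- The image of a path under a map `S → S'`. -/
def mapObj {K' : A → S' → S' → Type v₃} (f : S → S') (g : ∀ Z a b, K Z a b → K' Z (f a) (f b)) :
    {Zs : List A} → {a b : S} → LPath K Zs a b → LPath K' Zs (f a) (f b)
  | _, _, _, nil a => nil (f a)
  | _, _, _, cons h p => cons (g _ _ _ h) (mapObj f g p)

/-- The path given by a chain, with prescribed labels. -/
def ofChain {J : S → S → Type w} {F : ∀ a b, J a b → A} (i : ∀ a b j, K (F a b j) a b) :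
    {a b : S} → (p : Chain J a b) → LPath K (Chain.labels F p) a b
  | _, _, Chain.nil a => nil a
  | _, _, Chain.cons j p => cons (i _ _ j) (ofChain i p)

/-- Rebracketing changes the list that indexes a path only up to propositional equality, so laws for
paths which change the list are stated with `HEq` and proved step by step with this lemma and
`append_heq`. -/
lemma cons_heq {Z : A} {Zs Zs' : List A} {a b c : S} (h : Zs = Zs') {f f' : K Z a b}
    {p : LPath K Zs b c} {p' : LPath K Zs' b c} (hf : f = f') (hp : HEq p p') :
    HEq (cons f p) (cons f' p') := by
  subst h hf hp
  rfl

lemma append_heq {Zs Zs' Ws Ws' : List A} {a b c : S} (h : Zs = Zs') (h' : Ws = Ws')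
    {p : LPath K Zs a b} {p' : LPath K Zs' a b} {q : LPath K Ws b c} {q' : LPath K Ws' b c}
    (hp : HEq p p') (hq : HEq q q') : HEq (append p q) (append p' q') := by
  subst h h' hp hq
  rfl

lemma append_nil {Zs : List A} {a b : S} (p : LPath K Zs a b) : HEq (append p (nil b)) p := by
  induction p with
  | nil => rfl
  | cons f p ih => exact cons_heq (List.append_nil _) rfl ih

lemma append_assoc {Zs Ws Us : List A} {a b c d : S} (p : LPath K Zs a b) (q : LPath K Ws b c)
    (r : LPath K Us c d) : HEq (append (append p q) r) (append p (append q r)) := by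
  induction p with
  | nil => rfl
  | cons f p ih => exact cons_heq (List.append_assoc _ _ _) rfl (ih q)

lemma flatten_append {Zss Wss : List (List A)} {a b c : S} (R : LPath (LPath K) Zss a b)
    (T : LPath (LPath K) Wss b c) :
    HEq (flatten (append R T)) (append (flatten R) (flatten T)) := by
  induction R with
  | nil => rfl
  | cons p R ih =>
    exact (append_heq rfl (by simp) HEq.rfl (ih T)).trans (append_assoc _ _ _).symm

lemma flatten_flatten {Z : List (List (List A))} {a b : S}
    (R : LPath (LPath (LPath K)) Z a b) :
    HEq (flatten (mapLabels List.flatten (fun _ _ _ r => flatten r) R))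
      (flatten (flatten R)) := by
  induction R with
  | nil => rfl
  | cons p R ih =>
    exact (append_heq rfl (flatten_map_flatten _) HEq.rfl ih).trans (flatten_append _ _).symm

lemma mapLabels_append (o : A → A') (g : ∀ Z a b, K Z a b → K' (o Z) a b) {Zs Ws : List A}
    {a b c : S} (p : LPath K Zs a b) (q : LPath K Ws b c) :
    HEq (mapLabels o g (append p q)) (append (mapLabels o g p) (mapLabels o g q)) := by
  induction p with
  | nil => rfl
  | cons f p ih => exact cons_heq List.map_append rfl (ih q)

lemma mapLabels_flatten (o : A → A') (g : ∀ Z a b, K Z a b → K' (o Z) a b)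
    {Zss : List (List A)} {a b : S} (R : LPath (LPath K) Zss a b) :
    HEq (flatten (mapLabels (List.map o) (fun _ _ _ p => mapLabels o g p) R))
      (mapLabels o g (flatten R)) := by
  induction R with
  | nil => rfl
  | cons p R ih =>
    exact (append_heq rfl (by simp) HEq.rfl ih).trans (mapLabels_append o g _ _).symm

lemma mapLabels_mapLabels {A'' : Type*} {K'' : A'' → S → S → Type*} (o : A → A')
    (g : ∀ Z a b, K Z a b → K' (o Z) a b) (o' : A' → A'')
    (g' : ∀ Z a b, K' Z a b → K'' (o' Z) a b) {Zs : List A} {a b : S} (p : LPath K Zs a b) :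
    HEq (mapLabels o' g' (mapLabels o g p))
      (mapLabels (fun Z => o' (o Z)) (fun _ _ _ f => g' _ _ _ (g _ _ _ f)) p) := by
  induction p with
  | nil => rfl
  | cons f p ih => exact cons_heq (List.map_map ..) rfl ih

lemma flatten_singletons {Zs : List A} {a b : S} (p : LPath K Zs a b) :
    HEq (flatten (mapLabels (K' := LPath K) (fun Z => [Z]) (fun _ _ b f => cons f (nil b)) p))
      p := by
  induction p with
  | nil => rfl
  | cons f p ih => exact cons_heq (flatten_map_singleton _) rfl ih

lemma seq_append {Zs Ws : List A} {a b c : S} (p : LPath K Zs a b) (q : LPath K Ws b c) :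
    seq (append p q) = Chain.append (seq p) (seq q) := by
  induction p with
  | nil => rfl
  | cons f p ih => exact congrArg (Chain.cons _) (ih q)

lemma seq_mapLabels (o : A → A') (g : ∀ Z a b, K Z a b → K' (o Z) a b) {Zs : List A} {a b : S}
    (p : LPath K Zs a b) : seq (mapLabels o g p) = seq p := by
  induction p with
  | nil => rfl
  | cons f p ih => exact congrArg (Chain.cons _) ih

lemma seq_mapObj {K' : A → S' → S' → Type v₃} (f : S → S')
    (g : ∀ Z a b, K Z a b → K' Z (f a) (f b)) {Zs : List A} {a b : S} (p : LPath K Zs a b) :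
    seq (mapObj f g p) = Chain.map f (fun _ _ _ => PUnit.unit) (seq p) := by
  induction p with
  | nil => rfl
  | cons h p ih => exact congrArg (Chain.cons _) ih

lemma seq_ofChain {J : S → S → Type w} {F : ∀ a b, J a b → A} (i : ∀ a b j, K (F a b j) a b)
    {a b : S} (p : Chain J a b) : seq (ofChain i p) = Chain.objSeq p := by
  induction p with
  | nil => rfl
  | cons j p ih => exact congrArg (Chain.cons _) ih

/-- The sequences of objects of the paths in a path of paths. -/
def nestedSeq : {Zss : List (List A)} → {a b : S} → LPath (LPath K) Zss a b →
    Chain (fun a b : S => ObjSeq a b) a b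
  | _, _, _, nil a => Chain.nil a
  | _, _, _, cons p R => Chain.cons (seq p) (nestedSeq R)

lemma seq_flatten {Zss : List (List A)} {a b : S} (R : LPath (LPath K) Zss a b) :
    seq (flatten R) = Chain.flatten (nestedSeq R) := by
  induction R with
  | nil => rfl
  | cons p R ih => exact (seq_append _ _).trans (congrArg _ ih)

lemma objSeq_nestedSeq {Zss : List (List A)} {a b : S} (R : LPath (LPath K) Zss a b) :
    Chain.objSeq (nestedSeq R) = seq R := by
  induction R with
  | nil => rfl
  | cons p R ih => exact congrArg (Chain.cons _) ih

end LPath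

/-! ### Paths in enriched graphs -/

variable {V : Type u} [Category.{w} V]

/-- Paths in a graph with homs `H`: sequences `a = x₀, …, xₙ = b` of objects with maps
`Zᵢ ⟶ H (xᵢ₋₁, xᵢ)`. -/
abbrev Path {S : Type w} (H : S → S → V) : List V → S → S → Type (max u w) :=
  LPath fun Z a b => Z ⟶ H a b

namespace Path

open LPath

variable {S S' S'' : Type w} {H : S → S → V} {H' : S' → S' → V} {H'' : S'' → S'' → V}

/-- Makes paths with given endpoints contravariant in the list, through maps of `M V`; the sequence
of objects is unchanged. The last two cases are void, as there are no maps between lists of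
different lengths. -/
def precomp : {Zs' Zs : List V} → {a b : S} → (Zs' ⟶ Zs) → Path H Zs a b → Path H Zs' a b
  | [], _, _, _, _, nil a => nil a
  | _ :: _, _, _, _, s, cons f p => cons (s.1 ≫ f) (precomp s.2 p)
  | [], _, _, _, s, cons _ _ => s.elim
  | _ :: _, _, _, _, s, nil _ => s.elim

/-- The maps of a path, as a map of sequences. -/
def hom : {Zs : List V} → {a b : S} → (p : Path H Zs a b) → (Zs ⟶ Chain.homs H p.seq)
  | _, _, _, nil _ => 𝟙 _
  | _, _, _, cons f p => seqCons f (hom p)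

/-- The image of a path under a graph map. -/
abbrev map {f : S → S'} (φ : ∀ a b, H a b ⟶ H' (f a) (f b)) {Zs : List V} {a b : S}
    (p : Path H Zs a b) : Path H' Zs (f a) (f b) :=
  mapObj (K' := fun Z a b => Z ⟶ H' a b) f (fun _ a b h => h ≫ φ a b) p

/-- The path on a given sequence of objects whose maps are identities. -/
abbrev ofSeq (H : S → S → V) {a b : S} (q : ObjSeq a b) : Path H (Chain.homs H q) a b :=
  ofChain (F := fun a b _ => H a b) (fun a b _ => 𝟙 (H a b)) q

lemma precomp_id {Zs : List V} {a b : S} (p : Path H Zs a b) : precomp (𝟙 Zs) p = p := by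
  induction p with
  | nil => rfl
  | cons f p ih => exact congrArg₂ cons (Category.id_comp f) ih

/-- Expresses transport along an equality of lists as a precomposition, which turns the `HEq` laws
of paths into equations of maps. -/
lemma precomp_eqToHom {Zs Zs' : List V} (h : Zs = Zs') {a b : S} {p : Path H Zs a b}
    {p' : Path H Zs' a b} (hp : HEq p p') : precomp (eqToHom h) p' = p := by
  subst h hp
  exact precomp_id p

lemma precomp_append {Zs' Zs Ws' Ws : List V} {a b c : S} (s : Zs' ⟶ Zs) (t : Ws' ⟶ Ws)
    (p : Path H Zs a b) (q : Path H Ws b c) :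
    precomp (seqAppend s t) (append p q) = append (precomp s p) (precomp t q) := by
  induction s using seqHom_induction generalizing a with
  | nil => cases p with | nil => rfl
  | cons f s ih => cases p with | cons g p => exact congrArg (cons _) (ih p)

lemma precomp_comp {Zs'' Zs' Zs : List V} {a b : S} (s : Zs'' ⟶ Zs') (t : Zs' ⟶ Zs)
    (p : Path H Zs a b) : precomp s (precomp t p) = precomp (s ≫ t) p := by
  induction s using seqHom_induction generalizing Zs a with
  | nil => cases Zs with
    | nil => cases p with | nil => rfl
    | cons => exact t.elim
  | cons f s ih => cases Zs with
    | nil => exact t.elim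
    | cons => cases p with
      | cons g p => exact congrArg₂ cons (Category.assoc _ _ _).symm (ih t.2 p)

lemma precomp_mapLabels {A : Type*} {K : A → S → S → Type*} {o o' : A → V}
    (α : ∀ Z, o Z ⟶ o' Z) (g : ∀ Z a b, K Z a b → (o' Z ⟶ H a b)) {Zs : List A} {a b : S}
    (p : LPath K Zs a b) :
    precomp (seqHomOfList α Zs) (mapLabels (K' := fun Z a b => Z ⟶ H a b) o' g p) =
      mapLabels (K' := fun Z a b => Z ⟶ H a b) o (fun Z a b f => α Z ≫ g Z a b f) p := by
  induction p with
  | nil => rfl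
  | cons f p ih => exact congrArg (cons _) ih

/-- A Yoneda-type reduction: every path is the restriction of an identity path along its own
sequence of maps. -/
lemma precomp_hom {Zs : List V} {a b : S} (p : Path H Zs a b) :
    precomp p.hom (ofSeq H p.seq) = p := by
  induction p with
  | nil => rfl
  | cons f p ih => exact congrArg₂ cons (Category.comp_id f) ih

lemma hom_precomp {Zs' Zs : List V} {a b : S} (s : Zs' ⟶ Zs) (p : Path H Zs a b) :
    (precomp s p).seq = p.seq ∧ HEq (hom (precomp s p)) (s ≫ p.hom) := by
  induction s using seqHom_induction generalizing a with
  | nil => cases p with | nil => exact ⟨rfl, HEq.rfl⟩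
  | cons f s ih => cases p with
    | cons g p =>
      obtain ⟨h, h'⟩ := ih p
      exact ⟨congrArg (Chain.cons _) h, seqCons_heq rfl rfl rfl (congrArg _ h) HEq.rfl h'⟩

lemma hom_map {f : S → S'} (φ : ∀ a b, H a b ⟶ H' (f a) (f b)) {Zs : List V} {a b : S}
    (p : Path H Zs a b) : HEq (hom (map φ p)) (p.hom ≫ Chain.labelsHom (F := fun a b _ => H a b)
      (F' := fun a b _ => H' a b) (J' := fun _ _ : S' => PUnit.{w + 1}) (f := f)
      (g := fun _ _ _ => PUnit.unit) (fun a b _ => φ a b) p.seq) := by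
  induction p with
  | nil => rfl
  | cons g p ih => exact seqCons_heq rfl rfl rfl (congrArg _ (seq_mapObj _ _ _)) HEq.rfl ih

lemma hom_ofChain {J : S → S → Type w} {F : ∀ a b, J a b → V} (i : ∀ a b j, F a b j ⟶ H a b)
    {a b : S} (p : Chain J a b) :
    HEq (hom (ofChain i p)) (Chain.labelsHom (F := F) (F' := fun a b _ => H a b)
      (J' := fun _ _ : S => PUnit.{w + 1}) (f := fun a => a) (g := fun _ _ _ => PUnit.unit) i p) := by
  induction p with
  | nil => rfl
  | cons j p ih => exact seqCons_heq rfl rfl rfl (congrArg _ (seq_ofChain _ _)) HEq.rfl ih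

lemma hom_append {Zs Ws : List V} {a b c : S} (p : Path H Zs a b) (q : Path H Ws b c) :
    HEq (hom (append p q)) (seqAppend p.hom q.hom) := by
  induction p with
  | nil => rfl
  | cons f p ih =>
    refine seqCons_heq rfl rfl rfl ?_ HEq.rfl (ih q)
    rw [seq_append]
    exact Chain.labels_append _ _ _

/-- The maps of a path of paths, as a map of sequences of sequences. -/
def nestedHom : {Zss : List (List V)} → {a b : S} → (R : LPath (Path H) Zss a b) →
    (Zss ⟶ Chain.labels (fun _ _ q => Chain.homs H q) R.nestedSeq)
  | _, _, _, nil _ => 𝟙 _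
  | _, _, _, cons p R => seqCons (hom p) (nestedHom R)

lemma hom_flatten {Zss : List (List V)} {a b : S} (R : LPath (Path H) Zss a b) :
    HEq (hom (flatten R)) (seqFlattenMap (nestedHom R)) := by
  induction R with
  | nil => rfl
  | cons p R ih =>
    refine (hom_append _ _).trans (seqAppend_heq rfl rfl rfl ?_ HEq.rfl ih)
    rw [seq_flatten]
    exact (Chain.labels_flatten _ _).symm

end Path

section

open LPath

variable {S : Type w} {H : S → S → V}

variable (H) in
/-- The path of paths on a given nested sequence of objects whose maps are identities. -/
abbrev Path.ofNestedSeq {a b : S} (r : Chain (fun a b : S => ObjSeq a b) a b) :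
    LPath (Path H) (Chain.labels (fun _ _ q => Chain.homs H q) r) a b :=
  ofChain (F := fun _ _ q => Chain.homs H q) (fun _ _ q => Path.ofSeq H q) r

/-- A graph with a path of given identity maps. -/
noncomputable def listGraph [HasTerminal V] (Zs : List V) : ULift.{w} ℕ → ULift.{w} ℕ → V :=
  fun i _ => (Zs[i.down]?).getD (⊤_ V)

/-- The vertices are natural numbers and every hom out of `i` is the entry of index `i`, so the
sequence `0, 1, …, n` reads off the list. The terminal object serves as default beyond the end of
the list, where this sequence never looks. -/
lemma exists_listGraph_path [HasTerminal V] (Zs : List V) :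
    ∃ (n m : ULift.{w} ℕ) (q : ObjSeq n m), Chain.homs (listGraph Zs) q = Zs := by
  -- The induction is on a suffix `Ws` of a fixed list; the prefix `Us` only records, by its length,
  -- the vertex from which to start.
  have key : ∀ (Ws Us Zs : List V), Zs = Us ++ Ws → ∃ (q : ObjSeq (ULift.up.{w} Us.length)
      (ULift.up.{w} (Us.length + Ws.length))), Chain.homs (listGraph Zs) q = Ws := by
    intro Ws
    induction Ws with
    | nil => exact fun Us Zs h => ⟨Chain.nil _, rfl⟩
    | cons W Ws ih =>
      intro Us Zs h
      obtain ⟨q, hq⟩ := ih (Us ++ [W]) Zs (by simp [h])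
      have e : Us.length + (W :: Ws).length = (Us ++ [W]).length + Ws.length := by
        simp only [List.length_cons, List.length_append, List.length_nil]
        omega
      rw [e]
      refine ⟨Chain.cons (b := ULift.up (Us ++ [W]).length) PUnit.unit q, ?_⟩
      have e' : listGraph Zs (ULift.up.{w} Us.length) (ULift.up.{w} (Us ++ [W]).length) = W := by
        simp [listGraph, h]
      exact congrArg₂ List.cons e' hq
  obtain ⟨q, hq⟩ := key Zs [] Zs rfl
  exact ⟨_, _, q, hq⟩

end

lemma map_eqToHom_comp_map_eqToHom {W : Type u₂} [Category.{v} W] (G : V ⥤ W) {X Y : V} {Z : W}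
    (h : X = Y) (h' : Y = X) (k : G.obj X ⟶ Z) :
    G.map (eqToHom h) ≫ G.map (eqToHom h') ≫ k = k := by
  subst h
  simp

/-! ### Maps into `Γ E` induced by paths. -/

section GammaPath

open LPath

variable [HasCoproducts.{w} V] (E : Multitensor V) {S S' S'' : Type w} {H : S → S → V}
  {H' : S' → S' → V}

/-- The map `E (Z₁, …, Zₙ) ⟶ Γ E H (a, b)` given by a path. -/
noncomputable def gammaPath {Zs : List V} {a b : S} (p : Path H Zs a b) :
    E.tensor.obj Zs ⟶ gammaHom E H a b :=
  E.tensor.map (Path.hom p) ≫ gammaι E H p.seq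

/-- The path of the maps `gammaPath E p`, for the paths `p` in a path of paths. -/
noncomputable abbrev gammaPaths {Zss : List (List V)} {a b : S} (R : LPath (Path H) Zss a b) :
    Path (gammaHom E H) (Zss.map E.tensor.obj) a b :=
  mapLabels E.tensor.obj (fun _ _ _ p => gammaPath E p) R

variable {E}

lemma map_gammaι_congr {Zs : List V} {a b : S} {q q' : ObjSeq a b} (h : q = q')
    {s : Zs ⟶ Chain.homs H q} {s' : Zs ⟶ Chain.homs H q'} (hs : HEq s s') :
    E.tensor.map s ≫ gammaι E H q = E.tensor.map s' ≫ gammaι E H q' := by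
  subst h hs
  rfl

lemma gammaPath_precomp {Zs' Zs : List V} {a b : S} (s : Zs' ⟶ Zs) (p : Path H Zs a b) :
    gammaPath E (Path.precomp s p) = E.tensor.map s ≫ gammaPath E p := by
  obtain ⟨h, h'⟩ := Path.hom_precomp s p
  refine (map_gammaι_congr h h').trans ?_
  rw [gammaPath, E.tensor.map_comp, Category.assoc]

lemma gammaPath_map {f : S → S'} (φ : ∀ a b, H a b ⟶ H' (f a) (f b)) {Zs : List V} {a b : S}
    (p : Path H Zs a b) :
    gammaPath E p ≫ gammaMap E φ a b = gammaPath E (Path.map φ p) := by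
  rw [gammaPath, Category.assoc, gammaι_gammaMap]
  refine Eq.trans ?_ (map_gammaι_congr (seq_mapObj _ _ _) (Path.hom_map φ p)).symm
  rw [E.tensor.map_comp, Category.assoc]

lemma gammaPath_ofChain {J : S → S → Type w} {F : ∀ a b, J a b → V}
    (i : ∀ a b j, F a b j ⟶ H a b) {a b : S} (p : Chain J a b) :
    gammaPath E (ofChain (K := fun Z a b => Z ⟶ H a b) i p) = gammaChainι E i p :=
  map_gammaι_congr (seq_ofChain _ _) (Path.hom_ofChain i p)

lemma gammaPath_ofSeq {a b : S} (q : ObjSeq a b) :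
    gammaPath E (Path.ofSeq H q) = gammaι E H q := by
  have e : Chain.objSeq q = q := Chain.map_id q
  rw [gammaPath_ofChain, gammaChainι]
  refine (map_gammaι_congr e (s' := 𝟙 _) ?_).trans ?_
  · exact Chain.labelsHom_id (fun a b _ => H a b) q
  · rw [E.tensor.map_id, Category.id_comp]

lemma gammaPath_unit {Z : V} {a b : S} (f : Z ⟶ H a b) :
    E.unit Z ≫ gammaPath E (cons f (nil b) : Path H [Z] a b) = f ≫ gammaη E H a b := by
  have h : gammaPath E (cons f (nil b) : Path H [Z] a b) =
      E.tensor.map (seqCons f (𝟙 [])) ≫ gammaιSingle E H a b := rfl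
  rw [h, ← Category.assoc, ← E.unit_naturality, Category.assoc]
  rfl

lemma hom_gammaPaths {Zss : List (List V)} {a b : S} (R : LPath (Path H) Zss a b) :
    HEq (Path.hom (gammaPaths E R)) (seqMapMap E.tensor (Path.nestedHom R) ≫
      eqToHom (Chain.list_map_labels _ _ _) ≫
      Chain.labelsHom (J' := fun _ _ : S => PUnit.{w + 1}) (f := fun a => a)
        (g := fun _ _ _ => PUnit.unit) (F := fun _ _ q => E.tensor.obj (Chain.homs H q))
        (F' := fun a b _ => gammaHom E H a b) (fun _ _ q => gammaι E H q) R.nestedSeq) := by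
  induction R with
  | nil => exact heq_of_eq (by rfl)
  | cons p R ih =>
    have e : ∀ (X : V) {Xs Ys : List V} (h : Xs = Ys), eqToHom (congrArg (List.cons X) h) =
        seqCons (𝟙 X) (eqToHom h) := by
      rintro X Xs _ rfl
      rfl
    have e' := e (E.tensor.obj (Chain.homs H p.seq))
      (Chain.list_map_labels (fun _ _ q => Chain.homs H q) E.tensor.obj R.nestedSeq)
    refine HEq.trans ?_ (heq_of_eq (congrArg (fun k => seqMapMap E.tensor
      (Path.nestedHom (cons p R)) ≫ k ≫ Chain.labelsHom (J' := fun _ _ : S => PUnit.{w + 1})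
        (f := fun a => a) (g := fun _ _ _ => PUnit.unit)
        (F := fun _ _ q => E.tensor.obj (Chain.homs H q))
        (F' := fun a b _ => gammaHom E H a b) (fun _ _ q => gammaι E H q)
        (nestedSeq (cons p R))) e').symm)
    refine seqCons_heq rfl rfl rfl ?_ (heq_of_eq ?_) ih
    · rw [seq_mapLabels, ← objSeq_nestedSeq]
    · exact congrArg (_ ≫ ·) (Category.id_comp _).symm

lemma gammaPath_gammaPaths {Zss : List (List V)} {a b : S} (R : LPath (Path H) Zss a b) :
    gammaPath E (gammaPaths E R) = E.tensor.map (seqMapMap E.tensor (Path.nestedHom R)) ≫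
      E.tensor.map (eqToHom (Chain.list_map_labels _ _ _)) ≫
      gammaChainι E (fun _ _ q => gammaι E H q) R.nestedSeq := by
  refine (map_gammaι_congr ?_ (hom_gammaPaths R)).trans ?_
  · exact (seq_mapLabels _ _ R).trans (objSeq_nestedSeq R).symm
  · rw [E.tensor.map_comp, E.tensor.map_comp, Category.assoc, Category.assoc]
    rfl

/-- The definition of `gammaμ` covers nested sequences of identities; naturality of `E.subst` along
`nestedHom` extends it to all paths of paths. From here on the multiplication is used in this form.
-/
lemma gammaPath_flatten (hE : E.IsDistributive) {Zss : List (List V)} {a b : S}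
    (R : LPath (Path H) Zss a b) :
    E.subst Zss ≫ gammaPath E (flatten R) =
      gammaPath E (gammaPaths E R) ≫ gammaμ E hE H a b := by
  have h2 := E.subst_naturality (Path.nestedHom R)
  have h3 : gammaPath E (flatten R) = E.tensor.map (seqFlattenMap (Path.nestedHom R)) ≫
      E.tensor.map (eqToHom (Chain.labels_flatten (fun a b _ => H a b) R.nestedSeq)) ≫
        gammaι E H (Chain.flatten R.nestedSeq) := by
    rw [← Category.assoc, ← E.tensor.map_comp]
    refine map_gammaι_congr (seq_flatten R) ((Path.hom_flatten R).trans ?_)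
    exact (comp_eqToHom_heq _ _).symm
  rw [h3, gammaPath_gammaPaths, Category.assoc, Category.assoc, gammaChainι_gammaμ₀,
    ← Category.assoc, ← h2, substChain]
  simp only [Category.assoc]
  refine congrArg (_ ≫ ·) ?_
  exact (map_eqToHom_comp_map_eqToHom _ _ _ _).symm

lemma gammaPath_gammaApp {A B : Multitensor V} (α : A ⟶ B) {Zs : List V} {a b : S}
    (p : Path H Zs a b) :
    gammaPath A p ≫ gammaApp α H a b = α.toNatTrans.app Zs ≫ gammaPath B p := by
  rw [gammaPath, Category.assoc, gammaι_gammaApp, ← Category.assoc, α.toNatTrans.naturality,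
    Category.assoc]
  rfl

/-- The identity paths among the `p` already give all coproduct injections. -/
lemma gammaPath_hom_ext {a b : S} {Z : V} {φ ψ : gammaHom E H a b ⟶ Z}
    (h : ∀ {Zs : List V} (p : Path H Zs a b), gammaPath E p ≫ φ = gammaPath E p ≫ ψ) : φ = ψ := by
  refine gamma_hom_ext E fun q => ?_
  rw [← gammaPath_ofSeq]
  exact h _

variable (E H) in
lemma isCoprod_gammaι (a b : S) : IsCoprod (fun q : ObjSeq a b => E.tensor.obj (Chain.homs H q))
    (gammaHom E H a b) (gammaι E H) :=
  isCoprod_sigma _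

lemma gammaPaths_ofNestedSeq {a b : S} (r : Chain (fun a b : S => ObjSeq a b) a b) :
    HEq (gammaPaths E (Path.ofNestedSeq H r)) (ofChain (K := fun Z a b => Z ⟶ gammaHom E H a b)
      (F := fun _ _ q => E.tensor.obj (Chain.homs H q)) (fun _ _ q => gammaι E H q) r) := by
  induction r with
  | nil => rfl
  | cons q r ih => exact cons_heq (Chain.list_map_labels _ _ _) (gammaPath_ofSeq q) ih

lemma gammaPath_heq {Zs Zs' : List V} (h : Zs = Zs') {a b : S} {p : Path H Zs a b}
    {p' : Path H Zs' a b} (hp : HEq p p') :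
    E.tensor.map (eqToHom h) ≫ gammaPath E p' = gammaPath E p := by
  rw [← gammaPath_precomp, Path.precomp_eqToHom h hp]

variable (H) in
-- This is `gammaChain_isColimit`, rewritten along an equality of lists so that the injections are
-- in the form to which `gammaPath_flatten` applies.
lemma isCoprod_gammaPaths (hE : E.IsDistributive) (a b : S) :
    IsCoprod (fun r : Chain (fun a b : S => ObjSeq a b) a b => E.tensor.obj
      ((Chain.labels (fun _ _ q => Chain.homs H q) r).map E.tensor.obj))
      (gammaHom E (gammaHom E H) a b)
      (fun r => gammaPath E (gammaPaths E (Path.ofNestedSeq H r))) := by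
  have h := IsCoprod.of_isColimit
    (gammaChain_isColimit hE (fun _ _ q => gammaι E H q) (gamma_isColimit H) a b).some
  have h' := h.iso_comp (fun r => E.tensor.map (eqToHom
    (Chain.list_map_labels (fun _ _ q => Chain.homs H q) E.tensor.obj r)))
  convert h' using 2 with r
  rw [← gammaPath_ofChain]
  exact (gammaPath_heq _ (gammaPaths_ofNestedSeq r)).symm

/-- For each list `Z` there is a path which induces a monomorphism out of `E Z`. -/
lemma exists_mono_gammaPath [HasFiniteLimits V] (hV : IsExtensive V) (Zs : List V) :
    ∃ (S : Type w) (H : S → S → V) (a b : S) (p : Path H Zs a b),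
      ∀ E : Multitensor V, Mono (gammaPath E p) := by
  obtain ⟨n, m, q, hq⟩ := exists_listGraph_path Zs
  have : ∃ p : Path (listGraph Zs) Zs n m, HEq p (Path.ofSeq (listGraph Zs) q) := by
    have : ∀ {Zs Ws : List V} {H : ULift.{w} ℕ → ULift.{w} ℕ → V} (h : Ws = Zs)
        (p' : Path H Ws n m), ∃ p : Path H Zs n m, HEq p p' := by
      rintro Zs _ H rfl p
      exact ⟨p, HEq.rfl⟩
    exact this hq _
  obtain ⟨p, hp⟩ := this
  refine ⟨_, _, n, m, p, fun E => ?_⟩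
  -- Up to an isomorphism of lists, `gammaPath E p` is now a coproduct injection. The path was
  -- chosen before `E`, so it serves all multitensors at once.
  rw [← gammaPath_heq hq.symm hp, gammaPath_ofSeq]
  have := hV.mono_inj (isCoprod_gammaι E (listGraph Zs) n m) q
  exact mono_comp _ _

end GammaPath

/-! ### Pullbacks of sequences -/

section SeqPullbacks

variable {V : Type u} [Category.{v} V]

lemma eqToHom_cons (X : V) {Xs Ys : List V} (h : X :: Xs = X :: Ys) :
    eqToHom h = seqCons (𝟙 X) (eqToHom (List.cons.inj h).2) := by
  obtain rfl : Xs = Ys := (List.cons.inj h).2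
  rfl

lemma isPullback_seqNil (f g h k : ([] : List V) ⟶ []) : IsPullback f g h k :=
  (IsPullback.of_vert_isIso (snd := 𝟙 _) (f := 𝟙 _) ⟨rfl⟩ : IsPullback f (𝟙 _) (𝟙 _) k)

lemma isPullback_seqCons {P X Y Z : V} {Ps Xs Ys Zs : List V} {a : P ⟶ X} {b : P ⟶ Y}
    {f : X ⟶ Z} {g : Y ⟶ Z} {as : Ps ⟶ Xs} {bs : Ps ⟶ Ys} {fs : Xs ⟶ Zs} {gs : Ys ⟶ Zs}
    (h : IsPullback a b f g) (hs : IsPullback as bs fs gs) :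
    IsPullback (seqCons a as) (seqCons b bs) (seqCons f fs) (seqCons g gs) := by
  refine IsPullback.mk' (Prod.ext h.w hs.w) ?_ ?_
  · intro T φ φ' h₁ h₂
    cases T with
    | nil => exact φ.elim
    | cons T Ts =>
      exact Prod.ext (h.hom_ext (congrArg Prod.fst h₁) (congrArg Prod.fst h₂))
        (hs.hom_ext (congrArg Prod.snd h₁) (congrArg Prod.snd h₂))
  · intro T φ φ' w
    cases T with
    | nil => exact φ.elim
    | cons T Ts =>
      obtain ⟨l, h₁, h₂⟩ := h.exists_lift φ.1 φ'.1 (congrArg Prod.fst w)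
      obtain ⟨ls, hs₁, hs₂⟩ := hs.exists_lift φ.2 φ'.2 (congrArg Prod.snd w)
      exact ⟨seqCons l ls, Prod.ext h₁ hs₁, Prod.ext h₂ hs₂⟩

lemma isPullback_of_heq {P X Y Z P' X' Y' Z' : V} {a : P ⟶ X} {b : P ⟶ Y} {f : X ⟶ Z}
    {g : Y ⟶ Z} {a' : P' ⟶ X'} {b' : P' ⟶ Y'} {f' : X' ⟶ Z'} {g' : Y' ⟶ Z'}
    (h : IsPullback a b f g) (hP : P = P') (hX : X = X') (hY : Y = Y') (hZ : Z = Z')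
    (ha : HEq a a') (hb : HEq b b') (hf : HEq f f') (hg : HEq g g') : IsPullback a' b' f' g' := by
  subst hP hX hY hZ ha hb hf hg
  exact h

end SeqPullbacks

/-! ### Sequences of objects as lists -/

namespace Chain

variable {S S' : Type w}

/-- The objects `x₁, …, xₙ` of a sequence `x₀, …, xₙ`. -/
def verts {a b : S} (q : ObjSeq a b) : List S := labels (fun _ b _ => b) q

abbrev mapSeq (f : S → S') {a b : S} (q : ObjSeq a b) : ObjSeq (f a) (f b) :=
  map (J' := fun _ _ : S' => PUnit.{w + 1}) f (fun _ _ _ => PUnit.unit) q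

lemma verts_map (f : S → S') {a b : S} (q : ObjSeq a b) :
    verts (mapSeq f q) = (verts q).map f :=
  (labels_map (fun _ b _ => b) q).trans (list_map_labels (fun _ b _ => b) f q).symm

lemma mapSeq_mapSeq {S'' : Type w} (f : S → S') (f' : S' → S'') {a b : S} (q : ObjSeq a b) :
    mapSeq f' (mapSeq f q) = mapSeq (fun a => f' (f a)) q :=
  map_map (J' := fun _ _ : S' => PUnit.{w + 1}) (J'' := fun _ _ : S'' => PUnit.{w + 1}) q

/-- A sequence with a given start is the same thing as a list, and its endpoint can be read off.
Questions on sequences, whose types mention both endpoints, can thus be settled for plain lists. -/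
lemma eq_of_verts_eq {a b b' : S} (q : ObjSeq a b) (q' : ObjSeq a b') (h : verts q = verts q') :
    b = b' ∧ HEq q q' := by
  induction q with
  | nil => cases q' with
    | nil => exact ⟨rfl, HEq.rfl⟩
    | cons => exact absurd h (List.cons_ne_nil _ _).symm
  | cons j q ih => cases q' with
    | nil => exact absurd h (List.cons_ne_nil _ _)
    | cons j' q' =>
      obtain ⟨rfl, h⟩ := List.cons.inj h
      obtain ⟨rfl, h⟩ := ih q' h
      cases h
      exact ⟨rfl, HEq.rfl⟩

lemma verts_injective {a b : S} {q q' : ObjSeq a b} (h : verts q = verts q') : q = q' :=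
  eq_of_heq (eq_of_verts_eq q q' h).2

lemma exists_verts_eq (a : S) (l : List S) : ∃ (b : S) (q : ObjSeq a b), verts q = l := by
  induction l generalizing a with
  | nil => exact ⟨a, nil a, rfl⟩
  | cons c l ih =>
    obtain ⟨b, q, rfl⟩ := ih c
    exact ⟨b, cons PUnit.unit q, rfl⟩

/-- Since `f` acts vertex by vertex, any cut of the image sequence comes from a cut of `q` itself.
-/
lemma exists_append_eq (f : S → S') {a b : S} (q : ObjSeq a b) {l l' : List S'}
    (h : (verts q).map f = l ++ l') : ∃ (c : S) (q₁ : ObjSeq a c) (q₂ : ObjSeq c b),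
      append q₁ q₂ = q ∧ (verts q₁).map f = l ∧ (verts q₂).map f = l' := by
  induction l generalizing a with
  | nil => exact ⟨a, nil a, q, rfl, rfl, h⟩
  | cons x l ih => cases q with
    | nil => exact absurd h (List.cons_ne_nil _ _).symm
    | cons j q =>
      obtain ⟨h₁, h₂⟩ := List.cons.inj h
      obtain ⟨c, q₁, q₂, rfl, h₃, h₄⟩ := ih q h₂
      exact ⟨c, cons j q₁, q₂, rfl, congrArg₂ List.cons h₁ h₃, h₄⟩

/-- The objects of a nested sequence. -/
def nestedVerts {a b : S} (r : Chain (fun a b : S => ObjSeq a b) a b) : List (List S) :=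
  labels (fun _ _ q => verts q) r

abbrev mapNested (f : S → S') {a b : S} (r : Chain (fun a b : S => ObjSeq a b) a b) :
    Chain (fun a b : S' => ObjSeq a b) (f a) (f b) :=
  map f (fun _ _ q => mapSeq f q) r

lemma nestedVerts_map (f : S → S') {a b : S} (r : Chain (fun a b : S => ObjSeq a b) a b) :
    nestedVerts (mapNested f r) = (nestedVerts r).map (List.map f) := by
  induction r with
  | nil => rfl
  | cons q r ih => exact congrArg₂ List.cons (verts_map f q) ih

lemma verts_flatten {a b : S} (r : Chain (fun a b : S => ObjSeq a b) a b) :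
    verts (flatten r) = (nestedVerts r).flatten :=
  (labels_flatten (fun _ b _ => b) r).symm

lemma nestedVerts_injective {a b : S} {r r' : Chain (fun a b : S => ObjSeq a b) a b}
    (h : nestedVerts r = nestedVerts r') : r = r' := by
  induction r with
  | nil => cases r' with
    | nil => rfl
    | cons => exact absurd h (List.cons_ne_nil _ _).symm
  | cons q r ih => cases r' with
    | nil => exact absurd h (List.cons_ne_nil _ _)
    | cons q' r' =>
      obtain ⟨h₁, h₂⟩ := List.cons.inj h
      obtain ⟨rfl, h₁⟩ := eq_of_verts_eq q q' h₁
      exact congrArg₂ cons (eq_of_heq h₁) (ih h₂)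

lemma exists_flatten_eq (f : S → S') {a b : S} (q : ObjSeq a b) {L : List (List S')}
    (h : (verts q).map f = L.flatten) : ∃ r : Chain (fun a b : S => ObjSeq a b) a b,
      flatten r = q ∧ (nestedVerts r).map (List.map f) = L := by
  induction L generalizing a with
  | nil => cases q with
    | nil => exact ⟨nil _, rfl, rfl⟩
    | cons => exact absurd h (List.cons_ne_nil _ _)
  | cons l L ih =>
    obtain ⟨c, q₁, q₂, rfl, h₁, h₂⟩ := exists_append_eq f q (h.trans List.flatten_cons)
    obtain ⟨r, rfl, h₃⟩ := ih q₂ h₂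
    exact ⟨cons q₁ r, rfl, congrArg₂ List.cons h₁ h₃⟩

/-- A nested list is determined by its concatenation and by the lengths of its blocks, and
`mapNested f` preserves those lengths. With `exists_nested` this says that concatenation of
sequences is cartesian in the set of objects. -/
lemma nested_ext (f : S → S') {a b : S} {r r' : Chain (fun a b : S => ObjSeq a b) a b}
    (h : mapNested f r = mapNested f r') (h' : flatten r = flatten r') : r = r' := by
  refine nestedVerts_injective (List.eq_iff_flatten_eq.2 ⟨?_, ?_⟩)
  · rw [← verts_flatten, ← verts_flatten, h']
  · have e : ∀ r : Chain (fun a b : S => ObjSeq a b) a b, (nestedVerts r).map List.length =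
        (nestedVerts (mapNested f r)).map List.length := fun r => by
      rw [nestedVerts_map, List.map_map]
      exact List.map_congr_left fun l _ => (List.length_map f).symm
    rw [e, e, h]

/-- The bracketing of `r'` is copied onto `q`, which has as many vertices. -/
lemma exists_nested (f : S → S') {a b : S} (r' : Chain (fun a b : S' => ObjSeq a b) (f a) (f b))
    (q : ObjSeq a b) (h : flatten r' = mapSeq f q) :
    ∃ r : Chain (fun a b : S => ObjSeq a b) a b, mapNested f r = r' ∧ flatten r = q := by
  obtain ⟨r, h₁, h₂⟩ := exists_flatten_eq f q (L := nestedVerts r')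
    (by rw [← verts_flatten, h, verts_map])
  exact ⟨r, nestedVerts_injective ((nestedVerts_map f r).trans h₂), h₁⟩

/-! ### Sequences of objects in a pullback of sets. -/

section Pairs

variable {S R : S' → Type w}

/-- The projections of a pullback of sets over `S'`. -/
abbrev sigmaFst (x : Σ z, S z × R z) : Σ z, S z := ⟨x.1, x.2.1⟩

abbrev sigmaSnd (x : Σ z, S z × R z) : Σ z, R z := ⟨x.1, x.2.2⟩

lemma sigma_pair_ext {x y : Σ z, S z × R z} (h : sigmaFst x = sigmaFst y)
    (h' : sigmaSnd x = sigmaSnd y) : x = y := by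
  obtain ⟨z, s, r⟩ := x
  obtain ⟨z', s', r'⟩ := y
  cases h
  cases h'
  rfl

lemma exists_list_pair (l : List (Σ z, S z)) (l' : List (Σ z, R z))
    (h : l.map Sigma.fst = l'.map Sigma.fst) :
    ∃ k : List (Σ z, S z × R z), k.map sigmaFst = l ∧ k.map sigmaSnd = l' := by
  induction l generalizing l' with
  | nil => cases l' with
    | nil => exact ⟨[], rfl, rfl⟩
    | cons => exact absurd h (List.cons_ne_nil _ _).symm
  | cons x l ih => cases l' with
    | nil => exact absurd h (List.cons_ne_nil _ _)
    | cons y l' =>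
      obtain ⟨h₁, h₂⟩ := List.cons.inj h
      obtain ⟨k, rfl, rfl⟩ := ih l' h₂
      obtain ⟨z, s⟩ := x
      obtain ⟨z', r⟩ := y
      cases h₁
      exact ⟨⟨z, s, r⟩ :: k, rfl, rfl⟩

lemma list_pair_ext {k k' : List (Σ z, S z × R z)} (h : k.map sigmaFst = k'.map sigmaFst)
    (h' : k.map sigmaSnd = k'.map sigmaSnd) : k = k' := by
  induction k generalizing k' with
  | nil => exact (List.map_eq_nil_iff.1 h.symm).symm
  | cons x k ih => cases k' with
    | nil => exact absurd h (List.cons_ne_nil _ _)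
    | cons y k' =>
      obtain ⟨h₁, h₂⟩ := List.cons.inj h
      obtain ⟨h₁', h₂'⟩ := List.cons.inj h'
      exact congrArg₂ List.cons (sigma_pair_ext h₁ h₁') (ih h₂ h₂')

lemma pair_ext {x y : Σ z, S z × R z} {k k' : ObjSeq x y}
    (h : mapSeq sigmaFst k = mapSeq sigmaFst k') (h' : mapSeq sigmaSnd k = mapSeq sigmaSnd k') :
    k = k' := by
  refine verts_injective (list_pair_ext ?_ ?_)
  · rw [← verts_map, ← verts_map, h]
  · rw [← verts_map, ← verts_map, h']

/-- Together with `pair_ext`: forming sequences of objects preserves pullbacks of object sets,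
because forming lists does. -/
lemma exists_pair {x y : Σ z, S z × R z} (i : ObjSeq (sigmaFst x) (sigmaFst y))
    (j : ObjSeq (sigmaSnd x) (sigmaSnd y)) (h : mapSeq Sigma.fst i = mapSeq Sigma.fst j) :
    ∃ k : ObjSeq x y, mapSeq sigmaFst k = i ∧ mapSeq sigmaSnd k = j := by
  obtain ⟨l, h₁, h₂⟩ := exists_list_pair (verts i) (verts j)
    ((verts_map _ i).symm.trans ((congrArg verts h).trans (verts_map _ j)))
  -- The lifted list of vertices starts at `x` and ends at some `y'`, which must be `y` because both
  -- of its projections are those of `y`.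
  obtain ⟨y', k, rfl⟩ := exists_verts_eq x l
  obtain ⟨e₁, h₁⟩ := eq_of_verts_eq (mapSeq sigmaFst k) i ((verts_map _ k).trans h₁)
  obtain ⟨e₂, h₂⟩ := eq_of_verts_eq (mapSeq sigmaSnd k) j ((verts_map _ k).trans h₂)
  obtain rfl := sigma_pair_ext e₁ e₂
  exact ⟨k, eq_of_heq h₁, eq_of_heq h₂⟩

end Pairs

end Chain

/-! ### Cartesian multitensors and the monads `Γ E` -/

variable {V : Type u} [Category.{w} V]

section

open Chain

variable {S' : Type w} {S R : S' → Type w} {H' : S' → S' → V}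
  {K : (Σ z, S z × R z) → (Σ z, S z × R z) → V}
  {L : (Σ z, S z) → (Σ z, S z) → V} {M : (Σ z, R z) → (Σ z, R z) → V}

/-- Pullbacks in `M V` are formed entry by entry. The equalities `e` and `e'` bring both legs to one
codomain, since the two composite images of `k` in `S'` are not syntactically the same; they remain
hypotheses so that the induction can hand them to the tail. -/
lemma isPullback_labelsHom {π : ∀ x y, K x y ⟶ L (sigmaFst x) (sigmaFst y)}
    {ρ : ∀ x y, K x y ⟶ M (sigmaSnd x) (sigmaSnd y)} {φ : ∀ x y, L x y ⟶ H' x.1 y.1}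
    {ψ : ∀ x y, M x y ⟶ H' x.1 y.1}
    (h : ∀ x y, IsPullback (π x y) (ρ x y) (φ (sigmaFst x) (sigmaFst y))
      (ψ (sigmaSnd x) (sigmaSnd y))) {x y : Σ z, S z × R z} (k : ObjSeq x y)
    (e : homs H' (mapSeq Sigma.fst (mapSeq sigmaFst k)) = homs H' (mapSeq Sigma.fst k))
    (e' : homs H' (mapSeq Sigma.fst (mapSeq sigmaSnd k)) = homs H' (mapSeq Sigma.fst k)) :
    IsPullback
      (labelsHom (F := fun x y _ => K x y) (F' := fun x y _ => L x y)
        (J' := fun _ _ : Σ z, S z => PUnit.{w + 1}) (f := sigmaFst)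
        (g := fun _ _ _ => PUnit.unit) (fun x y _ => π x y) k)
      (labelsHom (F := fun x y _ => K x y) (F' := fun x y _ => M x y)
        (J' := fun _ _ : Σ z, R z => PUnit.{w + 1}) (f := sigmaSnd)
        (g := fun _ _ _ => PUnit.unit) (fun x y _ => ρ x y) k)
      (labelsHom (F := fun x y _ => L x y) (F' := fun x y _ => H' x y)
        (J' := fun _ _ : S' => PUnit.{w + 1}) (f := Sigma.fst)
        (g := fun _ _ _ => PUnit.unit) (fun x y _ => φ x y) (mapSeq sigmaFst k) ≫ eqToHom e)
      (labelsHom (F := fun x y _ => M x y) (F' := fun x y _ => H' x y)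
        (J' := fun _ _ : S' => PUnit.{w + 1}) (f := Sigma.fst)
        (g := fun _ _ _ => PUnit.unit) (fun x y _ => ψ x y) (mapSeq sigmaSnd k) ≫ eqToHom e') := by
  induction k with
  | nil => exact isPullback_seqNil _ _ _ _
  | cons j k ih =>
    exact isPullback_of_heq (isPullback_seqCons (h _ _)
      (ih (List.cons.inj e).2 (List.cons.inj e').2)) rfl rfl rfl rfl HEq.rfl HEq.rfl
      (heq_of_eq ((congrArg (_ ≫ ·) (eqToHom_cons _ e)).trans
        (congrArg (seqCons · _) (Category.comp_id _))).symm)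
      (heq_of_eq ((congrArg (_ ≫ ·) (eqToHom_cons _ e')).trans
        (congrArg (seqCons · _) (Category.comp_id _))).symm)

end

section

variable [HasCoproducts.{w} V] (hV : IsExtensive V) {A E : Multitensor V}

include hV in
-- Naturality squares of `α` at injections are pullbacks, so the candidate coproduct for `A` is the
-- pullback of one for `E`, and extensivity makes it a coproduct.
lemma Multitensor.IsDistributive.of_equifibered (hE : E.IsDistributive) (α : A ⟶ E)
    (hα : NatTrans.Equifibered α.toNatTrans) : A.IsDistributive := by
  intro Xs Ys I
  refine preservesColimitsOfShape_discrete _ fun X => ⟨∐ X, Sigma.ι X, isCoprod_sigma X, ?_⟩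
  have := hE Xs Ys I
  exact hV.isCoprod_of_isPullback ((isCoprod_sigma X).map (seqInsert Xs Ys ⋙ E.tensor))
    (α.toNatTrans.app _) fun i => hα ((seqInsert Xs Ys).map (Sigma.ι X i))

variable {S S' : Type w} {H : S → S → V} {H' : S' → S' → V}

include hV in
lemma mono_gammaι {a b : S} (q : ObjSeq a b) : Mono (gammaι E H q) :=
  hV.mono_inj (isCoprod_gammaι E H a b) q

include hV in
lemma isPullback_gammaι (α : A ⟶ E) {a b : S} (q : ObjSeq a b) :
    IsPullback (gammaι A H q) (α.toNatTrans.app (Chain.homs H q)) (gammaApp α H a b)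
      (gammaι E H q) :=
  hV.isPullback_of_isCoprod (isCoprod_gammaι E H a b) (isCoprod_gammaι A H a b)
    (f := fun q => α.toNatTrans.app (Chain.homs H q)) (fun q => gammaι_gammaApp α H q) q

include hV in
-- The naturality square of `α` at the maps of `p` is pasted with the square of a coproduct
-- injection. For the path in the terminal graph, this recovers `A Zs` from `Γ A` over `Γ E`.
lemma isPullback_gammaPath (α : A ⟶ E) (hα : NatTrans.Equifibered α.toNatTrans) {Zs : List V}
    {a b : S} (p : Path H Zs a b) :
    IsPullback (gammaPath A p) (α.toNatTrans.app Zs) (gammaApp α H a b) (gammaPath E p) :=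
  (hα p.hom).paste_horiz (isPullback_gammaι hV α p.seq)

include hV in
-- `Γ α` does not move the sequence of objects, so the square of index sets is trivially a pullback
-- and only naturality squares of `α` remain.
lemma isPullback_gammaApp [HasFiniteLimits V] (α : A ⟶ E)
    (hα : NatTrans.Equifibered α.toNatTrans) {f : S → S'}
    (φ : ∀ a b, H a b ⟶ H' (f a) (f b)) (a b : S) :
    IsPullback (gammaMap A φ a b) (gammaApp α H a b) (gammaApp α H' (f a) (f b))
      (gammaMap E φ a b) := by
  refine hV.isPullback_coprod (isCoprod_gammaι A H a b) (isCoprod_gammaι A H' _ _)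
    (isCoprod_gammaι E H a b) (isCoprod_gammaι E H' _ _) (r := Chain.mapSeq f) (s := fun q => q)
    (r' := fun q => q) (s' := Chain.mapSeq f) (fun q => gammaι_gammaMap φ q)
    (fun q => gammaι_gammaApp α H q) (fun q => gammaι_gammaApp α H' q)
    (fun q => gammaι_gammaMap φ q) (fun q => ?_) (fun _ _ _ h => h)
    (fun i j h => ⟨j, h.symm, rfl⟩)
  have := mono_gammaι hV (E := E) (H := H') (Chain.mapSeq f q)
  exact IsExtensive.isPullback_of_mono (hα _) (gammaι E H' (Chain.mapSeq f q))
    (gammaι_gammaApp α H' _) (gammaι_gammaMap φ q)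

include hV in
lemma equifibered_gammaHomMap [HasFiniteLimits V] (hA : A.IsDistributive)
    (hE : E.IsDistributive) (α : A ⟶ E) (hα : NatTrans.Equifibered α.toNatTrans) :
    NatTrans.Equifibered (MonadHom.toNatTrans
      (MonadOverSetHom.toMonadHom (gammaHomMap hA hE α))) := by
  rintro X Y ⟨f, φ⟩
  exact EGraph.isPullback_ofHoms_iff.2 (isPullback_gammaApp hV α hα φ)

lemma length_verts_single {a b : S} {q : ObjSeq a b} (h : (Chain.verts q).length = 1) :
    q = Chain.single PUnit.unit := by
  cases q with
  | nil => exact absurd h (by simp [Chain.verts, Chain.labels])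
  | cons j q => cases q with
    | nil => rfl
    | cons => exact absurd h (by simp [Chain.verts, Chain.labels])

include hV in
-- The square of `E.unit` is pasted with that of the inclusion of the sequence `a, b`. The latter is
-- a pullback on index sets because a sequence whose image under `f` has length one has length one
-- itself.
lemma isPullback_gammaη [HasFiniteLimits V] (hc : E.IsCartesian) {f : S → S'}
    (φ : ∀ a b, H a b ⟶ H' (f a) (f b)) (a b : S) :
    IsPullback (φ a b) (gammaη E H a b) (gammaη E H' (f a) (f b)) (gammaMap E φ a b) := by
  refine (hc.unit (φ a b)).paste_vert ?_
  have := mono_gammaι hV (E := E) (H := H') (Chain.single (a := f a) (b := f b) PUnit.unit)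
  -- The sources of the inclusions are regarded as coproducts with one summand.
  refine hV.isPullback_coprod (isCoprod_id.{w} _) (isCoprod_id.{w} _)
    (isCoprod_gammaι E H a b) (isCoprod_gammaι E H' _ _) (r := fun _ => PUnit.unit)
    (s := fun _ => Chain.single PUnit.unit)
    (r' := fun _ => Chain.single PUnit.unit) (s' := Chain.mapSeq f)
    (pk := fun _ => E.tensor.map (seqCons (φ a b) (𝟙 []))) (qk := fun _ => 𝟙 _)
    (fi := fun _ => 𝟙 _)
    (fun q => (Category.id_comp _).trans (Category.comp_id _).symm)
    (fun q => rfl) (fun q => rfl)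
    (fun q => gammaι_gammaMap φ q) (fun q => ?_) (fun _ _ _ _ => rfl) (fun i j h => ?_)
  · refine IsExtensive.isPullback_of_mono (IsPullback.of_vert_isIso (snd := 𝟙 _) (f := 𝟙 _) ⟨?_⟩)
      (gammaι E H' (Chain.single (a := f a) (b := f b) PUnit.unit)) rfl (gammaι_gammaMap φ _)
    exact (Category.comp_id _).trans (Category.id_comp _).symm
  · refine ⟨PUnit.unit, rfl, (length_verts_single ?_).symm⟩
    rw [← List.length_map f, ← Chain.verts_map, ← h]
    rfl

include hV in
-- On index sets this is `nested_ext` and `exists_nested`; on summands it is a naturality square of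
-- `E.subst`, at the map of lists of lists given by `φ`.
lemma isPullback_gammaμ [HasFiniteLimits V] (hE : E.IsDistributive) (hc : E.IsCartesian)
    {f : S → S'} (φ : ∀ a b, H a b ⟶ H' (f a) (f b)) (a b : S) :
    IsPullback (gammaMap E (gammaMap E φ) a b) (gammaμ E hE H a b) (gammaμ E hE H' (f a) (f b))
      (gammaMap E φ a b) := by
  refine hV.isPullback_coprod
    (.of_isColimit (gammaChain_isColimit hE (fun _ _ q => gammaι E H q) (gamma_isColimit H) a b).some)
    (.of_isColimit
      (gammaChain_isColimit hE (fun _ _ q => gammaι E H' q) (gamma_isColimit H') (f a) (f b)).some)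
    (isCoprod_gammaι E H a b) (isCoprod_gammaι E H' _ _) (r := Chain.mapNested f)
    (s := Chain.flatten) (r' := Chain.flatten) (s' := Chain.mapSeq f)
    (fun r => gammaChainι_gammaMap (E := E) (J' := fun a b : S' => ObjSeq a b)
      (f := f) (g := fun _ _ q => Chain.mapSeq f q) (fun a b => gammaMap E φ a b)
      (fun _ _ q => gammaι E H q) (fun _ _ q => gammaι E H' q)
      (fun _ _ q => E.tensor.map (Chain.labelsHom (F' := fun a b _ => H' a b) (fun a b _ => φ a b) q))
      (fun _ _ q => gammaι_gammaMap φ q) r)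
    (fun r => gammaChainι_gammaμ₀ hE H r) (fun r => gammaChainι_gammaμ₀ hE H' r)
    (fun q => gammaι_gammaMap φ q) (fun r => ?_) (fun _ _ h h' => Chain.nested_ext f h h')
    (Chain.exists_nested f)
  have e : Chain.flatten (Chain.mapNested f r) = Chain.mapSeq f (Chain.flatten r) :=
    Chain.map_flatten r
  have e' := congrArg (Chain.homs H') e
  have := mono_gammaι hV (E := E) (H := H') (Chain.mapSeq f (Chain.flatten r))
  refine IsExtensive.isPullback_of_mono (f := substChain E (fun a b _ => H' a b)
    (Chain.mapNested f r) ≫ E.tensor.map (eqToHom e')) ?_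
    (gammaι E H' (Chain.mapSeq f (Chain.flatten r))) ?_ (gammaι_gammaMap φ _)
  · set h := Chain.labelsHom (F := fun _ _ q => Chain.homs H q)
      (F' := fun _ _ q => Chain.homs H' q) (f := f) (g := fun _ _ q => Chain.mapSeq f q)
      (fun _ _ q => Chain.labelsHom (fun a b _ => φ a b) q) r with hh
    have hp : IsPullback (E.tensor.map (seqMapMap E.tensor h)) (E.subst _) (E.subst _)
      (E.tensor.map (seqFlattenMap h)) := hc.subst h
    refine isPullback_of_heq hp
      (congrArg E.tensor.obj (Chain.list_map_labels _ _ _))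
      (congrArg E.tensor.obj (Chain.list_map_labels _ _ _))
      (congrArg E.tensor.obj (Chain.labels_flatten _ _))
      (congrArg E.tensor.obj ((Chain.labels_flatten _ _).trans e'))
      (map_heq E.tensor (Chain.list_map_labels _ _ _) (Chain.list_map_labels _ _ _)
        (Chain.seqMapMap_labelsHom _ _ _))
      (substChain_heq _ _).symm
      ((substChain_heq _ _).symm.trans (heq_map_eqToHom _ _ _).symm)
      (map_heq E.tensor (Chain.labels_flatten _ _) ((Chain.labels_flatten _ _).trans e')
        (Chain.seqFlattenMap_labelsHom _ _))
  · refine (gammaChainι_gammaμ₀ hE H' _).trans (Eq.trans ?_ (Category.assoc _ _ _).symm)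
    refine congrArg (_ ≫ ·) ?_
    refine Eq.trans ?_ (map_gammaι_congr e (s := 𝟙 _) (comp_eqToHom_heq (𝟙 _) e').symm |>.trans ?_)
    · rw [E.tensor.map_id]
      exact (Category.id_comp _).symm
    · rw [Category.id_comp]

section Pairs

open Chain

variable {S R : S' → Type w} {H' : S' → S' → V} {K : (Σ z, S z × R z) → (Σ z, S z × R z) → V}
  {L : (Σ z, S z) → (Σ z, S z) → V} {M : (Σ z, R z) → (Σ z, R z) → V}

include hV in
-- On index sets this is `pair_ext` and `exists_pair`; on summands it is preservation of pullbacks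
-- by `E`, applied to an entrywise pullback of sequences.
lemma isPullback_gammaMap [HasFiniteLimits V] (hc : E.IsCartesian)
    {π : ∀ x y, K x y ⟶ L (sigmaFst x) (sigmaFst y)}
    {ρ : ∀ x y, K x y ⟶ M (sigmaSnd x) (sigmaSnd y)} {φ : ∀ x y, L x y ⟶ H' x.1 y.1}
    {ψ : ∀ x y, M x y ⟶ H' x.1 y.1}
    (h : ∀ x y, IsPullback (π x y) (ρ x y) (φ (sigmaFst x) (sigmaFst y))
      (ψ (sigmaSnd x) (sigmaSnd y))) (x y : Σ z, S z × R z) :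
    IsPullback (gammaMap E π x y) (gammaMap E ρ x y) (gammaMap E φ (sigmaFst x) (sigmaFst y))
      (gammaMap E ψ (sigmaSnd x) (sigmaSnd y)) := by
  refine hV.isPullback_coprod (isCoprod_gammaι E K x y) (isCoprod_gammaι E L _ _)
    (isCoprod_gammaι E M _ _) (isCoprod_gammaι E H' _ _) (r := mapSeq sigmaFst)
    (s := mapSeq sigmaSnd) (r' := mapSeq Sigma.fst) (s' := mapSeq Sigma.fst)
    (fun q => gammaι_gammaMap π q) (fun q => gammaι_gammaMap ρ q)
    (fun q => gammaι_gammaMap φ q) (fun q => gammaι_gammaMap ψ q) (fun k => ?_)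
    (fun _ _ h h' => pair_ext h h') (fun i j h => exists_pair i j h)
  have e := mapSeq_mapSeq.{w} sigmaFst Sigma.fst k
  have e' := mapSeq_mapSeq.{w} sigmaSnd Sigma.fst k
  have := hc.preservesPullbacks
  have := mono_gammaι hV (E := E) (H := H') (mapSeq Sigma.fst k)
  have key : ∀ {q q' : ObjSeq x.1 y.1} (e : q = q') {Zs : List V} (s : Zs ⟶ homs H' q),
      E.tensor.map s ≫ gammaι E H' q =
        E.tensor.map (s ≫ eqToHom (congrArg (homs H') e)) ≫ gammaι E H' q' := by
    rintro q _ rfl Zs s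
    exact congrArg (fun s => E.tensor.map s ≫ gammaι E H' q) (Category.comp_id s).symm
  exact IsExtensive.isPullback_of_mono
    ((isPullback_labelsHom h k (congrArg _ e) (congrArg _ e')).map E.tensor)
    (gammaι E H' (mapSeq Sigma.fst k)) ((gammaι_gammaMap φ _).trans (key e _))
    ((gammaι_gammaMap ψ _).trans (key e' _))

end Pairs

include hV in
lemma isCartesianMonad_gamma [HasFiniteLimits V] (hE : E.IsDistributive) (hc : E.IsCartesian) :
    IsCartesianMonad (gamma E hE).toMonad where
  preservesPullbacks := by
    refine preservesLimitsOfShape_walkingCospan_of_forall_isPullback fun X Y Z f g _ => ?_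
    -- Up to isomorphism the two object maps are projections of disjoint unions over `Z.obj`.
    -- Objects of the pullback are then triples `(z, s, r)` and the square of object maps commutes
    -- definitionally, as `isPullback_gammaMap` requires.
    obtain ⟨S, L, φ, e, he⟩ := EGraph.exists_iso_sigma f
    obtain ⟨R, M, ψ, e', he'⟩ := EGraph.exists_iso_sigma g
    let P : EGraph V := ⟨Σ z, S z × R z, fun x y => Limits.pullback
      (φ (Chain.sigmaFst x) (Chain.sigmaFst y)) (ψ (Chain.sigmaSnd x) (Chain.sigmaSnd y))⟩
    let p : P ⟶ ⟨Σ z, S z, L⟩ := ⟨Chain.sigmaFst, fun _ _ => pullback.fst _ _⟩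
    let q : P ⟶ ⟨Σ z, R z, M⟩ := ⟨Chain.sigmaSnd, fun _ _ => pullback.snd _ _⟩
    have surj : ∀ (x : Σ z, S z) (y : Σ z, R z), x.1 = y.1 →
        ∃ a : Σ z, S z × R z, Chain.sigmaFst a = x ∧ Chain.sigmaSnd a = y := by
      rintro ⟨z, s⟩ ⟨_, r⟩ rfl
      exact ⟨⟨z, s, r⟩, rfl, rfl⟩
    have hp : ∀ x y : P.obj, IsPullback (p.hom x y) (q.hom x y) (φ _ _) (ψ _ _) :=
      fun x y => IsPullback.of_hasPullback _ _
    have h₁ : IsPullback p q (⟨Sigma.fst, φ⟩ : (⟨Σ z, S z, L⟩ : EGraph V) ⟶ Z)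
        (⟨Sigma.fst, ψ⟩ : (⟨Σ z, R z, M⟩ : EGraph V) ⟶ Z) :=
      EGraph.isPullback_of_hom (fun _ => rfl) (fun _ _ => Chain.sigma_pair_ext) surj fun x y =>
        IsExtensive.isPullback_of_mono (hp x y) (𝟙 _) rfl (Category.comp_id _).symm
    have h₂ : IsPullback ((gamma E hE).toMonad.map p) ((gamma E hE).toMonad.map q)
        ((gamma E hE).toMonad.map (⟨Sigma.fst, φ⟩ : (⟨Σ z, S z, L⟩ : EGraph V) ⟶ Z))
        ((gamma E hE).toMonad.map (⟨Sigma.fst, ψ⟩ : (⟨Σ z, R z, M⟩ : EGraph V) ⟶ Z)) :=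
      EGraph.isPullback_of_hom (fun _ => rfl) (fun _ _ => Chain.sigma_pair_ext) surj fun x y =>
        IsExtensive.isPullback_of_mono (isPullback_gammaMap hV hc hp x y) (𝟙 _) rfl
          (Category.comp_id _).symm
    refine ⟨P, p ≫ e.hom, q ≫ e'.hom, ?_, ?_⟩
    · exact IsPullback.of_iso h₁ (Iso.refl _) e e' (Iso.refl _) (by simp) (by simp)
        (by simp [he]) (by simp [he'])
    · refine IsPullback.of_iso h₂ (Iso.refl _) ((gamma E hE).toMonad.mapIso e)
        ((gamma E hE).toMonad.mapIso e') (Iso.refl _) (by simp) (by simp) ?_ ?_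
      · simp [← he]
      · simp [← he']
  η := by
    rintro X Y ⟨f, φ⟩
    exact EGraph.isPullback_ofHoms_iff.2 (isPullback_gammaη hV hc φ)
  μ := by
    rintro X Y ⟨f, φ⟩
    exact EGraph.isPullback_ofHoms_iff.2 (isPullback_gammaμ hV hE hc φ)

end

/-! ### `Γ_E` is fully faithful -/

/-- A path over a concatenated list can be cut at the ends of the blocks. Equations involving
substitution, when tested on paths, may hence be tested on paths of paths. -/
lemma LPath.exists_flatten_eq {S : Type w} {A : Type u₂} {K : A → S → S → Type v}
    {Zss : List (List A)} {a b : S} (p : LPath K Zss.flatten a b) :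
    ∃ R : LPath (LPath K) Zss a b, flatten R = p := by
  have split : ∀ (Zs : List A) {Ws : List A} {a : S} (p : LPath K (Zs ++ Ws) a b),
      ∃ (c : S) (q : LPath K Zs a c) (r : LPath K Ws c b), append q r = p := by
    intro Zs Ws
    induction Zs with
    | nil => exact fun p => ⟨_, nil _, p, rfl⟩
    | cons Z Zs ih =>
      intro a p
      cases p with
      | cons f p =>
        obtain ⟨c, q, r, rfl⟩ := ih p
        exact ⟨c, cons f q, r, rfl⟩
  induction Zss generalizing a with
  | nil => cases p with | nil => exact ⟨nil _, rfl⟩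
  | cons Zs Zss ih =>
    obtain ⟨c, q, r, rfl⟩ := split Zs p
    obtain ⟨R, rfl⟩ := ih r
    exact ⟨cons q R, rfl⟩

variable {V : Type u} [Category.{w} V]

lemma Path.map_mapLabels {S : Type w} {H H' : S → S → V} {A : Type*}
    {K : A → S → S → Type*} {o : A → V} (g : ∀ Z a b, K Z a b → (o Z ⟶ H a b))
    (φ : ∀ a b, H a b ⟶ H' a b) {Zs : List A} {a b : S} (p : LPath K Zs a b) :
    Path.map (f := fun a => a) φ (LPath.mapLabels (K' := fun Z a b => Z ⟶ H a b) o g p) =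
      LPath.mapLabels (K' := fun Z a b => Z ⟶ H' a b) o (fun Z a b f => g Z a b f ≫ φ a b) p := by
  induction p with
  | nil => rfl
  | cons f p ih => exact congrArg (LPath.cons _) ih

/-! ### Paths in the terminal graph. -/

section Bang

variable [HasTerminal V]

variable (V) in
/-- The homs of the terminal graph. -/
noncomputable abbrev bangHom : PUnit.{w + 1} → PUnit.{w + 1} → V := fun _ _ => ⊤_ V

/-- The unique path in the terminal graph over a given list of objects. -/
noncomputable def bangPath : (Zs : List V) → Path (bangHom V) Zs PUnit.unit PUnit.unit
  | [] => LPath.nil _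
  | Z :: Zs => LPath.cons (terminal.from Z) (bangPath Zs)

lemma map_bang {S : Type w} {H : S → S → V} {Zs : List V} {a b : S} (p : Path H Zs a b) :
    Path.map (H' := bangHom V) (f := fun _ => PUnit.unit) (fun _ _ => terminal.from _) p =
      bangPath Zs := by
  induction p with
  | nil => rfl
  | cons f p ih => exact congrArg₂ LPath.cons (terminalIsTerminal.hom_ext _ _) ih

end Bang

variable [HasCoproducts.{w} V] [HasFiniteLimits V] (hV : IsExtensive V)
  {A B E : Multitensor V}

include hV in
-- As `β` is cartesian, `B Zs` is the pullback of `Γ B 1` along `E Zs ⟶ Γ E 1`, so `α` together with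
-- `Φ` at the terminal graph induces a map into it. The axioms are then verified after composition
-- with the maps `gammaPath B p`, where they become the monad map axioms of `Φ`.
lemma exists_multitensorHom (hA : A.IsDistributive) (hB : B.IsDistributive) (α : A ⟶ E)
    (β : B ⟶ E) (hβ : NatTrans.Equifibered β.toNatTrans)
    (Φ : ∀ {S : Type w} (H : S → S → V) (a b : S), gammaHom A H a b ⟶ gammaHom B H a b)
    (hΦ : ∀ {S S' : Type w} {H : S → S → V} {H' : S' → S' → V} {f : S → S'}
      (φ : ∀ a b, H a b ⟶ H' (f a) (f b)) (a b : S),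
      gammaMap A φ a b ≫ Φ H' (f a) (f b) = Φ H a b ≫ gammaMap B φ a b)
    (hη : ∀ {S : Type w} (H : S → S → V) (a b : S), gammaη A H a b ≫ Φ H a b = gammaη B H a b)
    (hμ : ∀ {S : Type w} (H : S → S → V) (a b : S), gammaμ A hA H a b ≫ Φ H a b =
      (gammaMap A (f := fun a => a) (Φ H) a b ≫ Φ (gammaHom B H) a b) ≫ gammaμ B hB H a b)
    (hE : ∀ {S : Type w} (H : S → S → V) (a b : S),
      Φ H a b ≫ gammaApp β H a b = gammaApp α H a b) :
    ∃ f : A ⟶ B, f ≫ β = α ∧ ∀ {S : Type w} (H : S → S → V) (a b : S), gammaApp f H a b = Φ H a b := by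
  have h0 : ∀ Zs : List V, ∃ f : A.tensor.obj Zs ⟶ B.tensor.obj Zs,
      f ≫ gammaPath B (bangPath Zs) = gammaPath A (bangPath Zs) ≫ Φ _ _ _ ∧
      f ≫ β.toNatTrans.app Zs = α.toNatTrans.app Zs := fun Zs => by
    refine (isPullback_gammaPath hV β hβ (bangPath Zs)).exists_lift _ _ ?_
    rw [Category.assoc, hE, gammaPath_gammaApp]
  choose f hf hfβ using h0
  -- Compatibility passes from the terminal graph to every graph: `Γ B H (a, b)` is the pullback of
  -- `Γ B 1` along `Γ E H (a, b) ⟶ Γ E 1`, so the equation is checked in `Γ B 1` and in `Γ E H (a,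
  -- b)`.
  have hp : ∀ {S : Type w} {H : S → S → V} {Zs : List V} {a b : S} (p : Path H Zs a b),
      f Zs ≫ gammaPath B p = gammaPath A p ≫ Φ H a b := fun {S H Zs a b} p => by
    refine (isPullback_gammaApp hV β hβ (H' := bangHom V) (f := fun _ => PUnit.unit)
      (fun _ _ => terminal.from _) a b).hom_ext ?_ ?_
    · rw [Category.assoc, gammaPath_map, map_bang, hf, Category.assoc, ← hΦ, ← Category.assoc,
        gammaPath_map, map_bang]
    · rw [Category.assoc, gammaPath_gammaApp, ← Category.assoc, hfβ, Category.assoc, hE,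
        gammaPath_gammaApp]
  -- The maps `gammaPath B p` are jointly monic, since a single one of them is already monic.
  have ext : ∀ {Zs : List V} {W : V} {k l : W ⟶ B.tensor.obj Zs} (_ : ∀ {S : Type w}
      {H : S → S → V} {a b : S} (p : Path H Zs a b), k ≫ gammaPath B p = l ≫ gammaPath B p),
      k = l := fun {Zs W k l} h => by
    obtain ⟨S, H, a, b, p, hp⟩ := exists_mono_gammaPath hV Zs
    have := hp B
    exact (cancel_mono _).1 (h p)
  let F : A ⟶ B :=
    { toNatTrans :=
        { app := f
          naturality := fun Zs Ws s => ext fun p => by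
            rw [Category.assoc, hp, ← Category.assoc, ← gammaPath_precomp, Category.assoc,
              ← gammaPath_precomp, hp] }
      unit_comp := fun Z => ext fun p => by
        cases p with
        | cons h p => cases p with
          | nil => rw [Category.assoc, hp, ← Category.assoc, gammaPath_unit, Category.assoc, hη,
              gammaPath_unit]
      subst_comp := fun Z => ext fun p => by
        obtain ⟨R, rfl⟩ := LPath.exists_flatten_eq p
        rw [Category.assoc, hp, ← Category.assoc, gammaPath_flatten hA, Category.assoc, hμ,
          ← Category.assoc, ← Category.assoc, gammaPath_map (f := fun a => a)]
        simp only [Category.assoc]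
        rw [gammaPath_flatten hB, ← Category.assoc (f _), hp, Category.assoc, ← Category.assoc,
          ← Category.assoc, ← Category.assoc, ← gammaPath_precomp]
        refine congrArg (fun k => (gammaPath A k ≫ Φ _ _ _) ≫ _) ?_
        rw [Path.map_mapLabels]
        refine Eq.trans ?_ (Path.precomp_mapLabels _ _ _).symm
        congr 1
        funext Zs a b p
        exact (hp p).symm }
  refine ⟨F, ?_, fun H a b => ?_⟩
  · exact MultitensorHom.ext (NatTrans.ext (funext hfβ))
  · exact gammaPath_hom_ext fun p => (gammaPath_gammaApp F p).trans (hp p)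

/-! ### Faithfulness and fullness. -/

section Functor

variable (hE : E.IsDistributive) (hd : ∀ A : EMultitensor E, A.obj.left.IsDistributive)
  (hc : ∀ A : EMultitensor E, NatTrans.Equifibered (MonadHom.toNatTrans
    (MonadOverSetHom.toMonadHom (gammaHomMap (hd A) hE A.obj.hom))))

include hV in
-- A multitensor map is determined by `Γ` of it: its component at `Zs` is recovered through a path
-- for which `gammaPath` is monic.
lemma gammaFunctor_faithful : (gammaFunctor E hE hd hc).Faithful where
  map_injective {A B} f g h := by
    ext : 2
    refine MultitensorHom.ext (NatTrans.ext (funext fun Zs => ?_))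
    obtain ⟨S, H, a, b, p, hp⟩ := exists_mono_gammaPath hV Zs
    have := hp B.obj.left
    have h₁ : gammaHomMap (hd A) (hd B) f.hom.left = gammaHomMap (hd A) (hd B) g.hom.left :=
      congrArg (fun k => k.hom.left) h
    have h₂ : gammaApp f.hom.left H a b = gammaApp g.hom.left H a b :=
      congrFun (congrFun (congrFun (congrArg MonadOverSetHom.app h₁) ⟨S, H⟩) a) b
    refine (cancel_mono (gammaPath B.obj.left p)).1 ?_
    rw [← gammaPath_gammaApp, ← gammaPath_gammaApp, h₂]

include hV in
lemma gammaFunctor_full : (gammaFunctor E hE hd hc).Full where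
  map_surjective {A B} φ := by
    let Φ : MonadOverSetHom (gamma A.obj.left (hd A)) (gamma B.obj.left (hd B)) := φ.hom.left
    have hΦ : Φ ≫ gammaHomMap (hd B) hE B.obj.hom = gammaHomMap (hd A) hE A.obj.hom :=
      Over.w φ.hom
    obtain ⟨f, hf, hf'⟩ := exists_multitensorHom hV (hd A) (hd B) A.obj.hom B.obj.hom B.property
      (fun {S} H a b => Φ.app ⟨S, H⟩ a b)
      (fun {S S' H H' f} φ a b => Φ.naturality (X := ⟨S, H⟩) (Y := ⟨S', H'⟩) ⟨f, φ⟩ a b)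
      (fun {S} H a b => Φ.η_comp ⟨S, H⟩ a b) (fun {S} H a b => Φ.μ_comp ⟨S, H⟩ a b)
      (fun {S} H a b =>
        congrFun (congrFun (congrFun (congrArg MonadOverSetHom.app hΦ) ⟨S, H⟩) a) b)
    refine ⟨ObjectProperty.homMk (Over.homMk f hf), ?_⟩
    ext : 2
    refine MonadOverSetHom.ext (funext fun X => funext fun a => funext fun b => ?_)
    exact hf' X.hom a b

end Functor

/-! ### The multitensor of an operad -/

lemma LPath.mapObj_heq_mapLabels {S : Type w} {A : Type u₂} {K K' : A → S → S → Type v}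
    (g : ∀ Z a b, K Z a b → K' Z a b) {Zs : List A} {a b : S} (p : LPath K Zs a b) :
    HEq (mapObj (K' := K') (fun a => a) g p) (mapLabels (K' := K') (fun Z => Z) g p) := by
  induction p with
  | nil => rfl
  | cons f p ih => exact cons_heq (List.map_id' _).symm rfl ih

section

variable {V : Type u} [Category.{w} V] [HasTerminal V]

lemma eq_bangPath {Zs : List V} {a b : PUnit.{w + 1}} (p : Path (bangHom V) Zs a b) :
    p = bangPath Zs := by
  induction p with
  | nil => rfl
  | cons f p ih => exact congrArg₂ LPath.cons (terminalIsTerminal.hom_ext _ _) ih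

/-- The unique path of paths in the terminal graph over a given list of lists. -/
noncomputable def bangNested : (Zss : List (List V)) →
    LPath (Path (bangHom V)) Zss PUnit.unit PUnit.unit
  | [] => LPath.nil _
  | Zs :: Zss => LPath.cons (bangPath Zs) (bangNested Zss)

lemma mapObj_bang {S : Type w} {H : S → S → V} {Zss : List (List V)} {a b : S}
    (R : LPath (Path H) Zss a b) :
    LPath.mapObj (K' := Path (bangHom V)) (fun _ => PUnit.unit)
      (fun _ _ _ p => Path.map (H' := bangHom V) (f := fun _ => PUnit.unit)
        (fun _ _ => terminal.from _) p) R = bangNested Zss := by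
  induction R with
  | nil => rfl
  | cons p R ih => exact congrArg₂ LPath.cons (map_bang p) ih

end

variable {V : Type u} [Category.{w} V]

/-- With `comp_chase₄`, this evaluates one side each of the associativity law of `opMultitensor`:
the test map is moved leftwards through the composite and leaves two multiplications behind. -/
lemma comp_chase₃ {A B C D X X' X'' : V} {a : A ⟶ B} {b : B ⟶ C} {c : C ⟶ D} {d : D ⟶ X}
    {y : C ⟶ X} {y' : B ⟶ X'} {m : X' ⟶ X} {z : A ⟶ X''} {m' : X'' ⟶ X'} (h₁ : c ≫ d = y)
    (h₂ : b ≫ y = y' ≫ m) (h₃ : a ≫ y' = z ≫ m') :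
    (a ≫ b ≫ c) ≫ d = z ≫ m' ≫ m := by
  rw [Category.assoc, Category.assoc, h₁, h₂, ← Category.assoc, h₃, Category.assoc]

lemma comp_chase₄ {A B C D F X X' X'' : V} {a : A ⟶ B} {b : B ⟶ C} {c : C ⟶ D} {d : D ⟶ F}
    {x : F ⟶ X} {y : D ⟶ X'} {m : X' ⟶ X} {y' : C ⟶ X'} {y'' : B ⟶ X''} {m' : X'' ⟶ X'}
    {z : A ⟶ X''} (h₁ : d ≫ x = y ≫ m) (h₂ : c ≫ y = y') (h₃ : b ≫ y' = y'' ≫ m')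
    (h₄ : a ≫ y'' = z) : (a ≫ b ≫ c ≫ d) ≫ x = z ≫ m' ≫ m := by
  rw [Category.assoc, Category.assoc, Category.assoc, h₁, ← Category.assoc c, h₂,
    ← Category.assoc b, h₃, ← Category.assoc, ← Category.assoc a, h₄, Category.assoc]

/-! ### Reconstruction of a multitensor from an operad. -/

section Operad

variable {S S' : Type w} {H : S → S → V} {H' : S' → S' → V}

/-- The homs of `P X`, for a graph `X` given by its homs. -/
abbrev MonadOverSet.homOf (P : MonadOverSet V) (H : S → S → V) (a b : S) : V := P.hom ⟨S, H⟩ a b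

abbrev MonadOverSet.mapOf (P : MonadOverSet V) {f : S → S'}
    (φ : ∀ a b, H a b ⟶ H' (f a) (f b)) (a b : S) : P.homOf H a b ⟶ P.homOf H' (f a) (f b) :=
  P.map (X := ⟨S, H⟩) (Y := ⟨S', H'⟩) ⟨f, φ⟩ a b

lemma MonadOverSet.mapOf_comp (P : MonadOverSet V) {S'' : Type w} {H'' : S'' → S'' → V}
    {f : S → S'} {f' : S' → S''} (φ : ∀ a b, H a b ⟶ H' (f a) (f b))
    (φ' : ∀ a b, H' a b ⟶ H'' (f' a) (f' b)) (a b : S) :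
    P.mapOf φ a b ≫ P.mapOf φ' (f a) (f b) =
      P.mapOf (f := fun a => f' (f a)) (fun a b => φ a b ≫ φ' _ _) a b :=
  (P.map_comp (X := ⟨S, H⟩) (Y := ⟨S', H'⟩) (Z := ⟨S'', H''⟩) ⟨f, φ⟩ ⟨f', φ'⟩ a b).symm

abbrev MonadOverSet.ηOf (P : MonadOverSet V) (H : S → S → V) (a b : S) : H a b ⟶ P.homOf H a b :=
  P.η ⟨S, H⟩ a b

abbrev MonadOverSet.μOf (P : MonadOverSet V) (H : S → S → V) (a b : S) :
    P.homOf (P.homOf H) a b ⟶ P.homOf H a b :=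
  P.μ ⟨S, H⟩ a b

lemma MonadOverSet.ηOf_naturality (P : MonadOverSet V) {f : S → S'}
    (φ : ∀ a b, H a b ⟶ H' (f a) (f b)) (a b : S) :
    φ a b ≫ P.ηOf H' (f a) (f b) = P.ηOf H a b ≫ P.mapOf φ a b :=
  P.η_naturality (X := ⟨S, H⟩) (Y := ⟨S', H'⟩) ⟨f, φ⟩ a b

lemma MonadOverSet.μOf_naturality (P : MonadOverSet V) {f : S → S'}
    (φ : ∀ a b, H a b ⟶ H' (f a) (f b)) (a b : S) :
    P.mapOf (P.mapOf φ) a b ≫ P.μOf H' (f a) (f b) = P.μOf H a b ≫ P.mapOf φ a b :=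
  P.μ_naturality (X := ⟨S, H⟩) (Y := ⟨S', H'⟩) ⟨f, φ⟩ a b

variable [HasCoproducts.{w} V] {E : Multitensor V} {hE : E.IsDistributive} {P : MonadOverSet V}

/-- The homs of a morphism of monads with target `Γ E`. -/
noncomputable abbrev MonadOverSetHom.appOf (π : MonadOverSetHom P (gamma E hE)) (H : S → S → V)
    (a b : S) : P.homOf H a b ⟶ gammaHom E H a b :=
  π.app ⟨S, H⟩ a b

variable (π : MonadOverSetHom P (gamma E hE))

lemma appOf_naturality {f : S → S'} (φ : ∀ a b, H a b ⟶ H' (f a) (f b)) (a b : S) :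
    P.mapOf φ a b ≫ π.appOf H' (f a) (f b) = π.appOf H a b ≫ gammaMap E φ a b :=
  π.naturality (X := ⟨S, H⟩) (Y := ⟨S', H'⟩) ⟨f, φ⟩ a b

lemma ηOf_appOf (a b : S) : P.ηOf H a b ≫ π.appOf H a b = gammaη E H a b :=
  π.η_comp ⟨S, H⟩ a b

lemma μOf_appOf (a b : S) : P.μOf H a b ≫ π.appOf H a b =
    (P.mapOf (f := fun a => a) (π.appOf H) a b ≫ π.appOf (gammaHom E H) a b) ≫
      gammaμ E hE H a b :=
  π.μ_comp ⟨S, H⟩ a b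

/-- A monad over `Set` with a cartesian morphism to `Γ E`. -/
abbrev MonadOverSetHom.IsOperad (π : MonadOverSetHom P (gamma E hE)) : Prop :=
  NatTrans.Equifibered (MonadHom.toNatTrans (MonadOverSetHom.toMonadHom π))

variable {π}

lemma MonadOverSetHom.IsOperad.isPullback (hπ : π.IsOperad) {f : S → S'}
    (φ : ∀ a b, H a b ⟶ H' (f a) (f b)) (a b : S) :
    IsPullback (P.mapOf φ a b) (π.appOf H a b) (π.appOf H' (f a) (f b)) (gammaMap E φ a b) :=
  EGraph.isPullback_ofHoms_iff.1 (hπ (⟨f, φ⟩ : (⟨S, H⟩ : EGraph V) ⟶ ⟨S', H'⟩)) a b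

variable [HasFiniteLimits V] (π)

/-- The object `A (Z₁, …, Zₙ)` of the multitensor `A` of an operad `P`: the pullback of `P 1` along
`E (Z₁, …, Zₙ) ⟶ Γ E 1`, where `1` is the terminal graph. -/
noncomputable def opObj (Zs : List V) : V :=
  Limits.pullback (gammaPath E (bangPath Zs)) (π.appOf (bangHom V) PUnit.unit PUnit.unit)

noncomputable def opFst (Zs : List V) : opObj π Zs ⟶ E.tensor.obj Zs := pullback.fst _ _

noncomputable def opSnd (Zs : List V) :
    opObj π Zs ⟶ P.homOf (bangHom V) PUnit.unit PUnit.unit := pullback.snd _ _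

lemma isPullback_op (Zs : List V) : IsPullback (opSnd π Zs) (opFst π Zs)
    (π.appOf (bangHom V) PUnit.unit PUnit.unit) (gammaPath E (bangPath Zs)) :=
  (IsPullback.of_hasPullback _ _).flip

variable {π} {Zs Zs' : List V}

lemma op_hom_ext {W : V} {k l : W ⟶ opObj π Zs} (h : k ≫ opFst π Zs = l ≫ opFst π Zs)
    (h' : k ≫ opSnd π Zs = l ≫ opSnd π Zs) : k = l :=
  (isPullback_op π Zs).hom_ext h' h

noncomputable def opLift {W : V} (k : W ⟶ E.tensor.obj Zs)
    (l : W ⟶ P.homOf (bangHom V) PUnit.unit PUnit.unit)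
    (h : k ≫ gammaPath E (bangPath Zs) = l ≫ π.appOf (bangHom V) PUnit.unit PUnit.unit) :
    W ⟶ opObj π Zs :=
  (isPullback_op π Zs).lift l k h.symm

lemma opLift_fst {W : V} (k : W ⟶ E.tensor.obj Zs)
    (l : W ⟶ P.homOf (bangHom V) PUnit.unit PUnit.unit)
    (h : k ≫ gammaPath E (bangPath Zs) = l ≫ π.appOf (bangHom V) PUnit.unit PUnit.unit) :
    opLift k l h ≫ opFst π Zs = k :=
  (isPullback_op π Zs).lift_snd _ _ _

lemma opLift_snd {W : V} (k : W ⟶ E.tensor.obj Zs)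
    (l : W ⟶ P.homOf (bangHom V) PUnit.unit PUnit.unit)
    (h : k ≫ gammaPath E (bangPath Zs) = l ≫ π.appOf (bangHom V) PUnit.unit PUnit.unit) :
    opLift k l h ≫ opSnd π Zs = l :=
  (isPullback_op π Zs).lift_fst _ _ _

/-- The canonical map to the hom of the terminal graph. -/
noncomputable abbrev bangMap (P : MonadOverSet V) (H : S → S → V) (a b : S) :
    P.homOf H a b ⟶ P.homOf (bangHom V) PUnit.unit PUnit.unit :=
  P.mapOf (H' := bangHom V) (f := fun _ => PUnit.unit) (fun _ _ => terminal.from _) a b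

/-- Cartesianness of `π` makes `P X (a, b)` the pullback of `P 1` along `Γ E X (a, b) ⟶ Γ E 1`.
Every path over `Zs` becomes `bangPath Zs` in the terminal graph, which is why the two components
are compatible. -/
lemma exists_opPath (hπ : π.IsOperad) {a b : S} (p : Path H Zs a b) :
    ∃ k : opObj π Zs ⟶ P.homOf H a b, k ≫ bangMap P H a b = opSnd π Zs ∧
      k ≫ π.appOf H a b = opFst π Zs ≫ gammaPath E p := by
  refine (hπ.isPullback (H' := bangHom V) (f := fun _ => PUnit.unit)
    (fun _ _ => terminal.from _) a b).exists_lift _ _ ?_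
  rw [Category.assoc, gammaPath_map, map_bang]
  exact (isPullback_op π Zs).w

/-- The map `A (Z₁, …, Zₙ) ⟶ P X (a, b)` given by a path in `X`. -/
noncomputable def opPath (hπ : π.IsOperad) {a b : S} (p : Path H Zs a b) :
    opObj π Zs ⟶ P.homOf H a b :=
  (exists_opPath hπ p).choose

variable (hπ : π.IsOperad)

lemma opPath_bang {a b : S} (p : Path H Zs a b) :
    opPath hπ p ≫ bangMap P H a b = opSnd π Zs :=
  (exists_opPath hπ p).choose_spec.1

lemma opPath_app {a b : S} (p : Path H Zs a b) :
    opPath hπ p ≫ π.appOf H a b = opFst π Zs ≫ gammaPath E p :=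
  (exists_opPath hπ p).choose_spec.2

include hπ in
lemma homOf_ext {W : V} {a b : S} {k l : W ⟶ P.homOf H a b}
    (h : k ≫ bangMap P H a b = l ≫ bangMap P H a b)
    (h' : k ≫ π.appOf H a b = l ≫ π.appOf H a b) : k = l :=
  (hπ.isPullback (H' := bangHom V) (f := fun _ => PUnit.unit)
    (fun _ _ => terminal.from _) a b).hom_ext h h'

/-- Cancellation against the pullback square of `π` at the map to the terminal graph. The object
`opObj π Zs` is thus a pullback along any path over `Zs`, not only along the one used to define it.
-/
lemma isPullback_opPath {a b : S} (p : Path H Zs a b) :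
    IsPullback (opPath hπ p) (opFst π Zs) (π.appOf H a b) (gammaPath E p) := by
  refine IsPullback.of_right ?_ (opPath_app hπ p) (hπ.isPullback (H' := bangHom V)
    (f := fun _ => PUnit.unit) (fun _ _ => terminal.from _) a b)
  rw [gammaPath_map, map_bang]
  exact isPullback_of_heq (isPullback_op π Zs) rfl rfl rfl rfl
    (heq_of_eq (opPath_bang hπ p).symm) HEq.rfl HEq.rfl HEq.rfl

/-- A path with `gammaPath E p` monic separates the component in `E`, and `isPullback_opPath` does
the rest. All laws of `opMultitensor` are proved by testing on paths in this way. -/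
lemma op_ext (hV : IsExtensive V) {W : V} {k l : W ⟶ opObj π Zs} (h : ∀ {S : Type w}
    {H : S → S → V} {a b : S} (p : Path H Zs a b), k ≫ opPath hπ p = l ≫ opPath hπ p) :
    k = l := by
  obtain ⟨S, H, a, b, p, hp⟩ := exists_mono_gammaPath hV Zs
  have := hp E
  refine (isPullback_opPath hπ p).hom_ext (h p) ?_
  refine (cancel_mono (gammaPath E p)).1 ?_
  rw [Category.assoc, Category.assoc, ← opPath_app hπ, ← Category.assoc, h, Category.assoc]

lemma opPath_map {f : S → S'} (φ : ∀ a b, H a b ⟶ H' (f a) (f b)) {a b : S}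
    (p : Path H Zs a b) : opPath hπ p ≫ P.mapOf φ a b = opPath hπ (Path.map φ p) := by
  refine homOf_ext hπ ?_ ?_
  · rw [opPath_bang, Category.assoc, P.mapOf_comp, ← opPath_bang hπ p]
    congr 3
    funext a b
    exact terminalIsTerminal.hom_ext _ _
  · rw [opPath_app, Category.assoc, appOf_naturality, ← Category.assoc, opPath_app,
      Category.assoc, gammaPath_map]

noncomputable def opMap (s : Zs ⟶ Zs') : opObj π Zs ⟶ opObj π Zs' :=
  opLift (opFst π Zs ≫ E.tensor.map s) (opSnd π Zs) (by
    rw [Category.assoc, ← gammaPath_precomp, eq_bangPath (Path.precomp s (bangPath Zs'))]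
    exact (isPullback_op π Zs).w.symm)

variable (π) in
lemma opMap_fst (s : Zs ⟶ Zs') : opMap (π := π) s ≫ opFst π Zs' = opFst π Zs ≫ E.tensor.map s :=
  opLift_fst _ _ _

lemma opMap_opPath (s : Zs ⟶ Zs') {a b : S} (p : Path H Zs' a b) :
    opMap (π := π) s ≫ opPath hπ p = opPath hπ (Path.precomp s p) := by
  refine homOf_ext hπ ?_ ?_
  · rw [Category.assoc, opPath_bang, opPath_bang]
    exact opLift_snd _ _ _
  · rw [Category.assoc, opPath_app, opPath_app, ← Category.assoc]
    refine (congrArg (· ≫ _) (opLift_fst _ _ _)).trans ?_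
    rw [Category.assoc, gammaPath_precomp]

variable (π) in
/-- The functor part of the multitensor of an operad. -/
noncomputable abbrev opFunctor : List V ⥤ V where
  obj := opObj π
  map := opMap
  map_id Zs := op_hom_ext ((opLift_fst _ _ _).trans (by simp)) ((opLift_snd _ _ _).trans (by simp))
  map_comp f g := by
    refine op_hom_ext ((opLift_fst _ _ _).trans ?_) ((opLift_snd _ _ _).trans ?_)
    · refine Eq.symm ((Category.assoc _ _ _).trans ((congrArg (_ ≫ ·) (opLift_fst _ _ _)).trans ?_))
      refine (Category.assoc _ _ _).symm.trans ((congrArg (· ≫ _) (opLift_fst _ _ _)).trans ?_)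
      rw [Category.assoc, E.tensor.map_comp]
    · refine Eq.symm ((Category.assoc _ _ _).trans ((congrArg (_ ≫ ·) (opLift_snd _ _ _)).trans ?_))
      exact opLift_snd _ _ _

lemma opPath_heq (h : Zs = Zs') {a b : S} {p : Path H Zs a b} {p' : Path H Zs' a b}
    (hp : HEq p p') : (opFunctor π).map (eqToHom h) ≫ opPath hπ p' = opPath hπ p :=
  (opMap_opPath hπ _ _).trans (congrArg _ (Path.precomp_eqToHom h hp))

/-- The path of the maps `opPath p`, for the paths `p` in a path of paths. -/
noncomputable abbrev opPaths {Zss : List (List V)} {a b : S} (R : LPath (Path H) Zss a b) :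
    Path (P.homOf H) (Zss.map (opFunctor π).obj) a b :=
  LPath.mapLabels (opFunctor π).obj (fun _ _ _ p => opPath hπ p) R

variable (π) in
noncomputable def opUnit (Z : V) : Z ⟶ opObj π [Z] :=
  opLift (E.unit Z) (terminal.from Z ≫ P.ηOf (bangHom V) PUnit.unit PUnit.unit) (by
    exact (gammaPath_unit (H := bangHom V) (b := PUnit.unit) (terminal.from Z)).trans
      ((congrArg (terminal.from Z ≫ ·) (ηOf_appOf π _ _).symm).trans (Category.assoc _ _ _).symm))

lemma opUnit_opPath {Z : V} {a b : S} (f : Z ⟶ H a b) :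
    opUnit π Z ≫ opPath hπ (LPath.cons f (LPath.nil b) : Path H [Z] a b) = f ≫ P.ηOf H a b := by
  refine homOf_ext hπ ?_ ?_
  · rw [Category.assoc, opPath_bang, Category.assoc]
    refine (opLift_snd _ _ _).trans ?_
    refine Eq.trans ?_ (congrArg (f ≫ ·) (P.ηOf_naturality (H' := bangHom V)
      (f := fun _ => PUnit.unit) (fun _ _ => terminal.from _) a b))
    refine Eq.trans ?_ (Category.assoc _ _ _)
    exact congrArg (· ≫ _) (terminalIsTerminal.hom_ext _ _)
  · refine (Category.assoc _ _ _).trans ((congrArg (_ ≫ ·) (opPath_app hπ _)).trans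
      (Eq.trans ?_ (Category.assoc _ _ _).symm))
    refine (Category.assoc _ _ _).symm.trans ((congrArg (· ≫ _) (opLift_fst _ _ _)).trans ?_)
    exact (gammaPath_unit f).trans (congrArg (f ≫ ·) (ηOf_appOf π a b).symm)

variable (π) in
lemma opUnit_fst (Z : V) : opUnit π Z ≫ opFst π [Z] = E.unit Z :=
  opLift_fst _ _ _

variable (π) in
/-- The composite `A (A Z₁, …, A Zₙ) ⟶ E (E Z₁, …, E Zₙ) ⟶ E (Z₁, …, Zₙ)`. -/
noncomputable def opSubstFst (Zss : List (List V)) :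
    opObj π (Zss.map (opFunctor π).obj) ⟶ E.tensor.obj Zss.flatten :=
  opFst π _ ≫ E.tensor.map (seqHomOfList (f := (opFunctor π).obj) (g := E.tensor.obj)
    (opFst π) Zss) ≫ E.subst Zss

/-- The image in `Γ E` of the multiplication of `P` on a path of paths; it supplies the
compatibility needed to define `opSubst`. -/
lemma opPaths_app {Zss : List (List V)} {a b : S} (R : LPath (Path H) Zss a b) :
    (opPath hπ (opPaths hπ R) ≫ P.μOf H a b) ≫ π.appOf H a b =
      opSubstFst π Zss ≫ gammaPath E (LPath.flatten R) := by
  have h : Path.map (f := fun a => a) (π.appOf H) (opPaths hπ R) =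
      Path.precomp (seqHomOfList (f := (opFunctor π).obj) (g := E.tensor.obj)
        (opFst π) Zss) (gammaPaths E R) := by
    refine (Path.map_mapLabels _ _ _).trans (Eq.trans ?_ (Path.precomp_mapLabels _ _ _).symm)
    congr 1
    funext Zs a b p
    exact opPath_app hπ p
  rw [Category.assoc, μOf_appOf, ← Category.assoc, ← Category.assoc, opPath_map, h, opPath_app,
    gammaPath_precomp, opSubstFst]
  simp only [Category.assoc]
  rw [gammaPath_flatten hE]

/-- The component in `P 1` is the multiplication of `P`, restricted along the unique path of paths
in the terminal graph. -/
noncomputable def opSubst (Zss : List (List V)) :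
    opObj π (Zss.map (opFunctor π).obj) ⟶ opObj π Zss.flatten :=
  opLift (opSubstFst π Zss) (opPath hπ (opPaths hπ (bangNested Zss)) ≫ P.μOf _ _ _) (by
    rw [opPaths_app, eq_bangPath (LPath.flatten _)])

lemma opSubst_fst (Zss : List (List V)) :
    opSubst hπ Zss ≫ opFst π Zss.flatten = opSubstFst π Zss :=
  opLift_fst _ _ _

/-- Characterises `opSubst` on all graphs. Maps into `P X (a, b)` are compared in `P 1`, where
naturality of the multiplication of `P` reduces the claim to the definition, and in `Γ E X (a, b)`,
where `opPaths_app` applies. -/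
lemma opSubst_opPath {Zss : List (List V)} {a b : S} (R : LPath (Path H) Zss a b) :
    opSubst hπ Zss ≫ opPath hπ (LPath.flatten R) = opPath hπ (opPaths hπ R) ≫ P.μOf H a b := by
  refine homOf_ext hπ ?_ ?_
  · rw [Category.assoc, opPath_bang, Category.assoc, ← P.μOf_naturality, ← Category.assoc,
      opPath_map]
    refine (opLift_snd _ _ _).trans (congrArg (fun k => opPath hπ k ≫ _) ?_)
    rw [← mapObj_bang R]
    -- Forming the `opPath` of each block commutes with the map to the terminal graph.
    have key : ∀ {Zss : List (List V)} {a b : S} (R : LPath (Path H) Zss a b),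
        opPaths hπ (LPath.mapObj (K' := Path (bangHom V)) (fun _ => PUnit.unit)
          (fun _ _ _ p => Path.map (H' := bangHom V) (f := fun _ => PUnit.unit)
            (fun _ _ => terminal.from _) p) R) =
        Path.map (H' := P.homOf (bangHom V)) (f := fun _ => PUnit.unit)
          (fun a b => bangMap P H a b) (opPaths hπ R) := by
      intro Zss a b R
      induction R with
      | nil => rfl
      | cons p R ih => exact congrArg₂ LPath.cons (opPath_map hπ _ p).symm ih
    exact key R
  · rw [opPaths_app, Category.assoc, opPath_app, ← Category.assoc]
    exact congrArg (· ≫ _) (opLift_fst _ _ _)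

/-- Restricting a path of paths block by block restricts both its concatenation and its path of
`opPath` maps; naturality of `opSubst` follows. -/
lemma exists_precomp_nested {Zss' Zss : List (List V)} (s : Zss' ⟶ Zss) {a b : S}
    (R : LPath (Path H) Zss a b) : ∃ R' : LPath (Path H) Zss' a b,
      LPath.flatten R' = Path.precomp (seqFlattenMap s) (LPath.flatten R) ∧
      opPaths hπ R' = Path.precomp (seqMapMap (opFunctor π) s) (opPaths hπ R) := by
  induction s using seqHom_induction generalizing a with
  | nil => exact ⟨R, (Path.precomp_id _).symm, (Path.precomp_id _).symm⟩
  | cons s t ih => cases R with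
    | cons p R =>
      obtain ⟨R', h₁, h₂⟩ := ih R
      refine ⟨LPath.cons (Path.precomp s p) R', ?_, ?_⟩
      · exact (congrArg (LPath.append _) h₁).trans (Path.precomp_append s (seqFlattenMap t) p _).symm
      · exact congrArg₂ LPath.cons (opMap_opPath hπ s p).symm h₂

lemma opPath_single_μ {a b : S} (p : Path H Zs a b) :
    opUnit π (opObj π Zs) ≫ opSubst hπ [Zs] ≫
      opPath hπ (LPath.flatten (LPath.cons p (LPath.nil b))) = opPath hπ p := by
  have h := opUnit_opPath hπ (opPath hπ p)
  rw [opSubst_opPath]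
  refine (Category.assoc _ _ _).symm.trans ((congrArg (· ≫ _) h).trans ?_)
  refine (Category.assoc _ _ _).trans ((congrArg (_ ≫ ·) ?_).trans (Category.comp_id _))
  exact P.left_unit ⟨S, H⟩ a b

/-- The multitensor of an operad. -/
noncomputable abbrev opMultitensor (hV : IsExtensive V) : Multitensor V where
  tensor := opFunctor π
  unit := opUnit π
  unit_naturality f := op_ext hπ hV fun p => by
    -- A test path over a list with one entry is a single map.
    cases p with
    | cons h p => cases p with
      | nil =>
        refine (Category.assoc _ _ _).trans ((congrArg (f ≫ ·) (opUnit_opPath hπ h)).trans ?_)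
        refine Eq.trans ?_ (Category.assoc _ _ _).symm
        refine Eq.trans ?_ (congrArg (_ ≫ ·) (opMap_opPath hπ _ _)).symm
        exact ((opUnit_opPath hπ (f ≫ h)).trans (Category.assoc _ _ _)).symm
  subst := opSubst hπ
  subst_naturality {Z Z'} s := op_ext hπ hV fun p => by
    obtain ⟨R, rfl⟩ := LPath.exists_flatten_eq p
    obtain ⟨R', h₁, h₂⟩ := exists_precomp_nested hπ s R
    refine (Category.assoc _ _ _).trans (Eq.trans ?_ (Category.assoc _ _ _).symm)
    refine (congrArg (_ ≫ ·) (opSubst_opPath hπ R)).trans (Eq.trans ?_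
      (congrArg (_ ≫ ·) (opMap_opPath hπ _ _)).symm)
    rw [← h₁, opSubst_opPath, h₂, ← opMap_opPath, Category.assoc]
  unit_subst Zs := op_ext hπ hV fun p => by
    refine (Category.assoc _ _ _).trans (Eq.trans ?_ (Category.id_comp _).symm)
    refine (congrArg (_ ≫ ·) ((Category.assoc _ _ _).trans (congrArg (_ ≫ ·)
      (opPath_heq hπ _ (LPath.append_nil p))))).trans ?_
    exact opPath_single_μ hπ p
  map_unit_subst Zs := op_ext hπ hV fun {S H a b} p => by
    -- The test path is the concatenation of its one-step paths. On those `opUnit` gives the unit of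
    -- `P`, so that the law becomes the right unit law of `P`.
    refine (Category.assoc _ _ _).trans (Eq.trans ?_ (Category.id_comp _).symm)
    refine (congrArg (_ ≫ ·) ((Category.assoc _ _ _).trans ((congrArg (_ ≫ ·)
      (opPath_heq hπ _ (LPath.flatten_singletons p))).trans (opSubst_opPath hπ _)))).trans ?_
    refine (Category.assoc _ _ _).symm.trans ((congrArg (· ≫ _) ((opMap_opPath hπ _ _).trans
      ((congrArg (opPath hπ) (?_ : _ = Path.map (f := fun a => a) (P.ηOf H) p)).trans
        (opPath_map hπ (f := fun a => a) (P.ηOf H) p).symm))).trans ?_)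
    · rw [← Path.precomp_comp, ← Path.precomp_comp]
      refine (congrArg (fun k => Path.precomp _ (Path.precomp _ k))
        (Path.precomp_eqToHom _ (LPath.mapLabels_mapLabels (K' := Path H) (fun Z => [Z])
          (fun _ _ b f => LPath.cons f (LPath.nil b)) (opFunctor π).obj
          (fun _ _ _ p => opPath hπ p) p).symm)).trans ?_
      refine (congrArg (fun k => Path.precomp _ k) (Path.precomp_mapLabels (opUnit π)
        (fun _ _ b f => opPath hπ (LPath.cons f (LPath.nil b))) p)).trans ?_
      refine Path.precomp_eqToHom _ ((LPath.mapObj_heq_mapLabels _ p).trans (heq_of_eq ?_))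
      congr 1
      funext Z a b f
      exact (opUnit_opPath hπ f).symm
    · refine (Category.assoc _ _ _).trans ((congrArg (_ ≫ ·) ?_).trans (Category.comp_id _))
      exact P.right_unit ⟨S, H⟩ a b
  assoc Z := op_ext hπ hV fun {S H a b} p => by
    -- The test path is cut twice, into a path of paths of paths `R`. Both sides then start with
    -- `opPath hπ X`: in `h₁` it is followed by the multiplication at `P X` and that at `X`, in `h₂`
    -- by `P` of the multiplication and then the multiplication. The associativity law of `P`
    -- identifies them.
    obtain ⟨R, rfl⟩ := LPath.exists_flatten_eq p
    obtain ⟨R, rfl⟩ := LPath.exists_flatten_eq R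
    let T : LPath (Path (P.homOf H)) (Z.map fun L => L.map (opFunctor π).obj) a b :=
      LPath.mapLabels (fun L => L.map (opFunctor π).obj) (fun _ _ _ r => opPaths hπ r) R
    let X : Path (P.homOf (P.homOf H)) (Z.map fun L => opObj π (L.map (opFunctor π).obj)) a b :=
      LPath.mapLabels (fun L => opObj π (L.map (opFunctor π).obj))
        (fun _ _ _ r => opPath hπ (opPaths hπ r)) R
    let U : LPath (Path H) (Z.map List.flatten) a b :=
      LPath.mapLabels List.flatten (fun _ _ _ r => LPath.flatten r) R
    have hX : HEq X (opPaths hπ T) := (LPath.mapLabels_mapLabels (K' := Path (P.homOf H))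
      (K'' := fun Z a b => Z ⟶ P.homOf (P.homOf H) a b) (fun L => L.map (opFunctor π).obj)
      (fun _ _ _ r => opPaths hπ r) (opFunctor π).obj (fun _ _ _ p => opPath hπ p) R).symm
    have hT : HEq (LPath.flatten T) (opPaths hπ (LPath.flatten R)) :=
      LPath.mapLabels_flatten (K' := fun Z a b => Z ⟶ P.homOf H a b) (opFunctor π).obj
        (fun _ _ _ p => opPath hπ p) R
    have h₁ := comp_chase₄ (opSubst_opPath hπ (LPath.flatten R))
      (opPath_heq hπ (by simp) hT) (opSubst_opPath hπ T)
      (opPath_heq hπ (by simp) hX)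
    have e : Path.precomp (seqHomOfList (f := fun L : List (List V) =>
        opObj π (L.map (opFunctor π).obj)) (g := fun L => opObj π L.flatten) (opSubst hπ) Z ≫
          eqToHom (by simp)) (opPaths hπ U) = Path.map (f := fun a => a) (P.μOf H) X := by
      rw [← Path.precomp_comp]
      refine (congrArg (fun k => Path.precomp _ k) (Path.precomp_eqToHom _
        (LPath.mapLabels_mapLabels (K' := Path H) List.flatten (fun _ _ _ r => LPath.flatten r)
          (opFunctor π).obj (fun _ _ _ p => opPath hπ p) R).symm)).trans ?_
      refine (Path.precomp_mapLabels (opSubst hπ) _ R).trans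
        (Eq.trans ?_ (Path.map_mapLabels _ _ _).symm)
      congr 1
      funext L a b r
      exact opSubst_opPath hπ r
    have h₂ := comp_chase₃ (opPath_heq hπ (flatten_map_flatten Z) (LPath.flatten_flatten R))
      (opSubst_opPath hπ U) ((opMap_opPath hπ _ _).trans ((congrArg (opPath hπ) e).trans
        (opPath_map hπ (f := fun a => a) (P.μOf H) X).symm))
    refine h₁.trans (Eq.trans ?_ h₂.symm)
    exact congrArg (_ ≫ ·) (P.assoc ⟨S, H⟩ a b).symm

/-- The cartesian morphism from the multitensor of an operad to `E`. -/
noncomputable abbrev opHom (hV : IsExtensive V) : opMultitensor hπ hV ⟶ E where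
  toNatTrans :=
    { app := opFst π
      naturality := fun _ _ s => opMap_fst π s }
  unit_comp Z := opUnit_fst π Z
  subst_comp Zss := by
    refine (opSubst_fst hπ Zss).trans ?_
    refine (Category.assoc _ _ _).symm.trans (Eq.trans ?_ (Category.assoc _ _ _))
    exact congrArg (· ≫ E.subst Zss) (opMap_fst π _).symm

/-- The pullback square of `bangPath Zs'` is cancelled from the one of its restriction along `s`. -/
lemma equifibered_opHom (hV : IsExtensive V) :
    NatTrans.Equifibered (opHom hπ hV).toNatTrans := by
  intro Zs Zs' s
  refine IsPullback.of_right ?_ ((opHom hπ hV).toNatTrans.naturality s)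
    (isPullback_opPath hπ (bangPath Zs'))
  have h : E.tensor.map s ≫ gammaPath E (bangPath Zs') =
      gammaPath E (Path.precomp s (bangPath Zs')) := (gammaPath_precomp s _).symm
  rw [h]
  exact isPullback_of_heq (isPullback_opPath hπ (Path.precomp s (bangPath Zs'))) rfl rfl rfl rfl
    (heq_of_eq (opMap_opPath hπ s _).symm) HEq.rfl HEq.rfl HEq.rfl

/-! ### The operad of the multitensor of an operad -/

noncomputable def opApp (hV : IsExtensive V) (H : S → S → V) (a b : S) :
    gammaHom (opMultitensor hπ hV) H a b ⟶ P.homOf H a b :=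
  gammaDesc (opMultitensor hπ hV) fun q => opPath hπ (Path.ofSeq H q)

lemma gammaPath_opApp (hV : IsExtensive V) {a b : S} (p : Path H Zs a b) :
    gammaPath (opMultitensor hπ hV) p ≫ opApp hπ hV H a b = opPath hπ p := by
  refine (Category.assoc _ _ _).trans ((congrArg (_ ≫ ·) (gammaι_desc _ _ _)).trans ?_)
  exact (opMap_opPath hπ _ _).trans (congrArg _ (Path.precomp_hom p))

lemma opApp_app (hV : IsExtensive V) (a b : S) :
    opApp hπ hV H a b ≫ π.appOf H a b = gammaApp (opHom hπ hV) H a b :=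
  gammaPath_hom_ext fun p => by
    rw [← Category.assoc, gammaPath_opApp, gammaPath_gammaApp]
    exact opPath_app hπ p

/-- The decomposition of `Γ E H (a, b)` over sequences of objects pulls back along `π` to one of `P
H (a, b)`. Its summands are the `opObj`, by `isPullback_opPath` at identity paths, and these are
also the summands of `Γ` of the multitensor. -/
lemma isIso_opApp (hV : IsExtensive V) (a b : S) : IsIso (opApp hπ hV H a b) := by
  refine IsCoprod.isIso (isCoprod_gammaι _ H a b) (x' := fun q => opPath hπ (Path.ofSeq H q))
    (hV.isCoprod_of_isPullback (isCoprod_gammaι E H a b) (π.appOf H a b)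
      (f := fun q => opFst π (Chain.homs H q)) fun q => ?_) fun q => ?_
  · rw [← gammaPath_ofSeq]
    exact isPullback_opPath hπ _
  · exact gammaι_desc _ _ _

noncomputable def opIsoHom (hV : IsExtensive V) (hd : (opMultitensor hπ hV).IsDistributive) :
    MonadOverSetHom (gamma (opMultitensor hπ hV) hd) P where
  app X := opApp hπ hV X.hom
  naturality {X Y} f a b := gammaPath_hom_ext fun p => by
    refine (Category.assoc _ _ _).symm.trans ((congrArg (· ≫ _) (gammaPath_map f.hom p)).trans ?_)
    refine (gammaPath_opApp hπ hV _).trans (Eq.trans ?_ (Category.assoc _ _ _))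
    refine Eq.trans ?_ (congrArg (· ≫ P.map f a b) (gammaPath_opApp hπ hV p)).symm
    exact (opPath_map hπ f.hom p).symm
  η_comp X a b := by
    have h := gammaPath_unit (E := opMultitensor hπ hV) (𝟙 (X.hom a b))
    have h' := opUnit_opPath hπ (𝟙 (X.hom a b))
    refine (congrArg (· ≫ opApp hπ hV X.hom a b) ((Category.id_comp _).symm.trans h.symm)).trans ?_
    refine (Category.assoc _ _ _).trans ((congrArg (_ ≫ ·) (gammaPath_opApp hπ hV _)).trans ?_)
    exact h'.trans (Category.id_comp _)
  -- The source is `Γ` applied twice, so the equation is tested on the decomposition over nested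
  -- sequences, where `gammaPath_flatten` and `opSubst_opPath` compute the two multiplications.
  μ_comp X a b := (isCoprod_gammaPaths X.hom hd a b).hom_ext fun r => by
    set R := Path.ofNestedSeq X.hom r
    have h₁ : gammaPath (opMultitensor hπ hV) (gammaPaths (opMultitensor hπ hV) R) ≫
        gammaμ (opMultitensor hπ hV) hd X.hom a b ≫ opApp hπ hV X.hom a b =
          opPath hπ (opPaths hπ R) ≫ P.μ X a b := by
      rw [← Category.assoc, ← gammaPath_flatten hd, Category.assoc, gammaPath_opApp]
      exact opSubst_opPath hπ R
    refine h₁.trans (Eq.trans ?_ (Category.assoc _ _ _))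
    refine congrArg (· ≫ P.μ X a b) (Eq.trans ?_ (Category.assoc _ _ _))
    refine Eq.trans ?_ (congrArg (· ≫ opApp hπ hV (P.homOf X.hom) a b)
      (gammaPath_map (f := fun a => a) (opApp hπ hV X.hom)
        (gammaPaths (opMultitensor hπ hV) R))).symm
    refine Eq.trans ?_ (gammaPath_opApp hπ hV _).symm
    refine congrArg (opPath hπ) (Eq.trans ?_ (Path.map_mapLabels _ _ _).symm)
    refine congrArg (fun k : ∀ Zs a b, Path X.hom Zs a b → (opObj π Zs ⟶ P.homOf X.hom a b) =>
      LPath.mapLabels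
        (K' := fun Z a b => Z ⟶ P.homOf X.hom a b) (opFunctor π).obj k R) ?_
    funext Zs a b p
    exact (gammaPath_opApp hπ hV p).symm

end Operad

lemma MonadOverSetHom.isIso_of_app {S T : MonadOverSet V} (θ : MonadOverSetHom S T)
    (h : ∀ X a b, IsIso (θ.app X a b)) : IsIso (C := MonadOverSet V) (X := S) (Y := T) θ := by
  choose i hi hi' using fun X a b => (h X a b).out
  let θ' : MonadOverSetHom T S :=
    { app := i
      naturality := fun {X Y} f a b => by
        have := h X a b
        refine (cancel_epi (θ.app X a b)).1 ?_
        rw [← Category.assoc, ← θ.naturality, Category.assoc, hi, Category.comp_id,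
          ← Category.assoc, hi, Category.id_comp]
      η_comp := fun X a b => by
        rw [← θ.η_comp, Category.assoc, hi, Category.comp_id]
      μ_comp := fun X a b => by
        have e : (fun a b => i X a b ≫ θ.app X a b) = fun a b => 𝟙 (T.hom X a b) :=
          funext fun a => funext fun b => hi' X a b
        have h₁ : S.mapOf (f := fun a => a) (i X) a b ≫
            S.mapOf (f := fun a => a) (θ.app X) a b = 𝟙 _ :=
          (S.mapOf_comp (f := fun a => a) (f' := fun a => a) (i X) (θ.app X) a b).trans
            ((congrArg (fun φ => S.mapOf (f := fun a => a) φ a b) e).trans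
              (S.map_id ⟨X.obj, T.hom X⟩ a b))
        have h₂ : S.mapOf (f := fun a => a) (i X) a b ≫ θ.app ⟨X.obj, S.hom X⟩ a b =
            θ.app ⟨X.obj, T.hom X⟩ a b ≫ T.mapOf (f := fun a => a) (i X) a b :=
          θ.naturality (EGraphHom.ofHoms (i X)) a b
        have h₃ : S.μ X a b ≫ θ.app X a b = (S.mapOf (f := fun a => a) (θ.app X) a b ≫
            θ.app ⟨X.obj, T.hom X⟩ a b) ≫ T.μ X a b := θ.μ_comp X a b
        have h₄ : T.μ X a b ≫ i X a b =
            (T.mapOf (f := fun a => a) (i X) a b ≫ i ⟨X.obj, S.hom X⟩ a b) ≫ S.μ X a b := by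
          have := h ⟨X.obj, T.hom X⟩ a b
          refine (cancel_epi (θ.app ⟨X.obj, T.hom X⟩ a b)).1 ?_
          have h₅ : θ.app ⟨X.obj, T.hom X⟩ a b ≫ T.μ X a b =
              S.mapOf (f := fun a => a) (i X) a b ≫ S.μ X a b ≫ θ.app X a b := by
            rw [h₃, ← Category.assoc, ← Category.assoc, h₁, Category.id_comp]
          rw [← Category.assoc, h₅, Category.assoc, Category.assoc, hi, Category.comp_id,
            ← Category.assoc, ← Category.assoc, ← h₂, Category.assoc (S.mapOf _ a b), hi,
            Category.comp_id]
        exact h₄ }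
  exact ⟨θ', MonadOverSetHom.ext (funext fun X => funext fun a => funext fun b => hi X a b),
    MonadOverSetHom.ext (funext fun X => funext fun a => funext fun b => hi' X a b)⟩

lemma gammaFunctor_essSurj [HasCoproducts.{w} V] [HasFiniteLimits V] (hV : IsExtensive V)
    {E : Multitensor V} (hE : E.IsDistributive)
    (hd : ∀ A : EMultitensor E, A.obj.left.IsDistributive)
    (hc : ∀ A : EMultitensor E, NatTrans.Equifibered (MonadHom.toNatTrans
      (MonadOverSetHom.toMonadHom (gammaHomMap (hd A) hE A.obj.hom)))) :
    (gammaFunctor E hE hd hc).EssSurj where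
  mem_essImage Q := by
    let P : MonadOverSet V := Q.obj.left
    let π : MonadOverSetHom P (gamma E hE) := Q.obj.hom
    have hπ : π.IsOperad := Q.property
    let A : EMultitensor E := ⟨Over.mk (opHom hπ hV), equifibered_opHom hπ hV⟩
    let θ : gamma (opMultitensor hπ hV) (hd A) ⟶ P := opIsoHom hπ hV (hd A)
    have hθ : IsIso θ := MonadOverSetHom.isIso_of_app _ fun X a b => isIso_opApp hπ hV a b
    refine ⟨A, ⟨ObjectProperty.isoMk _ (Over.isoMk (@asIso _ _ _ _ θ hθ) ?_)⟩⟩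
    exact MonadOverSetHom.ext (funext fun X => funext fun a => funext fun b =>
      opApp_app hπ hV a b)

/-! ### The multitensor `T^×` is cartesian and distributive -/

section Times

variable {V : Type u} [Category.{w} V] [HasFiniteProducts V]

lemma isPullback_prodMap {P X Y Z P' X' Y' Z' : V} {a : P ⟶ X} {b : P ⟶ Y} {f : X ⟶ Z}
    {g : Y ⟶ Z} {a' : P' ⟶ X'} {b' : P' ⟶ Y'} {f' : X' ⟶ Z'} {g' : Y' ⟶ Z'}
    (h : IsPullback a b f g) (h' : IsPullback a' b' f' g') :
    IsPullback (prod.map a a') (prod.map b b') (prod.map f f') (prod.map g g') := by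
  refine IsPullback.mk' (by rw [prod.map_map, prod.map_map, h.w, h'.w]) ?_ ?_
  · intro T k l h₁ h₂
    refine Limits.prod.hom_ext (h.hom_ext ?_ ?_) (h'.hom_ext ?_ ?_)
    · simpa using congrArg (· ≫ prod.fst) h₁
    · simpa using congrArg (· ≫ prod.fst) h₂
    · simpa using congrArg (· ≫ prod.snd) h₁
    · simpa using congrArg (· ≫ prod.snd) h₂
  · intro T k l e
    obtain ⟨m, h₁, h₂⟩ := h.exists_lift (k ≫ prod.fst) (l ≫ prod.fst)
      (by simpa using congrArg (· ≫ prod.fst) e)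
    obtain ⟨m', h₁', h₂'⟩ := h'.exists_lift (k ≫ prod.snd) (l ≫ prod.snd)
      (by simpa using congrArg (· ≫ prod.snd) e)
    exact ⟨prod.lift m m', Limits.prod.hom_ext (by simpa [Limits.prod.lift_fst, Limits.prod.lift_snd] using h₁) (by simpa [Limits.prod.lift_fst, Limits.prod.lift_snd] using h₁'),
      Limits.prod.hom_ext (by simpa [Limits.prod.lift_fst, Limits.prod.lift_snd] using h₂) (by simpa [Limits.prod.lift_fst, Limits.prod.lift_snd] using h₂')⟩

lemma isPullback_prodMap_fst {X Y : V} (f : X ⟶ Y) (Z : V) :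
    IsPullback (prod.map f (𝟙 Z)) prod.fst prod.fst f := by
  refine IsPullback.mk' (prod.map_fst _ _) ?_ ?_
  · intro T k l h₁ h₂
    exact Limits.prod.hom_ext h₂ (by simpa using congrArg (· ≫ prod.snd) h₁)
  · intro T k l e
    exact ⟨prod.lift l (k ≫ prod.snd), Limits.prod.hom_ext (by simpa [Limits.prod.lift_fst, Limits.prod.lift_snd] using e.symm) (by simp [Limits.prod.lift_snd]),
      Limits.prod.lift_fst _ _⟩

lemma isPullback_prodMap_snd {X Y : V} (f : X ⟶ Y) (Z : V) :
    IsPullback (prod.map (𝟙 Z) f) prod.snd prod.snd f := by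
  refine IsPullback.mk' (prod.map_snd _ _) ?_ ?_
  · intro T k l h₁ h₂
    exact Limits.prod.hom_ext (by simpa using congrArg (· ≫ prod.fst) h₁) h₂
  · intro T k l e
    exact ⟨prod.lift (k ≫ prod.fst) l, Limits.prod.hom_ext (by simp [Limits.prod.lift_fst]) (by simpa [Limits.prod.lift_fst, Limits.prod.lift_snd] using e.symm),
      Limits.prod.lift_snd _ _⟩

/-- The induction step for `timesAppend`: up to the associator, the map is a product of an identity
with `g`. -/
lemma isIso_prodLift_assoc (A : V) {B C D : V} (g : B ⨯ C ⟶ D) [IsIso g] :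
    IsIso (prod.lift (prod.fst ≫ prod.fst : (A ⨯ B) ⨯ C ⟶ A)
      (prod.map prod.snd (𝟙 C) ≫ g)) := by
  have h : prod.lift (prod.fst ≫ prod.fst : (A ⨯ B) ⨯ C ⟶ A) (prod.map prod.snd (𝟙 C) ≫ g) =
      (prod.associator A B C).hom ≫ prod.map (𝟙 A) g := by
    rw [prod.associator_hom, prod.lift_map, Category.comp_id]
    congr 2
    exact Limits.prod.hom_ext (by simp [Limits.prod.lift_fst]) (by simp [Limits.prod.lift_snd])
  rw [h]
  infer_instance

variable (T : Monad V)

lemma isPullback_timesFst {X Y : V} (f : X ⟶ Y) (Xs : List V) :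
    IsPullback (timesMap T (seqCons f (𝟙 Xs))) (timesFst T X Xs) (timesFst T Y Xs) (T.map f) := by
  have h := isPullback_prodMap_fst (T.map f) (timesObj T Xs)
  rw [← timesMap_id] at h
  exact h

lemma isPullback_timesSnd (X : V) {Xs Ys : List V} (g : Xs ⟶ Ys) :
    IsPullback (timesMap T (seqCons (𝟙 X) g)) (timesSnd T X Xs) (timesSnd T X Ys)
      (timesMap T g) := by
  have h := isPullback_prodMap_snd (timesMap T g) (T.obj X)
  rw [← T.map_id] at h
  exact h

lemma isIso_timesAppend (Xs Ys : List V) : IsIso (timesAppend T Xs Ys) := by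
  induction Xs with
  | nil =>
    refine ⟨prod.lift (terminal.from _) (𝟙 _), Limits.prod.hom_ext
      (terminalIsTerminal.hom_ext _ _) ?_, Limits.prod.lift_snd _ _⟩
    exact (Category.assoc _ _ _).trans ((congrArg (_ ≫ ·) (Limits.prod.lift_snd _ _)).trans
      ((Category.comp_id _).trans (Category.id_comp _).symm))
  | cons X Xs ih =>
    exact isIso_prodLift_assoc (T.obj X) (timesAppend T Xs Ys)

lemma isPullback_timesAppend {Xs Ys Xs' Ys' : List V} (f : Xs ⟶ Ys) (g : Xs' ⟶ Ys') :
    IsPullback (prod.map (timesMap T f) (timesMap T g)) (timesAppend T Xs Xs')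
      (timesAppend T Ys Ys') (timesMap T (seqAppend f g)) := by
  have := isIso_timesAppend T Xs Xs'
  have := isIso_timesAppend T Ys Ys'
  refine IsPullback.of_vert_isIso ⟨?_⟩
  have h := timesPair_map T (prod.fst : timesObj T Xs ⨯ timesObj T Xs' ⟶ _) prod.snd f g
  simp only [timesPair, prod.lift_fst_snd, Category.id_comp, prod.lift_fst_comp_snd_comp] at h
  exact h.symm

variable {T}

lemma exists_isPullback_timesMap [HasPullbacks V]
    (h : PreservesLimitsOfShape WalkingCospan T.toFunctor) {Xs Ys Zs : List V} (f : Xs ⟶ Zs)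
    (g : Ys ⟶ Zs) : ∃ (Ps : List V) (p : Ps ⟶ Xs) (q : Ps ⟶ Ys), IsPullback p q f g ∧
      IsPullback (timesMap T p) (timesMap T q) (timesMap T f) (timesMap T g) := by
  induction f using seqHom_induction generalizing Ys with
  | nil => cases Ys with
    | nil => exact ⟨[], 𝟙 _, 𝟙 _, isPullback_seqNil _ _ _ _,
        IsPullback.of_vert_isIso (snd := 𝟙 (timesObj T [])) (f := 𝟙 _) ⟨rfl⟩⟩
    | cons Y Ys => exact g.elim
  | cons f fs ih => cases Ys with
    | nil => exact g.elim
    | cons Y Ys =>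
      obtain ⟨Ps, p, q, h₁, h₂⟩ := ih g.2
      have h₀ := IsPullback.of_hasPullback f g.1
      exact ⟨_, seqCons (pullback.fst f g.1) p, seqCons (pullback.snd f g.1) q,
        isPullback_seqCons h₀ h₁, isPullback_prodMap (h₀.map T.toFunctor) h₂⟩

lemma preservesPullbacks_timesFunctor [HasPullbacks V]
    (h : PreservesLimitsOfShape WalkingCospan T.toFunctor) :
    PreservesLimitsOfShape WalkingCospan (timesFunctor T) := by
  refine preservesLimitsOfShape_walkingCospan_of_forall_isPullback fun X Y Z f g _ => ?_
  obtain ⟨Ps, p, q, h₁, h₂⟩ := exists_isPullback_timesMap h f g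
  exact ⟨Ps, p, q, h₁, h₂⟩

/-- The head and the tail of a sequence are changed one at a time. In either case the projection
onto the changing factor gives a pullback square; cancelling it leaves a naturality square of the
multiplication of `T`, or the inductive case. -/
lemma isPullback_timesAct (hT : IsCartesianMonad T) {Xs Ys : List V} (f : Xs ⟶ Ys) :
    IsPullback (T.map (timesMap T f)) (timesAct T Xs) (timesAct T Ys) (timesMap T f) := by
  have := hT.preservesPullbacks
  induction f using seqHom_induction with
  | nil =>
    rw [timesMap_id]
    exact IsPullback.of_horiz_isIso ⟨timesNil_ext T _ _⟩
  | @cons X Y Xs Ys f fs ih =>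
    have h₁ : IsPullback (T.map (timesMap T (seqCons f (𝟙 Xs)))) (timesAct T (X :: Xs))
        (timesAct T (Y :: Xs)) (timesMap T (seqCons f (𝟙 Xs))) := by
      refine IsPullback.of_bot ?_ (timesAct_naturality T _) (isPullback_timesFst T f Xs)
      rw [timesAct_fst, timesAct_fst]
      exact ((isPullback_timesFst T f Xs).map T.toFunctor).paste_vert (hT.μ f)
    have h₂ : IsPullback (T.map (timesMap T (seqCons (𝟙 Y) fs))) (timesAct T (Y :: Xs))
        (timesAct T (Y :: Ys)) (timesMap T (seqCons (𝟙 Y) fs)) := by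
      refine IsPullback.of_bot ?_ (timesAct_naturality T _) (isPullback_timesSnd T Y fs)
      rw [timesAct_snd, timesAct_snd]
      exact ((isPullback_timesSnd T Y fs).map T.toFunctor).paste_vert ih
    have h := h₁.paste_horiz h₂
    rw [← T.map_comp, ← timesMap_comp, seqCons_comp, Category.comp_id, Category.id_comp] at h
    exact h

lemma isPullback_timesSubst (hT : IsCartesianMonad T) {Z Z' : List (List V)} (f : Z ⟶ Z') :
    IsPullback (timesMap T (seqMapMap (timesFunctor T) f)) (timesSubst T Z) (timesSubst T Z')
      (timesMap T (seqFlattenMap f)) := by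
  induction f using seqHom_induction with
  | nil => exact IsPullback.of_vert_isIso (snd := 𝟙 _) (f := 𝟙 _) ⟨rfl⟩
  | @cons L L' Z Z' f fs ih =>
    have h : ∀ (L : List V) (Z : List (List V)), timesSubst T (L :: Z) =
        prod.map (timesAct T L) (timesSubst T Z) ≫ timesAppend T L Z.flatten := fun L Z =>
      congrArg (· ≫ timesAppend T L Z.flatten) (prod.lift_fst_comp_snd_comp _ _)
    rw [h, h]
    exact (isPullback_prodMap (isPullback_timesAct hT f) ih).paste_vert
      (isPullback_timesAppend T f (seqFlattenMap fs))

lemma isCartesian_timesMultitensor [HasPullbacks V] (hT : IsCartesianMonad T) :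
    (timesMultitensor T).IsCartesian where
  preservesPullbacks := preservesPullbacks_timesFunctor hT.preservesPullbacks
  unit X Y f := by
    refine IsPullback.of_bot ?_ (timesUnit_naturality T f) (isPullback_timesFst T f [])
    have h : ∀ X : V, timesUnit T X ≫ timesFst T X [] = T.η.app X := fun X => timesLift_fst T _ _
    have h' := hT.η f
    rw [← h, ← h] at h'
    exact h'
  subst Z Z' f := isPullback_timesSubst hT f

/-- Varying one factor makes the product the base change of that factor along a projection. Thus `T`
preserving coproducts, together with their stability under pullback, suffices; distributivity of
products over coproducts comes from extensivity. -/
lemma isDistributive_timesMultitensor [HasCoproducts.{w} V] (hV : IsExtensive V)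
    (hT : ∀ I : Type w, PreservesColimitsOfShape (Discrete I) T.toFunctor) :
    (timesMultitensor T).IsDistributive := by
  intro Xs Ys I
  refine preservesColimitsOfShape_discrete _ fun X => ⟨_, _, isCoprod_sigma X, ?_⟩
  have := hT I
  induction Xs with
  | nil =>
    exact hV.isCoprod_of_isPullback ((isCoprod_sigma X).map T.toFunctor) (timesFst T (∐ X) Ys)
      fun i => isPullback_timesFst T (Sigma.ι X i) Ys
  | cons Z Xs ih =>
    exact hV.isCoprod_of_isPullback ih (timesSnd T Z (Xs ++ (∐ X) :: Ys))
      fun i => isPullback_timesSnd T Z (seqAppend (𝟙 Xs) (seqCons (Sigma.ι X i) (𝟙 Ys)))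

end Times

/-! ### `Γ E` preserves coproducts -/

section Coproducts

variable {V : Type u} [Category.{w} V] {E : Multitensor V}

/-- The case of the empty coproduct in distributivity. -/
lemma isInitial_tensor (hE : E.IsDistributive) (Xs Ys : List V) {Z : V} (hZ : IsInitial Z) :
    Nonempty (IsInitial (E.tensor.obj (Xs ++ Z :: Ys))) := by
  have := hE Xs Ys PEmpty
  have h : IsCoprod (fun i : PEmpty.{w + 1} => (i.elim : V)) Z fun i => i.elim :=
    ⟨fun t => ⟨hZ.to _, fun i => i.elim, fun _ _ => hZ.hom_ext _ _⟩⟩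
  exact (h.map (seqInsert Xs Ys ⋙ E.tensor)).isInitial

lemma isIso_seqCons {X Y : V} {Xs Ys : List V} (f : X ⟶ Y) (g : Xs ⟶ Ys) [IsIso f] [IsIso g] :
    IsIso (seqCons f g) :=
  ⟨seqCons (inv f) (inv g), Prod.ext (IsIso.hom_inv_id f) (IsIso.hom_inv_id g),
    Prod.ext (IsIso.inv_hom_id f) (IsIso.inv_hom_id g)⟩

lemma isIso_labelsHom {S S' : Type w} {J : S → S → Type w} {J' : S' → S' → Type w} {f : S → S'}
    {g : ∀ a b, J a b → J' (f a) (f b)} {F : ∀ a b, J a b → V} {F' : ∀ a b, J' a b → V}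
    (ψ : ∀ a b j, F a b j ⟶ F' (f a) (f b) (g a b j)) (hψ : ∀ a b j, IsIso (ψ a b j)) {a b : S}
    (p : Chain J a b) : IsIso (Chain.labelsHom ψ p) := by
  induction p with
  | nil => exact IsIso.id _
  | cons j p ih =>
    have := hψ _ _ j
    exact isIso_seqCons _ _

section

variable {I : Type w} {R : I → Type w} {H : (Σ i, R i) → (Σ i, R i) → V}

/-- A sequence in a disjoint union lies in one of the summands, or it passes from one summand to
another one. -/
lemma objSeq_sigma_cases (init : ∀ x y, x.1 ≠ y.1 → Nonempty (IsInitial (H x y)))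
    {x y : Σ i, R i} (q : ObjSeq x y) :
    (∃ Xs Z Ys, Chain.homs H q = Xs ++ Z :: Ys ∧ Nonempty (IsInitial Z)) ∨
      ∃ (i : I) (a b : R i) (q' : ObjSeq a b), x = ⟨i, a⟩ ∧ y = ⟨i, b⟩ ∧
        HEq q (Chain.mapSeq (Sigma.mk i) q') := by
  induction q with
  | nil x => exact Or.inr ⟨x.1, x.2, x.2, Chain.nil _, rfl, rfl, HEq.rfl⟩
  | @cons x y z j q ih =>
    by_cases hxy : x.1 = y.1
    · obtain ⟨Xs, Z, Ys, h, hZ⟩ | ⟨i, b, c, q', rfl, rfl, h⟩ := ih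
      · exact Or.inl ⟨H x y :: Xs, Z, Ys, congrArg (List.cons (H x y)) h, hZ⟩
      · obtain ⟨i, a⟩ := x
        obtain rfl : i = _ := hxy
        obtain rfl := eq_of_heq h
        exact Or.inr ⟨i, a, c, Chain.cons PUnit.unit q', rfl, rfl, HEq.rfl⟩
    · exact Or.inl ⟨[], H x y, Chain.homs H q, rfl, init x y hxy⟩

variable [HasCoproducts.{w} V] (hE : E.IsDistributive)
  (init : ∀ x y, x.1 ≠ y.1 → Nonempty (IsInitial (H x y)))

include hE init

lemma isInitial_gammaHom {x y : Σ i, R i} (h : x.1 ≠ y.1) :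
    Nonempty (IsInitial (gammaHom E H x y)) := by
  have hq : ∀ q : ObjSeq x y, Nonempty (IsInitial (E.tensor.obj (Chain.homs H q))) := by
    intro q
    obtain ⟨Xs, Z, Ys, e, ⟨hZ⟩⟩ | ⟨i, a, b, q', rfl, rfl, _⟩ := objSeq_sigma_cases init q
    · rw [e]
      exact isInitial_tensor hE Xs Ys hZ
    · exact absurd rfl h
  -- All summands are initial, so they may all be left out, down to the empty index set.
  exact ((isCoprod_gammaι E H x y).restrict (fun i : PEmpty.{w + 1} => i.elim)
    (fun i => i.elim) fun q _ => hq q).isInitial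

/-- A sequence which leaves the summand `i` contributes an initial object and can be left out. The
sequences that remain are exactly those of `R i`, with isomorphic homs. -/
lemma isIso_gammaMap_sigma (i : I) {K : R i → R i → V}
    (φ : ∀ a b, K a b ⟶ H ⟨i, a⟩ ⟨i, b⟩) (hφ : ∀ a b, IsIso (φ a b)) (a b : R i) :
    IsIso (gammaMap E (f := Sigma.mk i) φ a b) := by
  have hi : Function.Injective fun q : ObjSeq a b => Chain.mapSeq (Sigma.mk (β := R) i) q := by
    intro q q' h
    refine Chain.verts_injective ?_
    have h' := congrArg Chain.verts h
    simp only [Chain.verts_map] at h'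
    exact List.map_injective_iff.2 (fun _ _ e => eq_of_heq (Sigma.mk.inj e).2) h'
  have h := (isCoprod_gammaι E H (Sigma.mk i a) (Sigma.mk i b)).restrict _ hi fun q hq => by
    obtain ⟨Xs, Z, Ys, e, ⟨hZ⟩⟩ | ⟨j, a', b', q', ha, hb, h⟩ := objSeq_sigma_cases init q
    · rw [e]
      exact isInitial_tensor hE Xs Ys hZ
    · cases ha
      cases hb
      exact absurd (eq_of_heq h).symm (hq q')
  have hl : ∀ q : ObjSeq a b, IsIso (E.tensor.map (Chain.labelsHom (F := fun a b _ => K a b)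
      (F' := fun a b _ => H a b) (J' := fun _ _ : (Σ i, R i) => PUnit.{w + 1})
      (f := Sigma.mk i) (g := fun _ _ _ => PUnit.unit) (fun a b _ => φ a b) q)) := fun q => by
    have := isIso_labelsHom (F := fun a b _ => K a b)
      (F' := fun a b _ => H a b) (J' := fun _ _ : (Σ i, R i) => PUnit.{w + 1})
      (f := Sigma.mk i) (g := fun _ _ _ => PUnit.unit) (fun a b _ => φ a b)
      (fun a b _ => hφ a b) q
    infer_instance
  exact (isCoprod_gammaι E K a b).isIso (h.iso_comp fun q => E.tensor.map (Chain.labelsHom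
    (F := fun a b _ => K a b) (F' := fun a b _ => H a b)
    (J' := fun _ _ : (Σ i, R i) => PUnit.{w + 1}) (f := Sigma.mk i)
    (g := fun _ _ _ => PUnit.unit) (fun a b _ => φ a b) q)) fun q => gammaι_gammaMap φ q

end

lemma preservesCoproducts_gamma [HasCoproducts.{w} V] (hE : E.IsDistributive) (I : Type w) :
    PreservesColimitsOfShape (Discrete I) (gamma E hE).toMonad.toFunctor := by
  refine preservesColimitsOfShape_discrete _ fun X => ⟨_, _, EGraph.isCoprod_sigma X, ?_⟩
  have init : ∀ x y : Σ i, (X i).obj, x.1 ≠ y.1 →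
      Nonempty (IsInitial ((EGraph.sigma X).hom x y)) := fun x y h =>
    EGraph.sigma_hom_isInitial X h x.2 y.2
  refine EGraph.isCoprod_of_hom (fun i j a b h => h) (fun c => ⟨c.1, c.2, rfl⟩) ?_ ?_
  · intro i a b
    exact isIso_gammaMap_sigma (R := fun i => (X i).obj) hE init i (EGraph.sigmaι X i).hom
      (EGraph.isIso_sigmaι_hom X i) a b
  · intro i j a b hij
    exact isInitial_gammaHom (R := fun i => (X i).obj) hE init (x := ⟨i, a⟩) (y := ⟨j, b⟩) hij

end Coproducts

/-! ### The equivalence -/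

lemma gamma_equivalence {V : Type u} [Category.{w} V] [HasCoproducts.{w} V] [HasFiniteLimits V]
    (hV : IsExtensive V) (E : Multitensor V) (hE : E.IsDistributive) (hc : E.IsCartesian) :
    IsCartesianMonad (gamma E hE).toMonad ∧
      ∃ (hd : ∀ A : EMultitensor E, A.obj.left.IsDistributive)
        (hcart : ∀ A : EMultitensor E, NatTrans.Equifibered (MonadHom.toNatTrans
          (MonadOverSetHom.toMonadHom (gammaHomMap (hd A) hE A.obj.hom)))),
        (gammaFunctor E hE hd hcart : EMultitensor E ⥤ OperadOverSet (gamma E hE)).IsEquivalence := by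
  have hd : ∀ A : EMultitensor E, A.obj.left.IsDistributive := fun A =>
    Multitensor.IsDistributive.of_equifibered hV hE A.obj.hom A.property
  have hcart : ∀ A : EMultitensor E, NatTrans.Equifibered (MonadHom.toNatTrans
      (MonadOverSetHom.toMonadHom (gammaHomMap (hd A) hE A.obj.hom))) := fun A =>
    equifibered_gammaHomMap hV (hd A) hE A.obj.hom A.property
  exact ⟨isCartesianMonad_gamma hV hE hc, hd, hcart,
    { faithful := gammaFunctor_faithful hV hE hd hcart
      full := gammaFunctor_full hV hE hd hcart
      essSurj := gammaFunctor_essSurj hV hE hd hcart }⟩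

/-! ### The strict `n`-category monads -/

section StrictNCategories

/-- The category is lextensive, and the monad is cartesian and preserves coproducts. -/
structure CategoryWithMonad.IsLextensive (C : CategoryWithMonad.{w}) : Prop where
  hasFiniteLimits : HasFiniteLimits C.carrier
  isExtensive : IsExtensive C.carrier
  isCartesianMonad : IsCartesianMonad C.monad
  preservesCoproducts : ∀ I : Type w, PreservesColimitsOfShape (Discrete I) C.monad.toFunctor

lemma isCartesianMonad_id (C : Type u) [Category.{w} C] : IsCartesianMonad (Monad.id C) where
  preservesPullbacks := inferInstanceAs (PreservesLimitsOfShape WalkingCospan (𝟭 C))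
  η X Y f := IsPullback.of_vert_isIso (C := C) (snd := 𝟙 X) (f := 𝟙 Y) (fst := f) (g := f)
    ⟨(Category.comp_id f).trans (Category.id_comp f).symm⟩
  μ X Y f := IsPullback.of_vert_isIso (C := C) (snd := 𝟙 X) (f := 𝟙 Y) (fst := f) (g := f)
    ⟨(Category.comp_id f).trans (Category.id_comp f).symm⟩

lemma CategoryWithMonad.IsLextensive.isDistributive {C : CategoryWithMonad.{w}}
    (h : C.IsLextensive) : (timesMultitensor C.monad).IsDistributive :=
  isDistributive_timesMultitensor h.isExtensive h.preservesCoproducts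

lemma CategoryWithMonad.IsLextensive.isCartesian {C : CategoryWithMonad.{w}}
    (h : C.IsLextensive) : (timesMultitensor C.monad).IsCartesian :=
  have := h.hasFiniteLimits
  isCartesian_timesMultitensor h.isCartesianMonad

lemma strictNCat_succ (n : ℕ)
    (h : (timesMultitensor (strictNCat.{w} n).monad).IsDistributive) :
    strictNCat.{w} (n + 1) =
      { carrier := EGraph (strictNCat.{w} n).carrier
        monad := (gamma (timesMultitensor (strictNCat.{w} n).monad) h).toMonad } := by
  rw [strictNCat, dif_pos h]

/-- Preservation of coproducts has to be carried through the induction: it makes `T^×` distributive,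
which is needed for the next monad to be `Γ (T^×)` rather than the default value, and it is regained
from `preservesCoproducts_gamma`. -/
lemma isLextensive_strictNCat (n : ℕ) : (strictNCat.{w} n).IsLextensive := by
  induction n with
  | zero =>
    exact ⟨inferInstanceAs (HasFiniteLimits (Type w)), isExtensive_type,
      isCartesianMonad_id (Type w),
      fun I => inferInstanceAs (PreservesColimitsOfShape (Discrete I) (𝟭 (Type w)))⟩
  | succ n ih =>
    have := ih.hasFiniteLimits
    rw [strictNCat_succ n ih.isDistributive]
    exact ⟨inferInstanceAs (HasFiniteLimits (EGraph (strictNCat.{w} n).carrier)),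
      EGraph.isExtensive ih.isExtensive,
      isCartesianMonad_gamma ih.isExtensive ih.isDistributive ih.isCartesian,
      preservesCoproducts_gamma ih.isDistributive⟩

end StrictNCategories

end MultitensorOperad

theorem mainTheorem4 {V : Type u} [Category.{w} V] [HasCoproducts.{w} V] [HasFiniteLimits V]
    (hV : IsExtensive V) (E : Multitensor V) (hE : E.IsDistributive) (hc : E.IsCartesian) :
    (IsCartesianMonad (gamma E hE).toMonad ∧
      ∃ (hd : ∀ A : EMultitensor E, A.obj.left.IsDistributive)
        (hcart : ∀ A : EMultitensor E, NatTrans.Equifibered (MonadHom.toNatTrans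
          (MonadOverSetHom.toMonadHom (gammaHomMap (hd A) hE A.obj.hom)))),
        (gammaFunctor E hE hd hcart : EMultitensor E ⥤ OperadOverSet (gamma E hE)).IsEquivalence) ∧
    (∀ n : ℕ,
      HasFiniteLimits (strictNCat.{w} n).carrier ∧ IsExtensive (strictNCat.{w} n).carrier ∧
      (timesMultitensor (strictNCat.{w} n).monad).IsCartesian ∧
      ∃ h : (timesMultitensor (strictNCat.{w} n).monad).IsDistributive,
        strictNCat.{w} (n + 1) =
          { carrier := EGraph (strictNCat.{w} n).carrier
            monad := (gamma (timesMultitensor (strictNCat.{w} n).monad) h).toMonad } ∧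
        IsCartesianMonad (gamma (timesMultitensor (strictNCat.{w} n).monad) h).toMonad ∧
        ∃ (hd : ∀ A : EMultitensor (timesMultitensor (strictNCat.{w} n).monad),
            A.obj.left.IsDistributive)
          (hcart : ∀ A : EMultitensor (timesMultitensor (strictNCat.{w} n).monad),
            NatTrans.Equifibered (MonadHom.toNatTrans
              (MonadOverSetHom.toMonadHom (gammaHomMap (hd A) h A.obj.hom)))),
          (gammaFunctor (timesMultitensor (strictNCat.{w} n).monad) h hd hcart :
            EMultitensor (timesMultitensor (strictNCat.{w} n).monad) ⥤
              OperadOverSet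
                (gamma (timesMultitensor (strictNCat.{w} n).monad) h)).IsEquivalence) := by
  refine ⟨gamma_equivalence hV E hE hc, fun n => ?_⟩
  have h := isLextensive_strictNCat.{w} n
  have := h.hasFiniteLimits
  exact ⟨h.hasFiniteLimits, h.isExtensive, h.isCartesian, h.isDistributive,
    strictNCat_succ n h.isDistributive,
    gamma_equivalence h.isExtensive _ h.isDistributive h.isCartesian⟩
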